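/- Let $I_\mu(z)=\sum_{k\ge 0}\frac{(z/2)^{2k+\mu}}{k!\,\Gamma(k+\mu+1)}$ be the modified Bessel function of the first kind and $K_\mu(z)=\frac{\pi}{2\sin(\pi\mu)}\,[I_{-\mu}(z)-I_\mu(z)]$ the Macdonald function (with limiting values for integer $\mu$). Consider the index transform $$(Ff)(\tau)=\frac{\sqrt\pi}{\cosh(\pi\tau)}\int_0^\infty e^{-x/2}\,\mathrm{Re}\Big[I_{i\tau}\Big(\frac x2\Big)\Big]f(x)\,dx,\qquad \tau\in\mathbb R,$$ for complex-valued $f$ on $\mathbb R_+=(0,\infty)$. (i) $F$ is well defined as a bounded linear operator from $L_1(\mathbb R_+)$ to the space of bounded continuous functions on $\mathbb R$, the integral being absolutely convergent for every $\tau$, and $$\sup_{\tau\in\mathbb R}|(Ff)(\tau)|\le\sqrt\pi\,\|f\|_{1}.$$ (ii) Let $0<\nu<\frac12$, $1<p\le 2$, $q=p/(p-1)$. Let $f$ be a locally integrable function on $\mathbb R_+$ (for example $f\in L_1(\mathbb R_+)$) which has on the line $\mathrm{Re}\,s=1-\nu$ a Mellin transform $f^*(s)=\int_0^\infty f(x)x^{s-1}dx$,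 the integral being convergent in mean, i.e. $\int_{1/N}^N f(x)x^{s-1}dx\to f^*(s)$ as $N\to\infty$ in the norm of $L_r(1-\nu-i\infty,1-\nu+i\infty)$ for some $r\in[1,\infty]$. If $$\frac{f^*(s)}{\Gamma(1-s)}\in L_p(1-\nu-i\infty,\,1-\nu+i\infty),$$ then the integral $$\varphi(x)=\frac1{2\pi i}\int_{1-\nu-i\infty}^{1-\nu+i\infty}\frac{f^*(s)}{\Gamma(1-s)}\,x^{-s}\,ds$$ converges in the norm of $L_{1-\nu,q}(\mathbb R_+)$, where $\|\varphi\|_{1-\nu,q}=\big(\int_0^\infty|\varphi(x)|^q x^{(1-\nu)q-1}dx\big)^{1/q}$, to a function $\varphi$ of this space, and $Ff$ is the Lebedev transform of $\varphi$: for every $\tau\in\mathbb R$ $$(Ff)(\tau)=\frac{2\sqrt\pi}{\cosh(\pi\tau)}\int_0^\infty \mathrm{Re}\big[I_{i\tau}(\sqrt x)\big]\,K_{i\tau}(\sqrt x)\,\varphi(x)\,dx,$$ where this integral and the one defining $(Ff)(\tau)$ converge absolutely. -/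

import Mathlib

open MeasureTheory Set Filter Topology
open scoped ENNReal BoundedContinuousFunction

noncomputable section

/-- The modified Bessel function of the first kind `I_ν(z)`, by its power series
`∑ (z/2)^(2k+ν) / (k! Γ(k+ν+1))` (principal branch of the power; since `Complex.Gamma` is `0` at its
poles and `x / 0 = 0`, the terms at the poles of `Γ` vanish, as they should). -/
def besselI (ν z : ℂ) : ℂ :=
  ∑' k : ℕ, (z / 2) ^ (2 * (k : ℂ) + ν) / ((k.factorial : ℂ) * Complex.Gamma ((k : ℂ) + ν + 1))

/-- The quotient `π (I_{-ν}(z) - I_ν(z)) / (2 sin (π ν))`. -/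
def macdonaldQuotient (ν z : ℂ) : ℂ :=
  (Real.pi : ℂ) / (2 * Complex.sin ((Real.pi : ℂ) * ν)) * (besselI (-ν) z - besselI ν z)

open Classical in
/-- The Macdonald function (modified Bessel function of the second kind) `K_ν(z)`: the quotient
above, with its limiting value at the integers `ν`, where the quotient has the form `0 / 0`. -/
def macdonaldK (ν z : ℂ) : ℂ :=
  if Complex.sin ((Real.pi : ℂ) * ν) = 0 then
    limUnder (𝓝[≠] ν) (fun μ : ℂ => macdonaldQuotient μ z)
  else macdonaldQuotient ν z

/-- The function `x ↦ e^{-x/2} Re I_{iτ}(x/2)` under the integral sign in the transform `F`. -/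
def skalskayaKernel (τ x : ℝ) : ℝ :=
  Real.exp (-x / 2) * (besselI (Complex.I * (τ : ℂ)) (((x / 2 : ℝ)) : ℂ)).re

/-- The index transform
`(F f)(τ) = (√π / cosh (π τ)) ∫_0^∞ e^{-x/2} Re [I_{iτ}(x/2)] f(x) dx`. -/
def indexF (f : ℝ → ℂ) (τ : ℝ) : ℂ :=
  ((Real.sqrt Real.pi / Real.cosh (Real.pi * τ) : ℝ) : ℂ) *
    ∫ x in Ioi (0 : ℝ), (skalskayaKernel τ x : ℂ) * f x

/-- The kernel `x ↦ Re [I_{iτ}(√x)] K_{iτ}(√x)` of the Lebedev transform. -/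
def lebedevKernel (τ x : ℝ) : ℂ :=
  ((besselI (Complex.I * (τ : ℂ)) ((Real.sqrt x : ℝ) : ℂ)).re : ℂ) *
    macdonaldK (Complex.I * (τ : ℂ)) ((Real.sqrt x : ℝ) : ℂ)

/-- The Lebedev transform
`τ ↦ (2 √π / cosh (π τ)) ∫_0^∞ Re [I_{iτ}(√x)] K_{iτ}(√x) φ(x) dx`. -/
def lebedevTransform (φ : ℝ → ℂ) (τ : ℝ) : ℂ :=
  ((2 * Real.sqrt Real.pi / Real.cosh (Real.pi * τ) : ℝ) : ℂ) *
    ∫ x in Ioi (0 : ℝ), lebedevKernel τ x * φ x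

/-- The measure `x^(ν p - 1) dx` on `(0, ∞)`, so that `eLpNorm φ (ENNReal.ofReal p)` with respect to
it is the norm `(∫_0^∞ |φ(x)|^p x^(ν p - 1) dx)^(1/p)` of the space `L_{ν,p}(ℝ_+)`. -/
def mellinWeight (ν p : ℝ) : Measure ℝ :=
  (volume.restrict (Ioi (0 : ℝ))).withDensity (fun x => ENNReal.ofReal (x ^ (ν * p - 1)))

/-- The point `σ + i t` of the vertical line `Re s = σ`. -/
def vline (σ t : ℝ) : ℂ := (σ : ℂ) + Complex.I * (t : ℂ)

/-- `F` is, on the line `Re s = σ`, the Mellin transform `∫_0^∞ f(x) x^(s-1) dx` of the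
locally integrable function `f` on `(0, ∞)`, the integral being convergent in mean: for some
exponent `1 ≤ r ≤ ∞` the integrals over `[1/N, N]` tend to `F` in the norm of `L_r` of the line.
(Absolutely convergent integrals are included through `r = ∞`, and the transform of a function in
`L_{σ,p}`, `1 < p ≤ 2`, through `r = p / (p - 1)`.) -/
def IsMellinTransformOnLine (f : ℝ → ℂ) (σ : ℝ) (F : ℂ → ℂ) : Prop :=
  LocallyIntegrableOn f (Ioi (0 : ℝ)) ∧
  AEStronglyMeasurable (fun t : ℝ => F (vline σ t)) volume ∧
  ∃ r : ℝ≥0∞, 1 ≤ r ∧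
    Tendsto (fun N : ℝ => eLpNorm (fun t : ℝ =>
      (∫ x in Ioc N⁻¹ N, f x * (x : ℂ) ^ (vline σ t - 1)) - F (vline σ t)) r volume)
      atTop (𝓝 0)

/-- The truncated inverse Mellin integral
`(1 / (2 π i)) ∫_{σ - iT}^{σ + iT} H(s) x^(-s) ds`, parametrized by `s = σ + i t`. -/
def truncMellinInv (σ : ℝ) (H : ℂ → ℂ) (T x : ℝ) : ℂ :=
  (1 / (2 * (Real.pi : ℂ))) *
    ∫ t in Ioc (-T) T, H (vline σ t) * (x : ℂ) ^ (-vline σ t)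

end

/-!
The theorem rests on one identity between special functions and on Mellin inversion.

**The kernel identity.** For `y > 0`,
`∫_0^∞ e^(-y/w) (e^(-w/2) Re I_{iτ}(w/2)) dw / w = 2 Re[I_{iτ}(√y)] K_{iτ}(√y)`
(`integral_skalskayaKernel`). It is proved with `ν` in the strip `0 < Re ν < 1` in place of `iτ`
(`integral_exp_mul_besselI`): Poisson's integral writes `e^(-w/2) I_ν(w/2)` as a Beta average of
`w^ν e^(-ws)`, so that the left side is a Beta average of the integrals
`∫_0^∞ u^(ν-1) e^(-u-x/u) du`. These are expressed through `I_{-ν}` and `I_ν` by solving the linear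
system that two Wronskian identities give (`macdonaldIntegral_eq`), and integrating the power series
term by term produces the series of the products `I_ν I_{-ν}` and `I_ν²`
(`hasSum_besselSeries_mul`, by the Chu–Vandermonde identity). Dominated convergence then moves `ν` to
the imaginary axis, where `K_{iτ}` is real.

**The bound on `L_1`.** The dominating series of `I_0` gives
`|I_{iτ}(y)| ≤ e^y / |Γ(1+iτ)| ≤ e^y cosh(πτ)`, because `|Γ(1+iτ)|^(-2) = sinh(πτ)/(πτ)`. The kernel
of `F` is thus at most `cosh(πτ)`; the same argument with one more factor `y^(-1/2)` gives
decay of order `x^(-δ)`, `0 ≤ δ ≤ 1/2` (`abs_skalskayaKernel_le_rpow`).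

**The representation.** Put `ψ(s) = f^*(s) / Γ(1-s)`. In the variable `log x` the inverse Mellin
transform is a Fourier transform, so the Hausdorff–Young inequality (`exists_eLpNorm_fourier_le`,
proved by Marcinkiewicz interpolation with an unspecified constant) makes its truncations converge to
some `φ` in `L_{1-ν,q}`. The Laplace average `(1/x) ∫_0^∞ e^(-y/x) φ(y) dy` multiplies the Mellin
transform by `Γ(1-s)`, so it is the inverse Mellin integral of `f^*` (`integral_limit_mul_exp`), which
converges absolutely since `Γ(1-s)` lies in `L_q`. By uniqueness of Mellin transforms convergent in mean
(`ae_eq_mellinInvLine`) it equals `f` almost everywhere. Inserting this expression for `f` in `F f`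
and interchanging the integrals, the kernel identity yields the Lebedev transform of `φ`. The
interchange is legitimate by Hölder's inequality and the decay `x^(-δ)` of the kernel for one
exponent `δ < ν` and one `δ > ν`; this is where `ν < 1/2` is needed.
-/

open FourierTransform SchwartzMap

/-! ### The power series of the Bessel functions -/

/-- The entire function `∑ x^k / (k! Γ(c+k))` (the regularized hypergeometric function `₀F₁(; c; x)`),
through which the Bessel functions are expressed. -/
noncomputable def besselSeries (c x : ℂ) : ℂ :=
  ∑' k : ℕ, x ^ k * ((k.factorial : ℂ)⁻¹ * (Complex.Gamma (c + k))⁻¹)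

theorem inv_Gamma_eq (s : ℂ) : (Complex.Gamma s)⁻¹ = s * (Complex.Gamma (s + 1))⁻¹ :=
  Complex.one_div_Gamma_eq_self_mul_one_div_Gamma_add_one s

/-- Once `‖c + k‖ ≥ 1`, the numbers `1 / |Γ(c + k)|` decrease in `k`; the remaining finitely many
arguments lie in a compact set. -/
theorem exists_norm_inv_Gamma_add_natCast_le (R : ℝ) :
    ∃ M : ℝ, 0 ≤ M ∧ ∀ c : ℂ, ‖c‖ ≤ R → ∀ k : ℕ, ‖(Complex.Gamma (c + k))⁻¹‖ ≤ M := by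
  obtain ⟨n, hn⟩ := exists_nat_ge (R + 1)
  obtain ⟨M, hM⟩ := (isCompact_closedBall (0 : ℂ) (R + n)).exists_bound_of_continuousOn
    Complex.differentiable_one_div_Gamma.continuous.continuousOn
  refine ⟨max M 0, le_max_right _ _, fun c hc k => ?_⟩
  have small : ∀ k ≤ n, ‖(Complex.Gamma (c + k))⁻¹‖ ≤ M := by
    intro k hk
    refine hM _ ?_
    rw [mem_closedBall_zero_iff]
    have : ‖(k : ℂ)‖ ≤ n := by simpa using hk
    exact (norm_add_le _ _).trans (add_le_add hc this)
  refine le_trans ?_ (le_max_left M 0)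
  rcases le_total k n with hk | hk
  · exact small k hk
  · induction k, hk using Nat.le_induction with
    | base => exact small n le_rfl
    | succ k hk ih =>
      rw [inv_Gamma_eq, norm_mul] at ih
      have h1 : 1 ≤ ‖c + (k : ℂ)‖ := by
        have h2 : ‖(k : ℂ)‖ ≤ ‖c + k‖ + ‖c‖ := by
          simpa using norm_sub_le (c + (k : ℂ)) c
        have h3 : (n : ℝ) ≤ k := by exact_mod_cast hk
        simp only [Complex.norm_natCast] at h2
        linarith
      have h4 : c + ((k + 1 : ℕ) : ℂ) = c + k + 1 := by push_cast; ring
      rw [h4]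
      exact (le_mul_of_one_le_left (norm_nonneg _) h1).trans ih

theorem summable_besselSeries_norm (c x : ℂ) :
    Summable fun k : ℕ => ‖x ^ k * ((k.factorial : ℂ)⁻¹ * (Complex.Gamma (c + k))⁻¹)‖ := by
  obtain ⟨M, hM0, hM⟩ := exists_norm_inv_Gamma_add_natCast_le ‖c‖
  refine Summable.of_nonneg_of_le (fun _ => norm_nonneg _) (fun k => ?_)
    ((Real.summable_pow_div_factorial ‖x‖).mul_right M)
  rw [norm_mul, norm_mul, norm_pow, norm_inv, Complex.norm_natCast, ← mul_assoc, ← div_eq_mul_inv]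
  exact mul_le_mul_of_nonneg_left (hM c le_rfl k) (by positivity)

theorem hasSum_besselSeries (c x : ℂ) :
    HasSum (fun k : ℕ => x ^ k * ((k.factorial : ℂ)⁻¹ * (Complex.Gamma (c + k))⁻¹))
      (besselSeries c x) :=
  (summable_besselSeries_norm c x).of_norm.hasSum

theorem besselSeries_zero (c : ℂ) : besselSeries c 0 = (Complex.Gamma c)⁻¹ := by
  have h := hasSum_single (f := fun k : ℕ =>
    (0 : ℂ) ^ k * ((k.factorial : ℂ)⁻¹ * (Complex.Gamma (c + k))⁻¹)) 0 (fun k hk => by simp [hk])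
  simpa using (hasSum_besselSeries c 0).unique h

theorem hasSum_natCast_mul_besselSeries (c x : ℂ) :
    HasSum (fun k : ℕ => (k : ℂ) * (x ^ (k - 1) * ((k.factorial : ℂ)⁻¹ * (Complex.Gamma (c + k))⁻¹)))
      (besselSeries (c + 1) x) := by
  rw [← hasSum_nat_add_iff' 1]
  simp only [Finset.range_one, Finset.sum_singleton, Nat.cast_zero, zero_mul, sub_zero]
  convert! hasSum_besselSeries (c + 1) x using 2 with k
  rw [Nat.factorial_succ]
  have : ((k : ℂ) + 1) ≠ 0 := by exact_mod_cast k.succ_ne_zero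
  have h2 : c + ((k + 1 : ℕ) : ℂ) = c + 1 + k := by push_cast; ring
  rw [h2]
  push_cast
  field_simp

theorem hasDerivAt_besselSeries (c x : ℂ) :
    HasDerivAt (besselSeries c) (besselSeries (c + 1) x) x := by
  obtain ⟨M, hM0, hM⟩ := exists_norm_inv_Gamma_add_natCast_le ‖c‖
  set R := ‖x‖ + 1
  have hR : 0 < R := by positivity
  have hu : Summable fun k : ℕ => (k : ℝ) * R ^ (k - 1) / k.factorial * M := by
    refine Summable.mul_right M ?_
    rw [← summable_nat_add_iff 1]
    refine (Real.summable_pow_div_factorial R).congr fun k => ?_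
    rw [Nat.factorial_succ]
    have : ((k : ℝ) + 1) ≠ 0 := by positivity
    push_cast
    field_simp
  have hx : x ∈ Metric.ball (0 : ℂ) R := by simp [R]
  have := hasDerivAt_tsum_of_isPreconnected hu Metric.isOpen_ball
    (convex_ball (0 : ℂ) R).isPreconnected
    (g := fun (k : ℕ) (y : ℂ) => y ^ k * ((k.factorial : ℂ)⁻¹ * (Complex.Gamma (c + k))⁻¹))
    (g' := fun (k : ℕ) (y : ℂ) =>
      (k : ℂ) * (y ^ (k - 1) * ((k.factorial : ℂ)⁻¹ * (Complex.Gamma (c + k))⁻¹)))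
    (fun k y _ => by simpa only [mul_assoc] using (hasDerivAt_pow k y).mul_const _)
    (fun k y hy => by
      have hy' : ‖y‖ ≤ R := (mem_ball_zero_iff.1 hy).le
      simp only [norm_mul, norm_pow, norm_inv, Complex.norm_natCast]
      rw [← norm_inv, div_mul_eq_mul_div, div_eq_mul_inv, mul_assoc, mul_assoc, mul_comm M]
      gcongr
      exact hM c le_rfl k)
    hx (summable_besselSeries_norm c x).of_norm hx
  rw [(hasSum_natCast_mul_besselSeries c x).tsum_eq] at this
  exact this

theorem continuous_besselSeries (c : ℂ) : Continuous (besselSeries c) :=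
  continuous_iff_continuousAt.2 fun x => (hasDerivAt_besselSeries c x).continuousAt

theorem besselSeries_recurrence (c x : ℂ) :
    besselSeries c x = c * besselSeries (c + 1) x + x * besselSeries (c + 2) x := by
  have h1 := (hasSum_besselSeries (c + 1) x).mul_left c
  have h2 := (hasSum_natCast_mul_besselSeries (c + 1) x).mul_left x
  have h3 := h1.add h2
  rw [show c + 1 + 1 = c + 2 by ring] at h3
  refine (hasSum_besselSeries c x).unique ?_
  convert! h3 using 2 with k
  rw [inv_Gamma_eq, show c + (k : ℂ) + 1 = c + 1 + k by ring]
  rcases k with _ | k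
  · simp
  · simp only [Nat.add_sub_cancel, pow_succ]
    ring

theorem differentiable_besselSeries_left (x : ℂ) : Differentiable ℂ fun c => besselSeries c x := by
  intro c
  obtain ⟨M, hM0, hM⟩ := exists_norm_inv_Gamma_add_natCast_le (‖c‖ + 1)
  have h := Complex.differentiableOn_tsum_of_summable_norm
    ((Real.summable_pow_div_factorial ‖x‖).mul_right M)
    (F := fun (k : ℕ) (c : ℂ) => x ^ k * ((k.factorial : ℂ)⁻¹ * (Complex.Gamma (c + k))⁻¹))
    (U := Metric.ball 0 (‖c‖ + 1))
    (fun k => by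
      refine Differentiable.differentiableOn ?_
      refine Differentiable.const_mul (Differentiable.const_mul ?_ _) _
      exact Complex.differentiable_one_div_Gamma.comp (differentiable_id.add_const _))
    Metric.isOpen_ball
    (fun k w hw => by
      rw [norm_mul, norm_mul, norm_pow, norm_inv, Complex.norm_natCast, ← mul_assoc,
        ← div_eq_mul_inv]
      exact mul_le_mul_of_nonneg_left (hM w (mem_ball_zero_iff.1 hw).le k) (by positivity))
  exact h.differentiableAt (Metric.isOpen_ball.mem_nhds (by simp))

/-! ### Growth of `I_ν` -/

theorem norm_inv_Gamma_add_natCast_le {c : ℂ} (hc : 1 ≤ c.re) (k : ℕ) :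
    ‖(Complex.Gamma (c + k))⁻¹‖ ≤ ‖(Complex.Gamma c)⁻¹‖ * (k.factorial : ℝ)⁻¹ := by
  induction k with
  | zero => simp
  | succ k ih =>
    rw [inv_Gamma_eq, norm_mul] at ih
    have h1 : (k : ℝ) + 1 ≤ ‖c + k‖ := by
      refine le_trans ?_ (Complex.re_le_norm _)
      simp; linarith
    have h4 : c + ((k + 1 : ℕ) : ℂ) = c + k + 1 := by push_cast; ring
    rw [h4, Nat.factorial_succ]
    push_cast
    rw [mul_inv, mul_left_comm, le_inv_mul_iff₀ (by positivity)]
    exact (mul_le_mul_of_nonneg_right h1 (norm_nonneg _)).trans ih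

/-- `binom(2k, k) ≤ 4^k (2k+1)^(-1/2)`, without roots. -/
theorem two_mul_add_one_mul_centralBinom_sq_le (k : ℕ) :
    (2 * k + 1) * k.centralBinom ^ 2 ≤ 16 ^ k := by
  induction k with
  | zero => simp
  | succ k ih =>
    have h := Nat.succ_mul_centralBinom_succ k
    have h2 : (k + 1) ^ 2 * ((2 * (k + 1) + 1) * (k + 1).centralBinom ^ 2)
        = (2 * k + 3) * (2 * (2 * k + 1) * k.centralBinom) ^ 2 := by
      rw [← h]; ring
    have h3 : (2 * k + 3) * (2 * (2 * k + 1) * k.centralBinom) ^ 2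
        ≤ (k + 1) ^ 2 * 16 ^ (k + 1) := by
      calc (2 * k + 3) * (2 * (2 * k + 1) * k.centralBinom) ^ 2
          = 4 * ((2 * k + 3) * (2 * k + 1)) * ((2 * k + 1) * k.centralBinom ^ 2) := by ring
        _ ≤ 4 * (4 * (k + 1) ^ 2) * 16 ^ k := by
            have : (2 * k + 3) * (2 * k + 1) ≤ 4 * (k + 1) ^ 2 := by nlinarith
            gcongr
        _ = _ := by ring
    rw [← h2] at h3
    exact Nat.le_of_mul_le_mul_left h3 (by positivity)

theorem sq_factorial_inv_eq (k : ℕ) (y : ℝ) :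
    (y / 2) ^ (2 * k) * ((k.factorial : ℝ)⁻¹ * (k.factorial : ℝ)⁻¹)
      = y ^ (2 * k) / (2 * k).factorial * (k.centralBinom / 4 ^ k) := by
  have h := Nat.choose_mul_factorial_mul_factorial (show k ≤ 2 * k by omega)
  rw [show 2 * k - k = k by omega, ← Nat.centralBinom_eq_two_mul_choose] at h
  have h' : (k.centralBinom : ℝ) * k.factorial * k.factorial = (2 * k).factorial := by
    exact_mod_cast h
  rw [← h', div_pow, pow_mul 2]
  have : (k.centralBinom : ℝ) ≠ 0 := by exact_mod_cast k.centralBinom_ne_zero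
  field_simp
  norm_num

/-- The series of `I_0(y)`, which dominates the other Bessel series. -/
theorem summable_modified_bessel_zero (y : ℝ) :
    Summable fun k : ℕ => (y / 2) ^ (2 * k) * ((k.factorial : ℝ)⁻¹ * (k.factorial : ℝ)⁻¹) := by
  refine Summable.of_nonneg_of_le (fun k => ?_) (fun k => ?_)
    (Real.summable_pow_div_factorial ((y / 2) ^ 2))
  · rw [pow_mul]; positivity
  · rw [← mul_assoc, pow_mul, div_eq_mul_inv]
    refine mul_le_of_le_one_right (by positivity) (inv_le_one_of_one_le₀ ?_)
    exact_mod_cast k.factorial_pos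

theorem modified_bessel_zero_le_exp {y : ℝ} (hy : 0 ≤ y) :
    ∑' k : ℕ, (y / 2) ^ (2 * k) * ((k.factorial : ℝ)⁻¹ * (k.factorial : ℝ)⁻¹) ≤ Real.exp y := by
  have h1 := Real.hasSum_cosh y
  refine ((summable_modified_bessel_zero y).tsum_le_tsum (fun k => ?_) h1.summable).trans ?_
  · rw [sq_factorial_inv_eq]
    refine mul_le_of_le_one_right (by positivity) ?_
    rw [div_le_one (by positivity)]
    have := two_mul_add_one_mul_centralBinom_sq_le k
    have h : k.centralBinom ^ 2 ≤ (4 ^ k) ^ 2 := by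
      rw [← pow_mul, mul_comm k 2, pow_mul]
      norm_num
      nlinarith
    have h2 := (Nat.pow_le_pow_iff_left two_ne_zero).1 h
    exact_mod_cast h2
  · rw [h1.tsum_eq, Real.cosh_eq]
    have : Real.exp (-y) ≤ Real.exp y := Real.exp_le_exp.2 (by linarith)
    linarith

/-- Since `binom(2k, k) / 4^k ≤ (2k+1)^(-1/2) ≤ (a + 1/(a(2k+1)))/2` for every `a > 0`, the series is
at most `(a cosh y + sinh y / (a y)) / 2`; take `a = y^(-1/2)`. -/
theorem modified_bessel_zero_le_exp_div_sqrt {y : ℝ} (hy : 0 < y) :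
    ∑' k : ℕ, (y / 2) ^ (2 * k) * ((k.factorial : ℝ)⁻¹ * (k.factorial : ℝ)⁻¹)
      ≤ Real.exp y * (Real.sqrt y)⁻¹ := by
  set r := Real.sqrt y with hr
  have hr0 : 0 < r := Real.sqrt_pos.2 hy
  have hry : r ^ 2 = y := Real.sq_sqrt hy.le
  have h1 := (Real.hasSum_cosh y).mul_right (r⁻¹ / 2)
  have h2 := (Real.hasSum_sinh y).mul_right (r / (2 * y))
  have h3 := h1.add h2
  refine ((summable_modified_bessel_zero y).tsum_le_tsum (fun k => ?_) h3.summable).trans ?_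
  · rw [sq_factorial_inv_eq, Nat.factorial_succ, pow_succ]
    have e : y ^ (2 * k) / ((2 * k).factorial : ℝ) * (r⁻¹ / 2) +
        y ^ (2 * k) * y / (((2 * k + 1) * (2 * k).factorial : ℕ) : ℝ) * (r / (2 * y))
        = y ^ (2 * k) / ((2 * k).factorial : ℝ) * ((r⁻¹ + r / (2 * k + 1)) / 2) := by
      push_cast
      field_simp
    rw [e]
    refine mul_le_mul_of_nonneg_left ?_ (by positivity)
    have hc := two_mul_add_one_mul_centralBinom_sq_le k
    have hc' : (2 * (k : ℝ) + 1) * (k.centralBinom / 4 ^ k) ^ 2 ≤ 1 := by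
      have : (2 * (k : ℝ) + 1) * (k.centralBinom : ℝ) ^ 2 ≤ 16 ^ k := by exact_mod_cast hc
      rw [div_pow, ← pow_mul, mul_comm k 2, pow_mul, ← mul_div_assoc, div_le_one (by positivity)]
      norm_num
      exact this
    set b := (k.centralBinom : ℝ) / 4 ^ k
    have hb : 0 ≤ b := by positivity
    have hm : 0 < 2 * (k : ℝ) + 1 := by positivity
    rw [le_div_iff₀ two_pos]
    have hx : (r⁻¹ + r / (2 * k + 1)) ^ 2 ≥ (b * 2) ^ 2 := by
      have h5 : (r⁻¹ + r / (2 * k + 1)) ^ 2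
          = (r⁻¹ - r / (2 * k + 1)) ^ 2 + 4 / (2 * k + 1) := by
        field_simp; ring
      have h6 : b ^ 2 ≤ 1 / (2 * k + 1) := by
        rw [le_div_iff₀ hm]; linarith
      rw [h5, mul_pow, show (4 : ℝ) / (2 * k + 1) = 1 / (2 * k + 1) * 2 ^ 2 by ring]
      nlinarith [sq_nonneg (r⁻¹ - r / (2 * (k : ℝ) + 1))]
    exact le_of_sq_le_sq hx (by positivity)
  · rw [h3.tsum_eq, ← hry, Real.cosh_eq, Real.sinh_eq]
    field_simp
    linarith [Real.exp_pos (r ^ 2)]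

theorem norm_besselSeries_le {c : ℂ} (hc : 1 ≤ c.re) (y : ℝ) :
    ‖besselSeries c (((y / 2) ^ 2 : ℝ) : ℂ)‖ ≤ ‖(Complex.Gamma c)⁻¹‖ *
      ∑' k : ℕ, (y / 2) ^ (2 * k) * ((k.factorial : ℝ)⁻¹ * (k.factorial : ℝ)⁻¹) := by
  rw [← tsum_mul_left]
  refine tsum_of_norm_bounded ((summable_modified_bessel_zero y).mul_left _).hasSum fun k => ?_
  rw [norm_mul, norm_mul, norm_pow, Complex.norm_real, norm_inv, Complex.norm_natCast, pow_mul,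
    Real.norm_of_nonneg (by positivity)]
  calc ((y / 2) ^ 2) ^ k * ((k.factorial : ℝ)⁻¹ * ‖(Complex.Gamma (c + k))⁻¹‖)
      ≤ ((y / 2) ^ 2) ^ k * ((k.factorial : ℝ)⁻¹ *
          (‖(Complex.Gamma c)⁻¹‖ * (k.factorial : ℝ)⁻¹)) := by
        gcongr
        exact norm_inv_Gamma_add_natCast_le hc k
    _ = _ := by ring

theorem besselI_eq (ν : ℂ) {z : ℝ} (hz : 0 < z) :
    besselI ν (z : ℂ) = ((z / 2 : ℝ) : ℂ) ^ ν * besselSeries (ν + 1) (((z / 2) ^ 2 : ℝ) : ℂ) := by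
  rw [besselI, besselSeries, ← tsum_mul_left]
  congr 1 with k
  have h0 : ((z / 2 : ℝ) : ℂ) ≠ 0 := by exact_mod_cast (by positivity : z / 2 ≠ 0)
  have h1 : (z : ℂ) / 2 = ((z / 2 : ℝ) : ℂ) := by push_cast; rfl
  rw [h1, Complex.cpow_add _ _ h0, show (2 * (k : ℂ)) = ((2 * k : ℕ) : ℂ) by push_cast; rfl,
    Complex.cpow_natCast, pow_mul, show (k : ℂ) + ν + 1 = ν + 1 + k by ring]
  push_cast
  rw [div_eq_mul_inv, mul_inv]
  ring

theorem norm_besselI_le {ν : ℂ} (hν : 0 ≤ ν.re) {y : ℝ} (hy : 0 < y) :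
    ‖besselI ν (y : ℂ)‖ ≤ (y / 2) ^ ν.re * ‖(Complex.Gamma (ν + 1))⁻¹‖ * Real.exp y := by
  rw [besselI_eq ν hy, norm_mul, Complex.norm_cpow_eq_rpow_re_of_pos (by positivity), mul_assoc]
  gcongr
  exact (norm_besselSeries_le (by simpa using hν) y).trans
    (mul_le_mul_of_nonneg_left (modified_bessel_zero_le_exp hy.le) (norm_nonneg _))

theorem norm_besselI_le_div_sqrt {ν : ℂ} (hν : 0 ≤ ν.re) {y : ℝ} (hy : 0 < y) :
    ‖besselI ν (y : ℂ)‖ ≤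
      (y / 2) ^ ν.re * ‖(Complex.Gamma (ν + 1))⁻¹‖ * (Real.exp y * (Real.sqrt y)⁻¹) := by
  rw [besselI_eq ν hy, norm_mul, Complex.norm_cpow_eq_rpow_re_of_pos (by positivity), mul_assoc]
  gcongr
  exact (norm_besselSeries_le (by simpa using hν) y).trans
    (mul_le_mul_of_nonneg_left (modified_bessel_zero_le_exp_div_sqrt hy) (norm_nonneg _))

/-! ### Products of Bessel functions -/

open Polynomial in
theorem inv_Gamma_eq_descPochhammer_mul (z : ℂ) (j : ℕ) :
    (Complex.Gamma (z - j + 1))⁻¹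
      = (descPochhammer ℤ j).smeval z * (Complex.Gamma (z + 1))⁻¹ := by
  induction j with
  | zero => simp
  | succ j ih =>
    rw [descPochhammer_succ_right, smeval_mul, smeval_sub, smeval_X, smeval_natCast, mul_right_comm,
      ← ih, show z - ((j + 1 : ℕ) : ℂ) + 1 = z - j by push_cast; ring, inv_Gamma_eq]
    simp [mul_comm]

/-- The coefficients are evaluated by the Chu–Vandermonde identity. -/
theorem hasSum_besselSeries_mul {μ ν : ℂ} (h : 0 ≤ (μ + ν).re) (x : ℂ) :
    HasSum (fun n : ℕ => x ^ n * ((n.factorial : ℂ)⁻¹ * (Complex.Gamma (μ + n + 1))⁻¹ *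
        (Complex.Gamma (ν + n + 1))⁻¹ * Complex.Gamma (μ + ν + 2 * n + 1) *
        (Complex.Gamma (μ + ν + n + 1))⁻¹))
      (besselSeries (μ + 1) x * besselSeries (ν + 1) x) := by
  have hs := summable_norm_sum_mul_antidiagonal_of_summable_norm
    (summable_besselSeries_norm (μ + 1) x) (summable_besselSeries_norm (ν + 1) x)
  have he := tsum_mul_tsum_eq_tsum_sum_antidiagonal_of_summable_norm
    (summable_besselSeries_norm (μ + 1) x) (summable_besselSeries_norm (ν + 1) x)
  have hs' := hs.of_norm.hasSum
  rw [← he] at hs'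
  convert! hs' using 2 with n
  have hG : Complex.Gamma (μ + ν + 2 * n + 1) ≠ 0 := by
    refine Complex.Gamma_ne_zero_of_re_pos ?_
    simp at h ⊢
    positivity
  have hD := inv_Gamma_eq_descPochhammer_mul (μ + ν + 2 * n) n
  have hV := Ring.descPochhammer_smeval_add n (Commute.all (ν + n) (μ + n))
  rw [show ν + n + (μ + n) = μ + ν + 2 * n by ring] at hV
  rw [show μ + ν + 2 * (n : ℂ) - n + 1 = μ + ν + n + 1 by ring, hV] at hD
  rw [hD, mul_assoc ((n.factorial : ℂ)⁻¹ * (Complex.Gamma (μ + n + 1))⁻¹ *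
        (Complex.Gamma (ν + n + 1))⁻¹), mul_left_comm (Complex.Gamma (μ + ν + 2 * n + 1)),
    mul_inv_cancel₀ hG, mul_one, Finset.mul_sum, Finset.mul_sum]
  refine Finset.sum_congr rfl fun ij hij => ?_
  obtain ⟨i, j⟩ := ij
  have hij' : i + j = n := by simpa using hij
  have hc : ((n.choose i : ℕ) : ℂ) * (i.factorial * j.factorial) = n.factorial := by
    have := Nat.choose_mul_factorial_mul_factorial (show i ≤ n by omega)
    rw [show n - i = j by omega, mul_assoc] at this
    exact_mod_cast this
  have hi : (i.factorial : ℂ) ≠ 0 := by exact_mod_cast i.factorial_ne_zero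
  have hj : (j.factorial : ℂ) ≠ 0 := by exact_mod_cast j.factorial_ne_zero
  have hch : ((n.choose i : ℕ) : ℂ) ≠ 0 := by
    exact_mod_cast (Nat.choose_pos (by omega)).ne'
  have e1 := inv_Gamma_eq_descPochhammer_mul (μ + n) j
  have e2 := inv_Gamma_eq_descPochhammer_mul (ν + n) i
  have hn : (n : ℂ) = i + j := by rw [← hij']; push_cast; rfl
  rw [show μ + (n : ℂ) - j + 1 = μ + 1 + i by rw [hn]; ring] at e1
  rw [show ν + (n : ℂ) - i + 1 = ν + 1 + j by rw [hn]; ring] at e2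
  dsimp only
  rw [e1, e2, ← hc, ← hij', pow_add]
  rw [hij']
  field_simp

/-! ### The integral representation of `K_ν` -/

/-- The integral `∫_0^∞ u^(ν-1) e^(-u - x/u) du = 2 x^(ν/2) K_ν(2√x)`. -/
noncomputable def macdonaldIntegral (ν : ℂ) (x : ℝ) : ℂ :=
  ∫ u in Ioi (0 : ℝ), ((Real.exp (-u - x / u) : ℝ) : ℂ) * (u : ℂ) ^ (ν - 1)

theorem integral_comp_div_Ioi {E : Type*} [NormedAddCommGroup E] [NormedSpace ℝ E] (g : ℝ → E)
    {c : ℝ} (hc : 0 < c) :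
    ∫ x in Ioi (0 : ℝ), (c / x ^ 2) • g (c / x) = ∫ x in Ioi (0 : ℝ), g x := by
  have h1 := integral_comp_rpow_Ioi (fun x => c • g (c * x)) (p := -1) (by norm_num)
  have h2 := integral_comp_mul_left_Ioi g 0 hc
  rw [integral_smul, h2, mul_zero, smul_smul, mul_inv_cancel₀ hc.ne', one_smul] at h1
  rw [← h1]
  refine setIntegral_congr_fun measurableSet_Ioi fun x hx => ?_
  have hx : 0 < x := hx
  simp only [abs_neg, abs_one, one_mul, smul_smul, Real.rpow_neg_one]
  rw [show (-1 - 1 : ℝ) = ((-2 : ℤ) : ℝ) by norm_num, Real.rpow_intCast, zpow_neg, mul_comm]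
  rfl

theorem integrableOn_comp_div_Ioi_iff {E : Type*} [NormedAddCommGroup E] [NormedSpace ℝ E]
    (g : ℝ → E) {c : ℝ} (hc : 0 < c) :
    IntegrableOn (fun x => (c / x ^ 2) • g (c / x)) (Ioi (0 : ℝ)) ↔ IntegrableOn g (Ioi 0) := by
  have h1 := integrableOn_Ioi_comp_rpow_iff (fun x => c • g (c * x)) (p := -1) (by norm_num)
  have h2 := integrableOn_Ioi_comp_mul_left_iff g 0 hc
  rw [mul_zero] at h2
  have h3 : IntegrableOn (fun x => c • g (c * x)) (Ioi (0 : ℝ)) ↔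
      IntegrableOn (fun x => g (c * x)) (Ioi (0 : ℝ)) := integrable_smul_iff hc.ne' _
  rw [← h2, ← h3, ← h1]
  refine integrableOn_congr_fun (fun x hx => ?_) measurableSet_Ioi
  have hx : 0 < x := hx
  simp only [abs_neg, abs_one, one_mul, smul_smul, Real.rpow_neg_one]
  rw [show (-1 - 1 : ℝ) = ((-2 : ℤ) : ℝ) by norm_num, Real.rpow_intCast, zpow_neg, mul_comm]
  rfl

theorem exp_neg_div_le {x u : ℝ} (hx : 0 < x) (hu : 0 < u) (m : ℕ) :
    Real.exp (-(x / u)) ≤ m.factorial * x⁻¹ ^ m * u ^ m := by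
  have h := Real.pow_div_factorial_le_exp (x / u) (by positivity) m
  rw [Real.exp_neg, inv_le_comm₀ (Real.exp_pos _) (by positivity)]
  refine le_trans (le_of_eq ?_) h
  rw [div_pow, inv_pow]
  field_simp

theorem continuousOn_macdonald_integrand (s : ℝ) (ν : ℂ) (x : ℝ) :
    ContinuousOn (fun u : ℝ => ((Real.exp (-(s * u) - x / u) : ℝ) : ℂ) * (u : ℂ) ^ (ν - 1))
      (Ioi 0) := by
  intro u hu
  have hu : 0 < u := hu
  refine ContinuousAt.continuousWithinAt (ContinuousAt.mul ?_ ?_)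
  · refine Complex.continuous_ofReal.continuousAt.comp (Real.continuous_exp.continuousAt.comp ?_)
    exact (by fun_prop : ContinuousAt (fun u : ℝ => -(s * u)) u).sub
      (continuousAt_const.div continuousAt_id hu.ne')
  · exact Complex.continuousAt_ofReal_cpow_const u _ (Or.inr hu.ne')

theorem aestronglyMeasurable_macdonald_integrand (s : ℝ) (ν : ℂ) (x : ℝ) :
    AEStronglyMeasurable
      (fun u : ℝ => ((Real.exp (-(s * u) - x / u) : ℝ) : ℂ) * (u : ℂ) ^ (ν - 1))
      (volume.restrict (Ioi 0)) :=
  (continuousOn_macdonald_integrand s ν x).aestronglyMeasurable measurableSet_Ioi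

theorem integrableOn_rpow_mul_exp_neg_sub_div (σ : ℝ) {x : ℝ} (hx : 0 < x) :
    IntegrableOn (fun u : ℝ => Real.exp (-u - x / u) * u ^ (σ - 1)) (Ioi 0) := by
  obtain ⟨m, hm⟩ := exists_nat_gt (-σ)
  refine Integrable.mono' ((Real.GammaIntegral_convergent (s := σ + m) (by linarith)).const_mul
    (m.factorial * x⁻¹ ^ m)) ?_ ?_
  · have h := (aestronglyMeasurable_macdonald_integrand 1 σ x).norm
    refine h.congr ?_
    filter_upwards [ae_restrict_mem measurableSet_Ioi] with u hu
    have hu : 0 < u := hu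
    rw [norm_mul, Complex.norm_cpow_eq_rpow_re_of_pos hu, Complex.norm_real,
      Real.norm_of_nonneg (Real.exp_pos _).le]
    simp
  · filter_upwards [ae_restrict_mem measurableSet_Ioi] with u hu
    have hu : 0 < u := hu
    rw [Real.norm_of_nonneg (by positivity), sub_eq_add_neg, Real.exp_add,
      show σ + m - 1 = (σ - 1) + m by ring, Real.rpow_add hu, Real.rpow_natCast]
    calc Real.exp (-u) * Real.exp (-(x / u)) * u ^ (σ - 1)
        ≤ Real.exp (-u) * (m.factorial * x⁻¹ ^ m * u ^ m) * u ^ (σ - 1) := by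
          gcongr
          exact exp_neg_div_le hx hu m
      _ = _ := by ring

theorem norm_exp_mul_cpow {u : ℝ} (hu : 0 < u) (a : ℝ) (ν : ℂ) :
    ‖((Real.exp a : ℝ) : ℂ) * (u : ℂ) ^ (ν - 1)‖ = Real.exp a * u ^ (ν.re - 1) := by
  rw [norm_mul, Complex.norm_cpow_eq_rpow_re_of_pos hu, Complex.norm_real,
    Real.norm_of_nonneg (Real.exp_pos _).le]
  simp

theorem integrableOn_macdonald_integrand (ν : ℂ) {x : ℝ} (hx : 0 < x) :
    IntegrableOn (fun u : ℝ => ((Real.exp (-u - x / u) : ℝ) : ℂ) * (u : ℂ) ^ (ν - 1)) (Ioi 0) := by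
  refine Integrable.mono' (integrableOn_rpow_mul_exp_neg_sub_div ν.re hx) ?_ ?_
  · simpa using aestronglyMeasurable_macdonald_integrand 1 ν x
  · filter_upwards [ae_restrict_mem measurableSet_Ioi] with u hu
    rw [norm_exp_mul_cpow hu]

theorem hasDerivAt_macdonaldIntegral (ν : ℂ) {x : ℝ} (hx : 0 < x) :
    HasDerivAt (macdonaldIntegral ν) (-macdonaldIntegral (ν - 1) x) x := by
  have h := hasDerivAt_integral_of_dominated_loc_of_deriv_le
    (μ := volume.restrict (Ioi (0 : ℝ)))
    (F := fun (x : ℝ) (u : ℝ) => ((Real.exp (-u - x / u) : ℝ) : ℂ) * (u : ℂ) ^ (ν - 1))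
    (F' := fun (x : ℝ) (u : ℝ) =>
      -(((Real.exp (-u - x / u) : ℝ) : ℂ) * (u : ℂ) ^ (ν - 1 - 1)))
    (bound := fun u => Real.exp (-u - (x / 2) / u) * u ^ ((ν - 1).re - 1))
    (x₀ := x) (s := Ioi (x / 2)) (Ioi_mem_nhds (by linarith))
    (Eventually.of_forall fun y => by
      simpa using aestronglyMeasurable_macdonald_integrand 1 ν y)
    (integrableOn_macdonald_integrand ν hx)
    (by simpa using! (aestronglyMeasurable_macdonald_integrand 1 (ν - 1) x).neg)
    (by
      filter_upwards [ae_restrict_mem measurableSet_Ioi] with u hu y hy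
      have hu : 0 < u := hu
      have hy : x / 2 < y := hy
      rw [norm_neg, norm_exp_mul_cpow hu]
      gcongr)
    (integrableOn_rpow_mul_exp_neg_sub_div _ (by positivity))
    (by
      filter_upwards [ae_restrict_mem measurableSet_Ioi] with u hu y hy
      have hu : 0 < u := hu
      have h1 : HasDerivAt (fun y : ℝ => Real.exp (-u - y / u))
          (Real.exp (-u - y / u) * (-(1 / u))) y :=
        (((hasDerivAt_id y).div_const u).const_sub (-u)).exp
      convert! h1.ofReal_comp.mul_const ((u : ℂ) ^ (ν - 1)) using 1
      have hu' : (u : ℂ) ≠ 0 := by exact_mod_cast hu.ne'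
      rw [Complex.cpow_sub _ 1 hu', Complex.cpow_one]
      push_cast
      ring)
  rw [macdonaldIntegral, ← integral_neg]
  exact h.2

/-- Reflection `u ↦ x / u`; this is the evenness of `K_ν` in `ν`. -/
theorem macdonaldIntegral_neg (ν : ℂ) {x : ℝ} (hx : 0 < x) :
    macdonaldIntegral (-ν) x = (x : ℂ) ^ (-ν) * macdonaldIntegral ν x := by
  rw [macdonaldIntegral, ← integral_comp_div_Ioi _ hx, macdonaldIntegral, ← integral_const_mul]
  refine setIntegral_congr_fun measurableSet_Ioi fun u hu => ?_
  have hu : 0 < u := hu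
  have hu' : (u : ℂ) ≠ 0 := by exact_mod_cast hu.ne'
  have hx' : (x : ℂ) ≠ 0 := by exact_mod_cast hx.ne'
  simp only [Complex.real_smul]
  rw [show -(x / u) - x / (x / u) = -u - x / u by field_simp; ring]
  have e1 : ((x / u : ℝ) : ℂ) ^ (-ν - 1) = (x : ℂ) ^ (-ν) * (x : ℂ)⁻¹ * (u : ℂ) ^ (ν - 1) * u ^ 2 := by
    rw [Complex.ofReal_div, div_eq_mul_inv, ← Complex.ofReal_inv,
      Complex.mul_cpow_ofReal_nonneg hx.le (by positivity), Complex.ofReal_inv,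
      Complex.inv_cpow _ _ (by rw [Complex.arg_ofReal_of_nonneg hu.le]; exact Real.pi_pos.ne),
      ← Complex.cpow_neg, Complex.cpow_sub _ _ hx', Complex.cpow_one,
      show -(-ν - 1) = ν - 1 + 2 by ring, Complex.cpow_add _ _ hu']
    norm_num
    ring
  rw [e1]
  push_cast
  field_simp

theorem tendsto_macdonaldIntegral_zero {ν : ℂ} (hν : 0 < ν.re) :
    Tendsto (macdonaldIntegral ν) (𝓝[>] 0) (𝓝 (Complex.Gamma ν)) := by
  rw [Complex.Gamma_eq_integral hν]
  refine tendsto_integral_filter_of_dominated_convergence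
    (fun u => Real.exp (-u) * u ^ (ν.re - 1))
    (Eventually.of_forall fun y => by
      simpa using aestronglyMeasurable_macdonald_integrand 1 ν y) ?_
    (Real.GammaIntegral_convergent hν) ?_
  · filter_upwards [self_mem_nhdsWithin] with x hx
    have hx : 0 < x := hx
    filter_upwards [ae_restrict_mem measurableSet_Ioi] with u hu
    have hu : 0 < u := hu
    rw [norm_exp_mul_cpow hu]
    gcongr
    have : 0 < x / u := by positivity
    linarith
  · filter_upwards [ae_restrict_mem measurableSet_Ioi] with u hu
    refine Tendsto.mul_const _ ?_
    refine (Complex.continuous_ofReal.tendsto _).comp ?_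
    have h : Continuous fun x : ℝ => Real.exp (-u - x / u) := by fun_prop
    have := h.tendsto 0
    simp only [zero_div, sub_zero] at this
    exact this.mono_left nhdsWithin_le_nhds

theorem hasDerivAt_besselSeries_ofReal (c : ℂ) (x : ℝ) :
    HasDerivAt (fun y : ℝ => besselSeries c y) (besselSeries (c + 1) x) x :=
  (hasDerivAt_besselSeries c x).comp_ofReal

theorem tendsto_besselSeries_zero (c : ℂ) :
    Tendsto (fun y : ℝ => besselSeries c y) (𝓝[>] 0) (𝓝 (Complex.Gamma c)⁻¹) := by
  have h := (hasDerivAt_besselSeries_ofReal c 0).continuousAt.tendsto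
  rw [Complex.ofReal_zero, besselSeries_zero] at h
  exact h.mono_left nhdsWithin_le_nhds

theorem eq_of_hasDerivAt_zero_of_tendsto {V : ℝ → ℂ} {l : ℂ}
    (hV : ∀ x, 0 < x → HasDerivAt V 0 x) (hl : Tendsto V (𝓝[>] 0) (𝓝 l)) {x : ℝ} (hx : 0 < x) :
    V x = l := by
  obtain ⟨a, ha⟩ := isOpen_Ioi.exists_is_const_of_deriv_eq_zero (convex_Ioi (0 : ℝ)).isPreconnected
    (fun y hy => (hV y hy).differentiableAt.differentiableWithinAt) (fun y hy => (hV y hy).deriv)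
  have h2 : Tendsto V (𝓝[>] 0) (𝓝 a) :=
    tendsto_const_nhds.congr' (by
      filter_upwards [self_mem_nhdsWithin] with y hy using (ha y hy).symm)
  rw [ha x hx, tendsto_nhds_unique h2 hl]

/-- The Wronskian of the two solutions `x ↦ ∫ u^(ν-1) e^(-u-x/u) du` and `besselSeries (1 - ν)` of
`x y'' + (1 - ν) y' = y`. -/
theorem macdonaldIntegral_wronskian {ν : ℂ} (h0 : 0 < ν.re) (h1 : ν.re < 1) {x : ℝ} (hx : 0 < x) :
    (x : ℂ) ^ (1 - ν) * macdonaldIntegral ν x * besselSeries (2 - ν) x +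
      macdonaldIntegral (1 - ν) x * besselSeries (1 - ν) x = 1 := by
  have hν1 : 1 - ν ≠ 0 := fun h => by
    have := congrArg Complex.re h; simp at this; linarith
  refine eq_of_hasDerivAt_zero_of_tendsto (V := fun x : ℝ =>
    (x : ℂ) ^ (1 - ν) * macdonaldIntegral ν x * besselSeries (2 - ν) x +
      macdonaldIntegral (1 - ν) x * besselSeries (1 - ν) x) (fun x hx => ?_) ?_ hx
  · have hx' : (x : ℂ) ≠ 0 := by exact_mod_cast hx.ne'
    have d1 := hasDerivAt_ofReal_cpow_const hx.ne' hν1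
    have d2 := hasDerivAt_macdonaldIntegral ν hx
    have d3 := hasDerivAt_besselSeries_ofReal (2 - ν) x
    have d4 := hasDerivAt_macdonaldIntegral (1 - ν) hx
    have d5 := hasDerivAt_besselSeries_ofReal (1 - ν) x
    refine (((d1.mul d2).mul d3).add (d4.mul d5)).congr_deriv ?_
    have r := besselSeries_recurrence (1 - ν) x
    rw [show ν - 1 = -(1 - ν) by ring, macdonaldIntegral_neg _ hx,
      show 1 - ν - 1 = -ν by ring, macdonaldIntegral_neg _ hx, r,
      show 1 - ν + 1 = 2 - ν by ring, show 1 - ν + 2 = 2 - ν + 1 by ring, Complex.cpow_neg,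
      Complex.cpow_neg, Complex.cpow_sub _ _ hx', Complex.cpow_one]
    have h2 : (x : ℂ) ^ ν ≠ 0 := by simp [Complex.cpow_eq_zero_iff, hx']
    have e : (x : ℂ) ^ (1 - ν) * (x : ℂ) ^ ν = x := by
      rw [← Complex.cpow_add _ _ hx', sub_add_cancel, Complex.cpow_one]
    simp only [Pi.mul_apply]
    field_simp
    linear_combination (macdonaldIntegral ν x * besselSeries (2 - ν + 1) x) * e
  · have hre : 0 < (1 - ν).re := by simpa using h1
    have t0 : Tendsto (fun x : ℝ => (x : ℂ) ^ (1 - ν)) (𝓝[>] 0) (𝓝 0) := by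
      have := (Complex.continuous_ofReal_cpow_const hre).tendsto 0
      rw [Complex.ofReal_zero, Complex.zero_cpow hν1] at this
      exact this.mono_left nhdsWithin_le_nhds
    have := (((t0.mul (tendsto_macdonaldIntegral_zero h0)).mul
      (tendsto_besselSeries_zero (2 - ν))).add
      ((tendsto_macdonaldIntegral_zero hre).mul (tendsto_besselSeries_zero (1 - ν))))
    rwa [zero_mul, zero_mul, zero_add,
      mul_inv_cancel₀ (Complex.Gamma_ne_zero_of_re_pos hre)] at this

/-- The Wronskian of the two solutions in power series. -/
theorem besselSeries_wronskian (ν : ℂ) {x : ℝ} (hx : 0 < x) :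
    besselSeries ν x * besselSeries (1 - ν) x -
      x * besselSeries (1 + ν) x * besselSeries (2 - ν) x
      = Complex.sin (Real.pi * ν) / Real.pi := by
  refine eq_of_hasDerivAt_zero_of_tendsto (V := fun x : ℝ =>
    besselSeries ν x * besselSeries (1 - ν) x -
      x * besselSeries (1 + ν) x * besselSeries (2 - ν) x) (fun x hx => ?_) ?_ hx
  · have d1 := hasDerivAt_besselSeries_ofReal ν x
    have d2 := hasDerivAt_besselSeries_ofReal (1 - ν) x
    have d3 := hasDerivAt_besselSeries_ofReal (1 + ν) x
    have d4 := hasDerivAt_besselSeries_ofReal (2 - ν) x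
    have d5 : HasDerivAt (fun y : ℝ => (y : ℂ)) 1 x := (hasDerivAt_id (x : ℂ)).comp_ofReal
    refine ((d1.mul d2).sub ((d5.mul d3).mul d4)).congr_deriv ?_
    have r1 := besselSeries_recurrence (1 - ν) x
    have r2 := besselSeries_recurrence ν x
    simp only [Pi.mul_apply]
    rw [show 1 - ν + 1 = 2 - ν by ring, show 1 - ν + 2 = 2 - ν + 1 by ring] at r1
    rw [r1, r2, show 1 - ν + 1 = 2 - ν by ring, show ν + 1 = 1 + ν by ring,
      show ν + 2 = 1 + ν + 1 by ring]
    ring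
  · have t0 : Tendsto (fun x : ℝ => (x : ℂ)) (𝓝[>] 0) (𝓝 0) := by
      have := Complex.continuous_ofReal.tendsto 0
      rw [Complex.ofReal_zero] at this
      exact this.mono_left nhdsWithin_le_nhds
    have := (((tendsto_besselSeries_zero ν).mul (tendsto_besselSeries_zero (1 - ν))).sub
      ((t0.mul (tendsto_besselSeries_zero (1 + ν))).mul (tendsto_besselSeries_zero (2 - ν))))
    rwa [zero_mul, zero_mul, sub_zero, ← mul_inv, Complex.Gamma_mul_Gamma_one_sub, inv_div] at this

theorem sin_pi_mul_ne_zero_of_re_mem_Ioo {ν : ℂ} (h0 : 0 < ν.re) (h1 : ν.re < 1) :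
    Complex.sin (Real.pi * ν) ≠ 0 := by
  refine sin_pi_mul_ne_zero fun ⟨k, hk⟩ => ?_
  rw [← hk] at h0 h1
  simp only [Complex.intCast_re] at h0 h1
  norm_cast at h0 h1
  omega

/-- The connection between the integral and the series definitions of `K_ν`: the two Wronskian
identities (at `ν` and at `1 - ν`) are a linear system for the integrals. -/
theorem macdonaldIntegral_eq {ν : ℂ} (h0 : 0 < ν.re) (h1 : ν.re < 1) {x : ℝ} (hx : 0 < x) :
    macdonaldIntegral ν x = Real.pi / Complex.sin (Real.pi * ν) *
      (besselSeries (1 - ν) x - (x : ℂ) ^ ν * besselSeries (1 + ν) x) := by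
  have w1 := macdonaldIntegral_wronskian h0 h1 hx
  have w2 := macdonaldIntegral_wronskian (ν := 1 - ν) (by simpa using h1) (by simpa using h0) hx
  have w3 := besselSeries_wronskian ν hx
  rw [sub_sub_cancel, show 2 - (1 - ν) = 1 + ν by ring] at w2
  have hs := sin_pi_mul_ne_zero_of_re_mem_Ioo h0 h1
  have hpi : (Real.pi : ℂ) ≠ 0 := by exact_mod_cast Real.pi_ne_zero
  have hx' : (x : ℂ) ≠ 0 := by exact_mod_cast hx.ne'
  have e : (x : ℂ) ^ (1 - ν) * (x : ℂ) ^ ν = x := by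
    rw [← Complex.cpow_add _ _ hx', sub_add_cancel, Complex.cpow_one]
  have key : macdonaldIntegral ν x * (Complex.sin (Real.pi * ν) / Real.pi)
      = besselSeries (1 - ν) x - (x : ℂ) ^ ν * besselSeries (1 + ν) x := by
    rw [← w3]
    linear_combination besselSeries (1 - ν) x * w2 - (x : ℂ) ^ ν * besselSeries (1 + ν) x * w1
      + macdonaldIntegral ν x * besselSeries (2 - ν) x * besselSeries (1 + ν) x * e
  rw [← key]
  field_simp

/-! ### Poisson's integral for `I_ν` -/

theorem hasSum_integral_mul_pow {μ : Measure ℝ} {g h : ℝ → ℂ} (hg : Integrable g μ)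
    (hh : AEStronglyMeasurable h μ) (h1 : ∀ᵐ s ∂μ, ‖h s‖ ≤ 1) {a : ℕ → ℂ}
    (ha : Summable fun k => ‖a k‖) :
    HasSum (fun k => a k * ∫ s, g s * h s ^ k ∂μ) (∫ s, g s * ∑' k, h s ^ k * a k ∂μ) := by
  have hb : ∀ k, ∀ᵐ s ∂μ, ‖h s ^ k * a k‖ ≤ ‖a k‖ := fun k => by
    filter_upwards [h1] with s hs
    rw [norm_mul, norm_pow]
    exact mul_le_of_le_one_left (norm_nonneg _) (pow_le_one₀ (norm_nonneg _) hs)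
  have hi : ∀ k, Integrable (fun s => g s * (h s ^ k * a k)) μ := fun k =>
    hg.mul_bdd (c := ‖a k‖) ((hh.pow k).mul_const _) (hb k)
  have hle : ∀ k, ∫ s, ‖g s * (h s ^ k * a k)‖ ∂μ ≤ (∫ s, ‖g s‖ ∂μ) * ‖a k‖ := fun k => by
    rw [← integral_mul_const]
    refine integral_mono_ae (hi k).norm (hg.norm.mul_const _) ?_
    filter_upwards [hb k] with s hs
    rw [norm_mul]
    exact mul_le_mul_of_nonneg_left hs (norm_nonneg _)
  have := hasSum_integral_of_summable_integral_norm hi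
    (Summable.of_nonneg_of_le (fun k => integral_nonneg fun _ => norm_nonneg _) hle
      (ha.mul_left _))
  simp only [tsum_mul_left] at this
  convert! this using 2 with k
  rw [← integral_const_mul]
  congr 1 with s
  ring

theorem two_cpow_one_sub_two_mul (s : ℂ) : (2 : ℂ) ^ (1 - 2 * s) = 2 * 4 ^ (-s) := by
  have h := Complex.mul_cpow_ofReal_nonneg (zero_le_two : (0 : ℝ) ≤ 2) zero_le_two (-s)
  rw [show (4 : ℂ) = ((2 : ℝ) : ℂ) * ((2 : ℝ) : ℂ) by norm_num, h, Complex.ofReal_ofNat,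
    show 1 - 2 * s = 1 + -s + -s by ring, Complex.cpow_add _ _ two_ne_zero,
    Complex.cpow_add _ _ two_ne_zero, Complex.cpow_one]
  ring

theorem Gamma_mul_Gamma_add_half_eq (s : ℂ) : Complex.Gamma s * Complex.Gamma (s + 1 / 2)
    = 2 * 4 ^ (-s) * Complex.Gamma (2 * s) * (Real.sqrt Real.pi : ℂ) := by
  rw [Complex.Gamma_mul_Gamma_add_half, two_cpow_one_sub_two_mul]
  ring

theorem Gamma_one_half_eq_sqrt : Complex.Gamma (1 / 2) = (Real.sqrt Real.pi : ℂ) := by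
  rw [show (1 / 2 : ℂ) = ((1 / 2 : ℝ) : ℂ) by push_cast; rfl, Complex.Gamma_ofReal,
    Real.Gamma_one_half_eq]

/-- `Γ(k + 1/2) = (2k)! √π / (4^k k!)`. -/
theorem Gamma_natCast_add_half (k : ℕ) : Complex.Gamma (k + 1 / 2)
    = (2 * k).factorial * (4 : ℂ)⁻¹ ^ k * (k.factorial : ℂ)⁻¹ * (Real.sqrt Real.pi : ℂ) := by
  have h := Gamma_mul_Gamma_add_half_eq (k + 1 / 2)
  have hk : (k.factorial : ℂ) ≠ 0 := by exact_mod_cast k.factorial_ne_zero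
  rw [show (k : ℂ) + 1 / 2 + 1 / 2 = k + 1 by ring, Complex.Gamma_nat_eq_factorial,
    show 2 * ((k : ℂ) + 1 / 2) = ((2 * k : ℕ) : ℂ) + 1 by push_cast; ring,
    Complex.Gamma_nat_eq_factorial, neg_add, Complex.cpow_add _ _ (by norm_num : (4 : ℂ) ≠ 0),
    Complex.cpow_neg, Complex.cpow_natCast] at h
  have h4 : (4 : ℂ) ^ (-(1 / 2) : ℂ) = 2⁻¹ := by
    have := two_cpow_one_sub_two_mul (1 / 2)
    norm_num at this ⊢
    rw [← mul_right_inj' (two_ne_zero (α := ℂ)), ← this]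
    norm_num
  rw [h4] at h
  rw [← mul_left_inj' hk, h, inv_pow]
  field_simp

theorem integrable_beta {u v : ℂ} (hu : 0 < u.re) (hv : 0 < v.re) :
    Integrable (fun s : ℝ => (s : ℂ) ^ (u - 1) * (1 - (s : ℂ)) ^ (v - 1))
      (volume.restrict (Ioc 0 1)) :=
  (intervalIntegrable_iff_integrableOn_Ioc_of_le zero_le_one).1
    (Complex.betaIntegral_convergent hu hv)

theorem setIntegral_beta {u v : ℂ} (hu : 0 < u.re) (hv : 0 < v.re) :
    ∫ s in Ioc (0 : ℝ) 1, (s : ℂ) ^ (u - 1) * (1 - (s : ℂ)) ^ (v - 1)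
      = Complex.Gamma u * Complex.Gamma v / Complex.Gamma (u + v) := by
  rw [← Complex.betaIntegral_eq_Gamma_mul_div u v hu hv, Complex.betaIntegral,
    intervalIntegral.integral_of_le zero_le_one]

theorem integral_beta_mul_centered_pow_odd (a : ℂ) (k : ℕ) :
    ∫ s in Ioc (0 : ℝ) 1, (s : ℂ) ^ (a - 1) * (1 - (s : ℂ)) ^ (a - 1) *
      ((s : ℂ) - 1 / 2) ^ (2 * k + 1) = 0 := by
  rw [← intervalIntegral.integral_of_le zero_le_one]
  have h := intervalIntegral.integral_comp_sub_left (a := 0) (b := 1)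
    (fun s : ℝ => (s : ℂ) ^ (a - 1) * (1 - (s : ℂ)) ^ (a - 1) *
      ((s : ℂ) - 1 / 2) ^ (2 * k + 1)) 1
  simp only [sub_zero, sub_self] at h
  have h2 : ∀ s : ℝ, ((1 - s : ℝ) : ℂ) ^ (a - 1) * (1 - ((1 - s : ℝ) : ℂ)) ^ (a - 1) *
      (((1 - s : ℝ) : ℂ) - 1 / 2) ^ (2 * k + 1) = -((s : ℂ) ^ (a - 1) * (1 - (s : ℂ)) ^ (a - 1) *
      ((s : ℂ) - 1 / 2) ^ (2 * k + 1)) := fun s => by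
    have e : ((1 - s : ℝ) : ℂ) - 1 / 2 = -((s : ℂ) - 1 / 2) := by push_cast; ring
    rw [e, Odd.neg_pow ⟨k, rfl⟩]
    push_cast
    rw [sub_sub_cancel]
    ring
  simp only [h2, intervalIntegral.integral_neg] at h
  exact CharZero.eq_neg_self_iff.1 h.symm

theorem norm_sub_half_le {s : ℝ} (hs : s ∈ Ioc (0 : ℝ) 1) : ‖(s : ℂ) - 1 / 2‖ ≤ 1 := by
  rw [show ((s : ℂ) - 1 / 2) = ((s - 1 / 2 : ℝ) : ℂ) by push_cast; rfl, Complex.norm_real,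
    Real.norm_eq_abs, abs_le]
  constructor <;> linarith [hs.1, hs.2]

theorem integrable_beta_mul_centered_pow {a : ℂ} (ha : 0 < a.re) (n : ℕ) :
    Integrable (fun s : ℝ => (s : ℂ) ^ (a - 1) * (1 - (s : ℂ)) ^ (a - 1) *
      ((s : ℂ) - 1 / 2) ^ n) (volume.restrict (Ioc 0 1)) := by
  refine (integrable_beta ha ha).mul_bdd (c := 1)
    (by fun_prop : Continuous fun s : ℝ => ((s : ℂ) - 1 / 2) ^ n).aestronglyMeasurable ?_
  filter_upwards [ae_restrict_mem measurableSet_Ioc] with s hs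
  rw [norm_pow]
  exact pow_le_one₀ (norm_nonneg _) (norm_sub_half_le hs)

/-- The even moments, by induction from `(s - 1/2)^2 = 1/4 - s (1 - s)`. -/
theorem integral_beta_mul_centered_pow_even (k : ℕ) {a : ℂ} (ha : 0 < a.re) :
    ∫ s in Ioc (0 : ℝ) 1, (s : ℂ) ^ (a - 1) * (1 - (s : ℂ)) ^ (a - 1) *
      ((s : ℂ) - 1 / 2) ^ (2 * k)
      = 2 * (4 : ℂ) ^ (-a) * (4 : ℂ)⁻¹ ^ k * Complex.Gamma (k + 1 / 2) * Complex.Gamma a *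
        (Complex.Gamma (a + 1 / 2 + k))⁻¹ := by
  induction k generalizing a with
  | zero =>
    have h2a : Complex.Gamma (a + a) ≠ 0 := Complex.Gamma_ne_zero_of_re_pos (by simpa using ha)
    have hh : Complex.Gamma (a + 1 / 2) ≠ 0 :=
      Complex.Gamma_ne_zero_of_re_pos (by simp; linarith)
    have hd := Gamma_mul_Gamma_add_half_eq a
    simp only [mul_zero, pow_zero, mul_one, Nat.cast_zero, zero_add, add_zero]
    rw [setIntegral_beta ha ha, Gamma_one_half_eq_sqrt, ← two_mul, div_eq_iff (by rwa [two_mul]),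
      eq_comm]
    calc _ = Complex.Gamma a * (Complex.Gamma (a + 1 / 2))⁻¹ *
          (2 * 4 ^ (-a) * Complex.Gamma (2 * a) * (Real.sqrt Real.pi : ℂ)) := by ring
      _ = _ := by rw [← hd]; generalize Complex.Gamma (a + 1 / 2) = B at hh; field_simp
  | succ k ih =>
    have ha1 : 0 < (a + 1).re := by simp; linarith
    have i1 := ih ha
    have i2 := ih ha1
    have hint1 := (integrable_beta_mul_centered_pow ha (2 * k)).const_mul (4⁻¹ : ℂ)
    have hint2 := integrable_beta_mul_centered_pow ha1 (2 * k)
    have e : ∫ s in Ioc (0 : ℝ) 1, (s : ℂ) ^ (a - 1) * (1 - (s : ℂ)) ^ (a - 1) *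
        ((s : ℂ) - 1 / 2) ^ (2 * (k + 1)) =
        ∫ s in Ioc (0 : ℝ) 1, (4⁻¹ * ((s : ℂ) ^ (a - 1) * (1 - (s : ℂ)) ^ (a - 1) *
          ((s : ℂ) - 1 / 2) ^ (2 * k)) - (s : ℂ) ^ (a + 1 - 1) * (1 - (s : ℂ)) ^ (a + 1 - 1) *
          ((s : ℂ) - 1 / 2) ^ (2 * k)) := by
      refine setIntegral_congr_ae measurableSet_Ioc ?_
      filter_upwards [Measure.ae_ne volume (1 : ℝ)] with s hs1 hs
      have h0 : (s : ℂ) ≠ 0 := by exact_mod_cast hs.1.ne'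
      have h1 : 1 - (s : ℂ) ≠ 0 := by
        rw [sub_ne_zero]; exact_mod_cast hs1.symm
      rw [show a + 1 - 1 = (a - 1) + 1 by ring, Complex.cpow_add _ _ h0, Complex.cpow_add _ _ h1,
        Complex.cpow_one, Complex.cpow_one, show 2 * (k + 1) = 2 * k + 2 by ring, pow_add]
      ring
    have hA : Complex.Gamma (((k + 1 : ℕ) : ℂ) + 1 / 2)
        = (k + 1 / 2) * Complex.Gamma ((k : ℂ) + 1 / 2) := by
      rw [← Complex.Gamma_add_one]
      · push_cast; ring_nf
      · intro h
        have := congrArg Complex.re h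
        simp at this
        linarith [(Nat.cast_nonneg k : (0 : ℝ) ≤ k)]
    rw [e, integral_sub hint1 hint2, integral_const_mul, i1, i2, Complex.cpow_neg, Complex.cpow_neg,
      Complex.cpow_add _ _ (by norm_num : (4 : ℂ) ≠ 0), Complex.cpow_one,
      Complex.Gamma_add_one a (fun h => by rw [h] at ha; simp at ha), hA,
      inv_Gamma_eq (a + 1 / 2 + k), show a + 1 + 1 / 2 + (k : ℂ) = a + 1 / 2 + k + 1 by ring,
      show a + 1 / 2 + ((k + 1 : ℕ) : ℂ) = a + 1 / 2 + k + 1 by push_cast; ring, pow_succ]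
    have : (4 : ℂ) ^ a ≠ 0 := by simp [Complex.cpow_eq_zero_iff]
    generalize (Complex.Gamma (a + 1 / 2 + k + 1))⁻¹ = B
    generalize Complex.Gamma (k + 1 / 2) = A
    field_simp
    ring

/-- Poisson's integral representation of `e^{-w/2} I_ν(w/2)`, `a = ν + 1/2`. -/
theorem integral_beta_mul_exp {a : ℂ} (ha : 0 < a.re) (w : ℝ) :
    ∫ s in Ioc (0 : ℝ) 1, (s : ℂ) ^ (a - 1) * (1 - (s : ℂ)) ^ (a - 1) *
      ((Real.exp (-(w * s)) : ℝ) : ℂ)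
      = 2 * (4 : ℂ) ^ (-a) * (Real.sqrt Real.pi : ℂ) * Complex.Gamma a *
        ((Real.exp (-w / 2) : ℝ) : ℂ) * besselSeries (a + 1 / 2) (((w / 4) ^ 2 : ℝ) : ℂ) := by
  have hsum : Summable fun k : ℕ => ‖(-(w : ℂ)) ^ k / (k.factorial : ℂ)‖ := by
    refine (Real.summable_pow_div_factorial |w|).congr fun k => ?_
    simp
  have h := hasSum_integral_mul_pow (integrable_beta ha ha)
    (by fun_prop : Continuous fun s : ℝ => ((s : ℂ) - 1 / 2)).aestronglyMeasurable
    (by filter_upwards [ae_restrict_mem measurableSet_Ioc] with s hs using norm_sub_half_le hs)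
    hsum
  have hexp : ∀ s : ℝ, ∑' k : ℕ, ((s : ℂ) - 1 / 2) ^ k * ((-(w : ℂ)) ^ k / (k.factorial : ℂ))
      = ((Real.exp (w / 2) : ℝ) : ℂ) * ((Real.exp (-(w * s)) : ℝ) : ℂ) := fun s => by
    have e := NormedSpace.expSeries_div_hasSum_exp (-(w : ℂ) * ((s : ℂ) - 1 / 2))
    rw [← Complex.exp_eq_exp_ℂ] at e
    rw [← Complex.ofReal_mul, ← Real.exp_add, Complex.ofReal_exp,
      show ((w / 2 + -(w * s) : ℝ) : ℂ) = -(w : ℂ) * ((s : ℂ) - 1 / 2) by push_cast; ring,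
      ← e.tsum_eq]
    congr 1 with k
    rw [mul_pow]; ring
  simp only [hexp] at h
  have h2 : HasSum (fun k : ℕ => (-(w : ℂ)) ^ (2 * k) / ((2 * k).factorial : ℂ) *
      ∫ s in Ioc (0 : ℝ) 1, (s : ℂ) ^ (a - 1) * (1 - (s : ℂ)) ^ (a - 1) *
        ((s : ℂ) - 1 / 2) ^ (2 * k)) _ :=
    (Function.Injective.hasSum_iff (mul_right_injective₀ (two_ne_zero (α := ℕ)))
      (fun n hn => by
        obtain ⟨k, hk | hk⟩ := n.even_or_odd'
        · exact absurd ⟨k, hk.symm⟩ hn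
        · rw [hk, integral_beta_mul_centered_pow_odd, mul_zero])).2 h
  have h3 := (hasSum_besselSeries (a + 1 / 2) (((w / 4) ^ 2 : ℝ) : ℂ)).mul_left
    (2 * (4 : ℂ) ^ (-a) * (Real.sqrt Real.pi : ℂ) * Complex.Gamma a)
  have hcoef : ∀ k : ℕ, (-(w : ℂ)) ^ (2 * k) / ((2 * k).factorial : ℂ) *
      ∫ s in Ioc (0 : ℝ) 1, (s : ℂ) ^ (a - 1) * (1 - (s : ℂ)) ^ (a - 1) *
        ((s : ℂ) - 1 / 2) ^ (2 * k) = 2 * (4 : ℂ) ^ (-a) * (Real.sqrt Real.pi : ℂ) *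
          Complex.Gamma a * ((((w / 4) ^ 2 : ℝ) : ℂ) ^ k *
            ((k.factorial : ℂ)⁻¹ * (Complex.Gamma (a + 1 / 2 + k))⁻¹)) := fun k => by
    have h2k : ((2 * k).factorial : ℂ) ≠ 0 := by exact_mod_cast (2 * k).factorial_ne_zero
    have hw : (((w / 4) ^ 2 : ℝ) : ℂ) ^ k = (-(w : ℂ)) ^ (2 * k) * (4 : ℂ)⁻¹ ^ k * (4 : ℂ)⁻¹ ^ k := by
      rw [pow_mul, ← mul_pow, ← mul_pow]
      congr 1
      push_cast
      ring
    rw [integral_beta_mul_centered_pow_even k ha, Gamma_natCast_add_half, hw]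
    generalize (Complex.Gamma (a + 1 / 2 + k))⁻¹ = B
    field_simp
  simp only [hcoef] at h2
  have h4 := h2.unique h3
  have h5 : ∀ s : ℝ, (s : ℂ) ^ (a - 1) * (1 - (s : ℂ)) ^ (a - 1) *
      (((Real.exp (w / 2) : ℝ) : ℂ) * ((Real.exp (-(w * s)) : ℝ) : ℂ)) =
      ((Real.exp (w / 2) : ℝ) : ℂ) * ((s : ℂ) ^ (a - 1) * (1 - (s : ℂ)) ^ (a - 1) *
        ((Real.exp (-(w * s)) : ℝ) : ℂ)) := fun s => by ring
  simp only [h5] at h4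
  rw [integral_const_mul] at h4
  have h6 : ((Real.exp (w / 2) : ℝ) : ℂ) * ((Real.exp (-w / 2) : ℝ) : ℂ) = 1 := by
    rw [← Complex.ofReal_mul, ← Real.exp_add, show w / 2 + -w / 2 = 0 by ring, Real.exp_zero,
      Complex.ofReal_one]
  linear_combination ((Real.exp (-w / 2) : ℝ) : ℂ) * h4 - (∫ s in Ioc (0 : ℝ) 1, (s : ℂ) ^ (a - 1) *
    (1 - (s : ℂ)) ^ (a - 1) * ((Real.exp (-(w * s)) : ℝ) : ℂ)) * h6

/-! ### The kernel identity inside the strip `0 < Re ν < 1` -/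

theorem integral_cpow_mul_exp_neg_mul_sub_div (ν : ℂ) {s : ℝ} (hs : 0 < s) (y : ℝ) :
    ∫ w in Ioi (0 : ℝ), ((Real.exp (-(s * w) - y / w) : ℝ) : ℂ) * (w : ℂ) ^ (ν - 1)
      = (s : ℂ) ^ (-ν) * macdonaldIntegral ν (y * s) := by
  have h := integral_comp_mul_left_Ioi
    (fun u : ℝ => ((Real.exp (-u - (y * s) / u) : ℝ) : ℂ) * (u : ℂ) ^ (ν - 1)) 0 hs
  rw [mul_zero] at h
  have hs' : (s : ℂ) ≠ 0 := by exact_mod_cast hs.ne'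
  have hc : (s : ℂ) ^ (-ν) = (s : ℂ)⁻¹ * (s : ℂ) ^ (-(ν - 1)) := by
    rw [show -ν = -1 + -(ν - 1) by ring, Complex.cpow_add _ _ hs', Complex.cpow_neg_one]
  rw [macdonaldIntegral, hc, mul_right_comm, mul_assoc, mul_comm _ ((s : ℂ) ^ (-(ν - 1)))]
  rw [show (s : ℂ)⁻¹ = ((s⁻¹ : ℝ) : ℂ) by push_cast; rfl, mul_left_comm, ← Complex.real_smul, ← h,
    ← integral_const_mul]
  refine setIntegral_congr_fun measurableSet_Ioi fun w hw => ?_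
  have hw : 0 < w := hw
  rw [Complex.ofReal_mul, Complex.mul_cpow_ofReal_nonneg hs.le hw.le,
    show y * s / (s * w) = y / w by field_simp, Complex.cpow_neg]
  have : (s : ℂ) ^ (ν - 1) ≠ 0 := by simp [Complex.cpow_eq_zero_iff, hs']
  field_simp

theorem hasSum_integral_beta_mul_besselSeries {u v : ℂ} (hu : 0 < u.re) (hv : 0 < v.re) (c : ℂ)
    (y : ℝ) :
    HasSum (fun k : ℕ => (y : ℂ) ^ k * ((k.factorial : ℂ)⁻¹ * (Complex.Gamma (c + k))⁻¹) *
        (Complex.Gamma (u + k) * Complex.Gamma v * (Complex.Gamma (u + v + k))⁻¹))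
      (∫ s in Ioc (0 : ℝ) 1, (s : ℂ) ^ (u - 1) * (1 - (s : ℂ)) ^ (v - 1) *
        besselSeries c ((y * s : ℝ) : ℂ)) := by
  have h := hasSum_integral_mul_pow (integrable_beta hu hv)
    Complex.continuous_ofReal.aestronglyMeasurable
    (by
      filter_upwards [ae_restrict_mem measurableSet_Ioc] with s hs
      rw [Complex.norm_real, Real.norm_of_nonneg hs.1.le]
      exact hs.2)
    (summable_besselSeries_norm c y)
  have e : ∀ s : ℝ, ∑' k : ℕ, (s : ℂ) ^ k *
      ((y : ℂ) ^ k * ((k.factorial : ℂ)⁻¹ * (Complex.Gamma (c + k))⁻¹))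
      = besselSeries c ((y * s : ℝ) : ℂ) := fun s => by
    rw [besselSeries]
    congr 1 with k
    push_cast
    ring
  simp only [e] at h
  convert! h using 2 with k
  congr 1
  have hk : 0 < (u + k).re := by simp; positivity
  rw [← div_eq_mul_inv, show u + v + k = (u + k) + v by ring, ← setIntegral_beta hk hv]
  refine setIntegral_congr_fun measurableSet_Ioc fun s hs => ?_
  have h0 : (s : ℂ) ≠ 0 := by exact_mod_cast hs.1.ne'
  rw [show u + (k : ℂ) - 1 = (u - 1) + k by ring, Complex.cpow_add _ _ h0, Complex.cpow_natCast]
  ring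

theorem integrable_beta_mul_besselSeries {u v : ℂ} (hu : 0 < u.re) (hv : 0 < v.re) (c : ℂ)
    (y : ℝ) :
    Integrable (fun s : ℝ => (s : ℂ) ^ (u - 1) * (1 - (s : ℂ)) ^ (v - 1) *
        besselSeries c ((y * s : ℝ) : ℂ)) (volume.restrict (Ioc 0 1)) := by
  refine (intervalIntegrable_iff_integrableOn_Ioc_of_le zero_le_one).1 ?_
  refine (Complex.betaIntegral_convergent hu hv).mul_continuousOn ?_
  exact ((continuous_besselSeries c).comp (by fun_prop)).continuousOn

theorem four_cpow_neg_mul_cpow {w : ℝ} (hw : 0 < w) (ν : ℂ) :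
    ((w / 4 : ℝ) : ℂ) ^ ν = (4 : ℂ) ^ (-ν) * (w : ℂ) ^ ν := by
  have h := Complex.mul_cpow_ofReal_nonneg (by norm_num : (0 : ℝ) ≤ 4)
    (by positivity : (0 : ℝ) ≤ w / 4) ν
  rw [← Complex.ofReal_mul, mul_div_cancel₀ w (by norm_num), Complex.ofReal_ofNat] at h
  rw [h, ← mul_assoc, ← Complex.cpow_add _ _ (by norm_num), neg_add_cancel, Complex.cpow_zero,
    one_mul]

theorem two_mul_four_cpow (ν : ℂ) : 2 * (4 : ℂ) ^ (-(ν + 1 / 2)) = 4 ^ (-ν) := by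
  rw [← two_cpow_one_sub_two_mul, show 1 - 2 * (ν + 1 / 2) = (1 - 2 * ν) - 1 by ring,
    Complex.cpow_sub _ _ two_ne_zero, two_cpow_one_sub_two_mul, Complex.cpow_one]
  field_simp

theorem exp_mul_besselI_eq {ν : ℂ} (hν : -(1 / 2) < ν.re) {w : ℝ} (hw : 0 < w) :
    ((Real.exp (-w / 2) : ℝ) : ℂ) * besselI ν ((w / 2 : ℝ) : ℂ)
      = ((Real.sqrt Real.pi : ℂ) * Complex.Gamma (ν + 1 / 2))⁻¹ * ((w : ℂ) ^ ν *
        ∫ s in Ioc (0 : ℝ) 1, (s : ℂ) ^ (ν + 1 / 2 - 1) * (1 - (s : ℂ)) ^ (ν + 1 / 2 - 1) *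
          ((Real.exp (-(w * s)) : ℝ) : ℂ)) := by
  have ha : 0 < (ν + 1 / 2).re := by simp; linarith
  have hG := Complex.Gamma_ne_zero_of_re_pos ha
  have hpi : (Real.sqrt Real.pi : ℂ) ≠ 0 := by
    exact_mod_cast (Real.sqrt_pos.2 Real.pi_pos).ne'
  rw [integral_beta_mul_exp ha, besselI_eq ν (by positivity), show w / 2 / 2 = w / 4 by ring,
    four_cpow_neg_mul_cpow hw, two_mul_four_cpow, show ν + 1 / 2 + 1 / 2 = ν + 1 by ring]
  generalize Complex.Gamma (ν + 1 / 2) = G at hG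
  field_simp

theorem integrable_poisson_macdonald {ν : ℂ} (h0 : 0 < ν.re) {y : ℝ} (hy : 0 < y) :
    Integrable (Function.uncurry fun (s w : ℝ) =>
      ((s : ℂ) ^ (ν + 1 / 2 - 1) * (1 - (s : ℂ)) ^ (ν + 1 / 2 - 1)) *
      (((Real.exp (-(s * w) - y / w) : ℝ) : ℂ) * (w : ℂ) ^ (ν - 1)))
      ((volume.restrict (Ioc 0 1)).prod (volume.restrict (Ioi 0))) := by
  have hm : Measurable (Function.uncurry fun (s w : ℝ) =>
      ((s : ℂ) ^ (ν + 1 / 2 - 1) * (1 - (s : ℂ)) ^ (ν + 1 / 2 - 1)) *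
      (((Real.exp (-(s * w) - y / w) : ℝ) : ℂ) * (w : ℂ) ^ (ν - 1))) := by
    unfold Function.uncurry
    fun_prop
  have hin : ∀ s : ℝ, 0 < s → IntegrableOn (fun w : ℝ =>
      ((Real.exp (-(s * w) - y / w) : ℝ) : ℂ) * (w : ℂ) ^ (ν - 1)) (Ioi 0) ∧
      ∫ w in Ioi (0 : ℝ), ‖((Real.exp (-(s * w) - y / w) : ℝ) : ℂ) * (w : ℂ) ^ (ν - 1)‖
        ≤ Real.Gamma ν.re * s ^ (-ν.re) := fun s hs => by
    have hb : IntegrableOn (fun w : ℝ => w ^ (ν.re - 1) * Real.exp (-(s * w))) (Ioi 0) := by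
      have := integrableOn_rpow_mul_exp_neg_mul_rpow (s := ν.re - 1) (p := 1) (b := s)
        (by linarith) one_pos hs
      simpa using this
    have hle : ∀ w ∈ Ioi (0 : ℝ), ‖((Real.exp (-(s * w) - y / w) : ℝ) : ℂ) * (w : ℂ) ^ (ν - 1)‖
        ≤ w ^ (ν.re - 1) * Real.exp (-(s * w)) := fun w hw => by
      have hw : 0 < w := hw
      rw [norm_exp_mul_cpow hw, mul_comm]
      gcongr
      have : 0 < y / w := by positivity
      linarith
    have hi : IntegrableOn (fun w : ℝ =>
        ((Real.exp (-(s * w) - y / w) : ℝ) : ℂ) * (w : ℂ) ^ (ν - 1)) (Ioi 0) :=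
      Integrable.mono' hb (aestronglyMeasurable_macdonald_integrand s ν y)
        ((ae_restrict_iff' measurableSet_Ioi).2 (Eventually.of_forall hle))
    refine ⟨hi, (setIntegral_mono_on hi.norm hb measurableSet_Ioi hle).trans (le_of_eq ?_)⟩
    rw [Real.integral_rpow_mul_exp_neg_mul_Ioi h0 hs, one_div, Real.inv_rpow hs.le,
      Real.rpow_neg hs.le, mul_comm]
  rw [integrable_prod_iff hm.aestronglyMeasurable]
  constructor
  · filter_upwards [ae_restrict_mem measurableSet_Ioc] with s hs
    exact (hin s hs.1).1.const_mul ((s : ℂ) ^ (ν + 1 / 2 - 1) * (1 - (s : ℂ)) ^ (ν + 1 / 2 - 1))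
  · have hbd := ((integrable_beta (u := 1 / 2) (v := ν + 1 / 2) (by norm_num)
      (by simp; linarith)).norm).const_mul (Real.Gamma ν.re)
    refine hbd.mono' hm.aestronglyMeasurable.norm.integral_prod_right' ?_
    filter_upwards [ae_restrict_mem measurableSet_Ioc] with s hs
    have h := (hin s hs.1).2
    simp only [Function.uncurry]
    rw [Real.norm_of_nonneg (integral_nonneg fun _ => norm_nonneg _)]
    simp only [norm_mul _ (((Real.exp _ : ℝ) : ℂ) * _)]
    rw [integral_const_mul]
    refine (mul_le_mul_of_nonneg_left h (norm_nonneg _)).trans (le_of_eq ?_)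
    rw [norm_mul, norm_mul, Complex.norm_cpow_eq_rpow_re_of_pos hs.1,
      Complex.norm_cpow_eq_rpow_re_of_pos hs.1]
    have e : s ^ (ν + 1 / 2 - 1).re * s ^ (-ν.re) = s ^ ((1 / 2 : ℂ) - 1).re := by
      rw [← Real.rpow_add hs.1]
      congr 1
      simp; ring
    rw [← e]
    ring

/-- `∫_0^∞ e^{-w/2 - y/w} I_ν(w/2) dw/w = 2 I_ν(√y) K_ν(√y)` for `0 < Re ν < 1`. By Poisson's
integral the left side is a Beta-type average of the functions `macdonaldIntegral ν (y s)`; integrating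
their series term by term yields the series of the products `I_ν I_{-ν}` and `I_ν^2`. -/
theorem integral_exp_mul_besselI {ν : ℂ} (h0 : 0 < ν.re) (h1 : ν.re < 1) {y : ℝ} (hy : 0 < y) :
    ∫ w in Ioi (0 : ℝ), ((Real.exp (-w / 2 - y / w) / w : ℝ) : ℂ) * besselI ν ((w / 2 : ℝ) : ℂ)
      = 2 * besselI ν ((Real.sqrt y : ℝ) : ℂ) * macdonaldQuotient ν ((Real.sqrt y : ℝ) : ℂ) := by
  have hv : 0 < (ν + 1 / 2).re := by simp; linarith
  have hhalf : 0 < (1 / 2 : ℂ).re := by norm_num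
  have hG := Complex.Gamma_ne_zero_of_re_pos hv
  have hpi : (Real.sqrt Real.pi : ℂ) ≠ 0 := by
    exact_mod_cast (Real.sqrt_pos.2 Real.pi_pos).ne'
  have hs := sin_pi_mul_ne_zero_of_re_mem_Ioo h0 h1
  have hint := integrable_poisson_macdonald h0 hy
  set C := ((Real.sqrt Real.pi : ℂ) * Complex.Gamma (ν + 1 / 2))⁻¹ with hC
  set S := (Real.pi : ℂ) / Complex.sin (Real.pi * ν) with hS
  have step1 : ∫ w in Ioi (0 : ℝ), ((Real.exp (-w / 2 - y / w) / w : ℝ) : ℂ) *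
      besselI ν ((w / 2 : ℝ) : ℂ) = C * ∫ w in Ioi (0 : ℝ), ∫ s in Ioc (0 : ℝ) 1,
        ((s : ℂ) ^ (ν + 1 / 2 - 1) * (1 - (s : ℂ)) ^ (ν + 1 / 2 - 1)) *
        (((Real.exp (-(s * w) - y / w) : ℝ) : ℂ) * (w : ℂ) ^ (ν - 1)) := by
    rw [← integral_const_mul]
    refine setIntegral_congr_fun measurableSet_Ioi fun w hw => ?_
    have hw : 0 < w := hw
    have hw' : (w : ℂ) ≠ 0 := by exact_mod_cast hw.ne'
    have e : ((Real.exp (-w / 2 - y / w) / w : ℝ) : ℂ) * besselI ν ((w / 2 : ℝ) : ℂ)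
        = ((Real.exp (-(y / w)) / w : ℝ) : ℂ) *
          (((Real.exp (-w / 2) : ℝ) : ℂ) * besselI ν ((w / 2 : ℝ) : ℂ)) := by
      rw [sub_eq_add_neg, Real.exp_add]
      push_cast
      ring
    rw [e, exp_mul_besselI_eq (by linarith) hw, ← hC, mul_left_comm]
    congr 1
    rw [← mul_assoc, ← integral_const_mul]
    refine setIntegral_congr_fun measurableSet_Ioc fun s _ => ?_
    rw [Complex.cpow_sub _ _ hw', Complex.cpow_one, sub_eq_add_neg _ (y / w), Real.exp_add,
      mul_comm w s]
    push_cast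
    ring
  have step2 : ∀ s ∈ Ioc (0 : ℝ) 1, ∫ w in Ioi (0 : ℝ),
        ((s : ℂ) ^ (ν + 1 / 2 - 1) * (1 - (s : ℂ)) ^ (ν + 1 / 2 - 1)) *
        (((Real.exp (-(s * w) - y / w) : ℝ) : ℂ) * (w : ℂ) ^ (ν - 1))
      = S * ((s : ℂ) ^ ((1 / 2 : ℂ) - 1) * (1 - (s : ℂ)) ^ (ν + 1 / 2 - 1) *
          besselSeries (1 - ν) ((y * s : ℝ) : ℂ)) - S * (y : ℂ) ^ ν *
        ((s : ℂ) ^ (ν + 1 / 2 - 1) * (1 - (s : ℂ)) ^ (ν + 1 / 2 - 1) *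
          besselSeries (1 + ν) ((y * s : ℝ) : ℂ)) := fun s hs => by
    have hs' : (s : ℂ) ≠ 0 := by exact_mod_cast hs.1.ne'
    rw [integral_const_mul, integral_cpow_mul_exp_neg_mul_sub_div ν hs.1,
      macdonaldIntegral_eq h0 h1 (mul_pos hy hs.1), ← hS, Complex.ofReal_mul,
      Complex.mul_cpow_ofReal_nonneg hy.le hs.1.le]
    have e1 : (s : ℂ) ^ (ν + 1 / 2 - 1) = (s : ℂ) ^ ((1 / 2 : ℂ) - 1) * (s : ℂ) ^ ν := by
      rw [← Complex.cpow_add _ _ hs']; ring_nf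
    have e2 : (s : ℂ) ^ ν * (s : ℂ) ^ (-ν) = 1 := by
      rw [← Complex.cpow_add _ _ hs', add_neg_cancel, Complex.cpow_zero]
    rw [e1]
    linear_combination (S * ((s : ℂ) ^ ((1 / 2 : ℂ) - 1) * (1 - (s : ℂ)) ^ (ν + 1 / 2 - 1) *
      (besselSeries (1 - ν) (y * s) - (y : ℂ) ^ ν * (s : ℂ) ^ ν * besselSeries (1 + ν) (y * s))))
      * e2
  have sum1 : C * ∫ s in Ioc (0 : ℝ) 1, (s : ℂ) ^ ((1 / 2 : ℂ) - 1) *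
      (1 - (s : ℂ)) ^ (ν + 1 / 2 - 1) * besselSeries (1 - ν) ((y * s : ℝ) : ℂ)
      = besselSeries (-ν + 1) ((y / 4 : ℝ) : ℂ) * besselSeries (ν + 1) ((y / 4 : ℝ) : ℂ) := by
    refine ((hasSum_integral_beta_mul_besselSeries hhalf hv (1 - ν) y).mul_left C).unique ?_
    convert! hasSum_besselSeries_mul (μ := -ν) (ν := ν) (by simp) ((y / 4 : ℝ) : ℂ) using 2 with k
    have hk : (k.factorial : ℂ) ≠ 0 := by exact_mod_cast k.factorial_ne_zero
    rw [neg_add_cancel, zero_add, zero_add, Complex.Gamma_nat_eq_factorial,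
      show (2 : ℂ) * k + 1 = ((2 * k : ℕ) : ℂ) + 1 by push_cast; rfl,
      Complex.Gamma_nat_eq_factorial, add_comm (1 / 2 : ℂ) (k : ℂ), Gamma_natCast_add_half,
      show (1 / 2 : ℂ) + (ν + 1 / 2) + k = ν + k + 1 by ring,
      show 1 - ν + (k : ℂ) = -ν + k + 1 by ring, hC]
    generalize (Complex.Gamma (ν + k + 1))⁻¹ = A
    generalize (Complex.Gamma (-ν + k + 1))⁻¹ = B
    have e : ((y / 4 : ℝ) : ℂ) ^ k = (y : ℂ) ^ k * (4 : ℂ)⁻¹ ^ k := by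
      rw [← mul_pow]; push_cast; rfl
    rw [e]
    generalize Complex.Gamma (ν + 1 / 2) = G at hG
    field_simp
  have sum2 : C * ∫ s in Ioc (0 : ℝ) 1, (s : ℂ) ^ (ν + 1 / 2 - 1) *
      (1 - (s : ℂ)) ^ (ν + 1 / 2 - 1) * besselSeries (1 + ν) ((y * s : ℝ) : ℂ)
      = (4 : ℂ) ^ (-ν) * (besselSeries (ν + 1) ((y / 4 : ℝ) : ℂ) *
        besselSeries (ν + 1) ((y / 4 : ℝ) : ℂ)) := by
    refine ((hasSum_integral_beta_mul_besselSeries hv hv (1 + ν) y).mul_left C).unique ?_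
    convert! (hasSum_besselSeries_mul (μ := ν) (ν := ν) (by simp; linarith)
      ((y / 4 : ℝ) : ℂ)).mul_left ((4 : ℂ) ^ (-ν)) using 2 with k
    have hk : (k.factorial : ℂ) ≠ 0 := by exact_mod_cast k.factorial_ne_zero
    have hGk : Complex.Gamma (ν + k + 1) ≠ 0 :=
      Complex.Gamma_ne_zero_of_re_pos (by simp; positivity)
    have e : ((y / 4 : ℝ) : ℂ) ^ k = (y : ℂ) ^ k * (4 : ℂ)⁻¹ ^ k := by
      rw [← mul_pow]; push_cast; rfl
    have hd := Gamma_mul_Gamma_add_half_eq (ν + k + 1 / 2)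
    rw [show ν + (k : ℂ) + 1 / 2 + 1 / 2 = ν + k + 1 by ring,
      show 2 * (ν + (k : ℂ) + 1 / 2) = ν + ν + 2 * k + 1 by ring, two_mul_four_cpow, neg_add,
      Complex.cpow_add _ _ (by norm_num : (4 : ℂ) ≠ 0), Complex.cpow_neg _ (k : ℂ),
      Complex.cpow_natCast] at hd
    rw [e, show ν + 1 / 2 + (k : ℂ) = ν + k + 1 / 2 by ring,
      show ν + 1 / 2 + (ν + 1 / 2) + (k : ℂ) = ν + ν + k + 1 by ring,
      show 1 + ν + (k : ℂ) = ν + k + 1 by ring, hC]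
    rw [eq_div_of_mul_eq hGk hd, inv_pow]
    generalize (Complex.Gamma (ν + ν + k + 1))⁻¹ = A
    generalize Complex.Gamma (ν + ν + 2 * k + 1) = B
    generalize Complex.Gamma (ν + 1 / 2) = G at hG
    generalize Complex.Gamma (ν + k + 1) = G' at hGk
    field_simp
  have i1 := (integrable_beta_mul_besselSeries hhalf hv (1 - ν) y).const_mul S
  have i2 := (integrable_beta_mul_besselSeries hv hv (1 + ν) y).const_mul (S * (y : ℂ) ^ ν)
  rw [step1, integral_integral_swap (f := fun (w s : ℝ) =>
        ((s : ℂ) ^ (ν + 1 / 2 - 1) * (1 - (s : ℂ)) ^ (ν + 1 / 2 - 1)) *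
        (((Real.exp (-(s * w) - y / w) : ℝ) : ℂ) * (w : ℂ) ^ (ν - 1))) hint.swap,
    setIntegral_congr_fun measurableSet_Ioc step2, integral_sub i1 i2, integral_const_mul,
    integral_const_mul, mul_sub, mul_left_comm C S, sum1, mul_left_comm C, sum2]
  have hr : 0 < Real.sqrt y := Real.sqrt_pos.2 hy
  have hr2 : (Real.sqrt y / 2) ^ 2 = y / 4 := by
    rw [div_pow, Real.sq_sqrt hy.le]; norm_num
  rw [macdonaldQuotient, besselI_eq _ hr, besselI_eq _ hr, hr2]
  have hr' : ((Real.sqrt y / 2 : ℝ) : ℂ) ≠ 0 := by exact_mod_cast (by positivity)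
  have e1 : ((Real.sqrt y / 2 : ℝ) : ℂ) ^ ν * ((Real.sqrt y / 2 : ℝ) : ℂ) ^ (-ν) = 1 := by
    rw [← Complex.cpow_add _ _ hr', add_neg_cancel, Complex.cpow_zero]
  have e2 : (4 : ℂ) ^ (-ν) * (y : ℂ) ^ ν
      = ((Real.sqrt y / 2 : ℝ) : ℂ) ^ ν * ((Real.sqrt y / 2 : ℝ) : ℂ) ^ ν := by
    rw [← four_cpow_neg_mul_cpow hy, ← Complex.mul_cpow_ofReal_nonneg (by positivity)
      (by positivity), ← Complex.ofReal_mul, ← sq, hr2]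
  have e3 : (Real.pi : ℂ) / (2 * Complex.sin (Real.pi * ν)) = S / 2 := by
    rw [hS]; field_simp
  rw [e3]
  generalize ((Real.sqrt y / 2 : ℝ) : ℂ) ^ ν = A at *
  generalize ((Real.sqrt y / 2 : ℝ) : ℂ) ^ (-ν) = B at *
  generalize besselSeries (-ν + 1) ((y / 4 : ℝ) : ℂ) = P at *
  generalize besselSeries (ν + 1) ((y / 4 : ℝ) : ℂ) = Q at *
  linear_combination (-S * P * Q) * e1 - S * Q * Q * e2

/-! ### The kernel identity on the imaginary axis -/

theorem differentiable_besselI {z : ℝ} (hz : 0 < z) :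
    Differentiable ℂ fun ν => besselI ν (z : ℂ) := by
  have h0 : ((z / 2 : ℝ) : ℂ) ≠ 0 := by exact_mod_cast (by positivity : z / 2 ≠ 0)
  have h : (fun ν => besselI ν (z : ℂ)) = fun ν => ((z / 2 : ℝ) : ℂ) ^ ν *
      besselSeries (ν + 1) (((z / 2) ^ 2 : ℝ) : ℂ) := funext fun ν => besselI_eq ν hz
  rw [h]
  refine Differentiable.mul (fun ν => ?_) ?_
  · exact (differentiableAt_id).const_cpow (Or.inl h0)
  · exact (differentiable_besselSeries_left _).comp (differentiable_id.add_const 1)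

/-- The quotient defining `K_ν` tends to `K_{iτ}` as `ν → iτ`; at `τ = 0` the limit exists because
`I_{-ν} - I_ν` is differentiable and vanishes at `0`. -/
theorem tendsto_macdonaldQuotient (τ : ℝ) {z : ℝ} (hz : 0 < z) :
    Tendsto (fun μ => macdonaldQuotient μ (z : ℂ)) (𝓝[≠] (Complex.I * τ))
      (𝓝 (macdonaldK (Complex.I * τ) (z : ℂ))) := by
  have hD : Differentiable ℂ fun μ => besselI (-μ) (z : ℂ) - besselI μ (z : ℂ) :=
    ((differentiable_besselI hz).comp differentiable_neg).sub (differentiable_besselI hz)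
  by_cases hs : Complex.sin ((Real.pi : ℂ) * (Complex.I * τ)) = 0
  · rw [macdonaldK, if_pos hs]
    refine tendsto_nhds_limUnder ?_
    have hτ : τ = 0 := by
      obtain ⟨k, hk⟩ := Complex.sin_eq_zero_iff.1 hs
      have := congrArg Complex.im hk
      simpa [Real.pi_ne_zero] using this
    rw [hτ, Complex.ofReal_zero, mul_zero]
    have h1 := (hD 0).hasDerivAt.tendsto_slope
    have hsin : HasDerivAt (fun μ : ℂ => Complex.sin (Real.pi * μ)) (Real.pi : ℂ) 0 := by
      have := ((hasDerivAt_id (0 : ℂ)).const_mul (Real.pi : ℂ)).csin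
      simpa using this
    have h2 := hsin.tendsto_slope
    have hpi : (Real.pi : ℂ) ≠ 0 := by exact_mod_cast Real.pi_ne_zero
    refine ⟨_, ((h1.div h2 hpi).const_mul ((Real.pi : ℂ) / 2)).congr' ?_⟩
    filter_upwards [self_mem_nhdsWithin] with μ hμ
    have hμ : μ ≠ 0 := hμ
    simp only [Pi.div_apply, slope_def_field, macdonaldQuotient, sub_zero, neg_zero, sub_self,
      mul_zero, Complex.sin_zero]
    rw [div_div_div_cancel_right₀ hμ, div_mul_div_comm, div_mul_eq_mul_div]
  · rw [macdonaldK, if_neg hs]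
    have hc : ContinuousAt (fun μ => macdonaldQuotient μ (z : ℂ)) (Complex.I * τ) := by
      refine ContinuousAt.mul (ContinuousAt.div continuousAt_const ?_ ?_) hD.continuous.continuousAt
      · fun_prop
      · simpa using hs
    exact hc.tendsto.mono_left nhdsWithin_le_nhds

theorem integral_exp_neg_div_mul_rpow {δ y : ℝ} (hδ : 0 < δ) (hy : 0 < y) :
    IntegrableOn (fun w : ℝ => Real.exp (-(y / w)) * w ^ (-δ - 1)) (Ioi 0) ∧
    ∫ w in Ioi (0 : ℝ), Real.exp (-(y / w)) * w ^ (-δ - 1) = Real.Gamma δ * y ^ (-δ) := by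
  have e : ∀ w ∈ Ioi (0 : ℝ), (y / w ^ 2) • (Real.exp (-(y / w)) * (y / w) ^ (δ - 1))
      = y ^ δ * (Real.exp (-(y / w)) * w ^ (-δ - 1)) := fun w hw => by
    have hw : 0 < w := hw
    rw [Real.div_rpow hy.le hw.le, Real.rpow_sub hy, Real.rpow_sub hw, Real.rpow_sub hw,
      Real.rpow_neg hw.le, Real.rpow_one, Real.rpow_one, smul_eq_mul]
    field_simp
  have hyδ : y ^ δ ≠ 0 := (Real.rpow_pos_of_pos hy δ).ne'
  constructor
  · have h := (integrableOn_comp_div_Ioi_iff _ hy).2 (Real.GammaIntegral_convergent hδ)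
    rw [integrableOn_congr_fun e measurableSet_Ioi] at h
    refine (h.const_mul (y ^ δ)⁻¹).congr (Eventually.of_forall fun w => ?_)
    simp only
    rw [← mul_assoc, inv_mul_cancel₀ hyδ, one_mul]
  · have h := integral_comp_div_Ioi (fun u => Real.exp (-u) * u ^ (δ - 1)) hy
    rw [setIntegral_congr_fun measurableSet_Ioi e, integral_const_mul,
      ← Real.Gamma_eq_integral hδ] at h
    rw [← h, Real.rpow_neg hy.le]
    field_simp

theorem continuousOn_besselI_half (ν : ℂ) :
    ContinuousOn (fun w : ℝ => besselI ν ((w / 2 : ℝ) : ℂ)) (Ioi 0) := by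
  have h : ContinuousOn (fun w : ℝ => ((w / 4 : ℝ) : ℂ) ^ ν *
      besselSeries (ν + 1) (((w / 4) ^ 2 : ℝ) : ℂ)) (Ioi 0) := by
    refine ContinuousOn.mul (fun w hw => ?_)
      (((continuous_besselSeries _).comp (by fun_prop)).continuousOn)
    have hw : 0 < w := hw
    have h1 : ContinuousAt (fun w : ℝ => w / 4) w := by fun_prop
    exact ((Complex.continuousAt_ofReal_cpow_const (w / 4) ν
      (Or.inr (by positivity))).comp (f := fun w : ℝ => w / 4) h1).continuousWithinAt
  refine h.congr fun w hw => ?_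
  have hw : 0 < w := hw
  rw [besselI_eq ν (by positivity), show w / 2 / 2 = w / 4 by ring]

theorem aestronglyMeasurable_exp_mul_besselI (ν : ℂ) (y : ℝ) :
    AEStronglyMeasurable (fun w : ℝ => ((Real.exp (-w / 2 - y / w) / w : ℝ) : ℂ) *
      besselI ν ((w / 2 : ℝ) : ℂ)) (volume.restrict (Ioi 0)) := by
  refine AEStronglyMeasurable.mul ?_
    ((continuousOn_besselI_half ν).aestronglyMeasurable measurableSet_Ioi)
  have : Measurable fun w : ℝ => ((Real.exp (-w / 2 - y / w) / w : ℝ) : ℂ) := by fun_prop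
  exact this.aestronglyMeasurable

/-- A majorant of `e^{-w/2 - y/w} |I_ν(w/2)| / w`, uniform in `0 ≤ Re ν ≤ 1/4`. -/
theorem norm_exp_mul_besselI_le {ν : ℂ} (h0 : 0 ≤ ν.re) (h1 : ν.re ≤ 1 / 4) {M : ℝ}
    (hM : ‖(Complex.Gamma (ν + 1))⁻¹‖ ≤ M) {w : ℝ} (hw : 0 < w) (y : ℝ) :
    ‖((Real.exp (-w / 2 - y / w) / w : ℝ) : ℂ) * besselI ν ((w / 2 : ℝ) : ℂ)‖ ≤
      M * 2 * (Real.exp (-(y / w)) * w ^ (-(1 / 2) - 1 : ℝ) +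
        Real.exp (-(y / w)) * w ^ (-(1 / 4) - 1 : ℝ)) := by
  have hM0 : 0 ≤ M := (norm_nonneg _).trans hM
  have hb := norm_besselI_le_div_sqrt h0 (show 0 < w / 2 by positivity)
  rw [norm_mul, Complex.norm_real, Real.norm_of_nonneg (by positivity)]
  have hp : (w / 2 / 2) ^ ν.re ≤ 1 + w ^ (1 / 4 : ℝ) := by
    rcases le_total (w / 2 / 2) 1 with h | h
    · exact (Real.rpow_le_one (by positivity) h h0).trans
        (by linarith [Real.rpow_nonneg hw.le (1 / 4 : ℝ)])
    · refine (Real.rpow_le_rpow_of_exponent_le h h1).trans ?_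
      have : (w / 2 / 2) ^ (1 / 4 : ℝ) ≤ w ^ (1 / 4 : ℝ) :=
        Real.rpow_le_rpow (by positivity) (by linarith) (by norm_num)
      linarith
  have hs : (Real.sqrt (w / 2))⁻¹ ≤ 2 * w ^ (-(1 / 2) : ℝ) := by
    rw [Real.rpow_neg hw.le, ← Real.sqrt_eq_rpow, Real.sqrt_div hw.le, inv_div, div_eq_mul_inv]
    gcongr
    rw [Real.sqrt_le_left (by norm_num)]
    norm_num
  have e1 : w ^ (-(1 / 2) - 1 : ℝ) = w ^ (-(1 / 2) : ℝ) * w⁻¹ := by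
    rw [Real.rpow_sub hw, Real.rpow_one, div_eq_mul_inv]
  have e2 : w ^ (-(1 / 4) - 1 : ℝ) = w ^ (1 / 4 : ℝ) * (w ^ (-(1 / 2) : ℝ) * w⁻¹) := by
    rw [← mul_assoc, ← Real.rpow_add hw, ← Real.rpow_neg_one w, ← Real.rpow_add hw]
    norm_num
  calc Real.exp (-w / 2 - y / w) / w * ‖besselI ν ((w / 2 : ℝ) : ℂ)‖
      ≤ Real.exp (-w / 2 - y / w) / w * ((1 + w ^ (1 / 4 : ℝ)) * M *
          (Real.exp (w / 2) * (2 * w ^ (-(1 / 2) : ℝ)))) := by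
        gcongr
        refine hb.trans ?_
        gcongr
    _ = (Real.exp (-w / 2 - y / w) * Real.exp (w / 2)) * (M * 2 * ((1 + w ^ (1 / 4 : ℝ)) *
          (w ^ (-(1 / 2) : ℝ) * w⁻¹))) := by ring
    _ = _ := by
        rw [← Real.exp_add, show -w / 2 - y / w + w / 2 = -(y / w) by ring, e1, e2]
        ring

theorem integrable_exp_mul_besselI {ν : ℂ} (h0 : 0 ≤ ν.re) (h1 : ν.re ≤ 1 / 4) {y : ℝ}
    (hy : 0 < y) :
    IntegrableOn (fun w : ℝ => ((Real.exp (-w / 2 - y / w) / w : ℝ) : ℂ) *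
      besselI ν ((w / 2 : ℝ) : ℂ)) (Ioi 0) := by
  refine Integrable.mono' (((integral_exp_neg_div_mul_rpow (by norm_num : (0 : ℝ) < 1 / 2) hy).1.add
    (integral_exp_neg_div_mul_rpow (by norm_num : (0 : ℝ) < 1 / 4) hy).1).const_mul
      (‖(Complex.Gamma (ν + 1))⁻¹‖ * 2))
    (aestronglyMeasurable_exp_mul_besselI ν y) ?_
  filter_upwards [ae_restrict_mem measurableSet_Ioi] with w hw
  exact norm_exp_mul_besselI_le h0 h1 le_rfl hw y

/-- The identity of `integral_exp_mul_besselI`, carried to the imaginary axis by continuity. -/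
theorem integral_exp_mul_besselI_I_mul (τ : ℝ) {y : ℝ} (hy : 0 < y) :
    ∫ w in Ioi (0 : ℝ), ((Real.exp (-w / 2 - y / w) / w : ℝ) : ℂ) *
        besselI (Complex.I * τ) ((w / 2 : ℝ) : ℂ)
      = 2 * besselI (Complex.I * τ) ((Real.sqrt y : ℝ) : ℂ) *
        macdonaldK (Complex.I * τ) ((Real.sqrt y : ℝ) : ℂ) := by
  have hr : 0 < Real.sqrt y := Real.sqrt_pos.2 hy
  have hpath : Tendsto (fun ε : ℝ => Complex.I * τ + (ε : ℂ)) (𝓝[>] 0)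
      (𝓝[≠] (Complex.I * τ)) := by
    refine tendsto_nhdsWithin_iff.2 ⟨?_, ?_⟩
    · have : Continuous fun ε : ℝ => Complex.I * τ + (ε : ℂ) := by fun_prop
      have := this.tendsto 0
      rw [Complex.ofReal_zero, add_zero] at this
      exact this.mono_left nhdsWithin_le_nhds
    · filter_upwards [self_mem_nhdsWithin] with ε hε
      have hε : 0 < ε := hε
      simpa using hε.ne'
  have hpath' := hpath.mono_right nhdsWithin_le_nhds
  have hre : ∀ ε : ℝ, (Complex.I * τ + (ε : ℂ)).re = ε := fun ε => by simp
  have hR : Tendsto (fun ε : ℝ => 2 * besselI (Complex.I * τ + ε) ((Real.sqrt y : ℝ) : ℂ) *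
      macdonaldQuotient (Complex.I * τ + ε) ((Real.sqrt y : ℝ) : ℂ)) (𝓝[>] 0) (𝓝 (2 *
        besselI (Complex.I * τ) ((Real.sqrt y : ℝ) : ℂ) *
        macdonaldK (Complex.I * τ) ((Real.sqrt y : ℝ) : ℂ))) :=
    ((((differentiable_besselI hr).continuous.tendsto _).comp hpath').const_mul 2).mul
      ((tendsto_macdonaldQuotient τ hr).comp hpath)
  obtain ⟨M, hM0, hM⟩ := exists_norm_inv_Gamma_add_natCast_le (|τ| + 2)
  have hL : Tendsto (fun ε : ℝ => ∫ w in Ioi (0 : ℝ), ((Real.exp (-w / 2 - y / w) / w : ℝ) : ℂ) *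
        besselI (Complex.I * τ + ε) ((w / 2 : ℝ) : ℂ)) (𝓝[>] 0) (𝓝 (∫ w in Ioi (0 : ℝ),
          ((Real.exp (-w / 2 - y / w) / w : ℝ) : ℂ) *
            besselI (Complex.I * τ) ((w / 2 : ℝ) : ℂ))) := by
    refine tendsto_integral_filter_of_dominated_convergence _
      (Eventually.of_forall fun ε => aestronglyMeasurable_exp_mul_besselI _ y) ?_
      (((integral_exp_neg_div_mul_rpow (by norm_num : (0 : ℝ) < 1 / 2) hy).1.add
        (integral_exp_neg_div_mul_rpow (by norm_num : (0 : ℝ) < 1 / 4) hy).1).const_mul (M * 2)) ?_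
    · filter_upwards [Ioc_mem_nhdsGT (by norm_num : (0 : ℝ) < 1 / 4)] with ε hε
      filter_upwards [ae_restrict_mem measurableSet_Ioi] with w hw
      refine norm_exp_mul_besselI_le ?_ ?_ ?_ hw y
      · rw [hre]; exact hε.1.le
      · rw [hre]; exact hε.2
      · have := hM (Complex.I * τ + ε + 1) ?_ 0
        · simpa using this
        · refine (norm_add₃_le).trans ?_
          have : ‖(ε : ℂ)‖ ≤ 1 := by
            rw [Complex.norm_real, Real.norm_of_nonneg hε.1.le]; linarith [hε.2]
          simp only [norm_mul, Complex.norm_I, one_mul, Complex.norm_real, Real.norm_eq_abs,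
            norm_one] at this ⊢
          linarith
    · filter_upwards [ae_restrict_mem measurableSet_Ioi] with w hw
      have hw : 0 < w := hw
      exact (((differentiable_besselI (show 0 < w / 2 by positivity)).continuous.tendsto _).comp
        hpath').const_mul _
  refine tendsto_nhds_unique hL (hR.congr' ?_)
  filter_upwards [Ioc_mem_nhdsGT (by norm_num : (0 : ℝ) < 1 / 4)] with ε hε
  rw [integral_exp_mul_besselI (by rw [hre]; exact hε.1) (by rw [hre]; linarith [hε.2]) hy]

/-! ### Reality of `K_{iτ}` -/

theorem besselI_conj (ν : ℂ) {z : ℝ} (hz : 0 < z) :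
    besselI ((starRingEnd ℂ) ν) (z : ℂ) = (starRingEnd ℂ) (besselI ν (z : ℂ)) := by
  have hz2 : (z : ℂ) / 2 = ((z / 2 : ℝ) : ℂ) := by push_cast; rfl
  rw [besselI, besselI, Complex.conj_tsum]
  congr 1 with k
  have hc := Complex.cpow_conj ((z / 2 : ℝ) : ℂ) (2 * (k : ℂ) + ν)
    (by rw [Complex.arg_ofReal_of_nonneg (by positivity)]; exact Real.pi_pos.ne)
  rw [Complex.conj_ofReal] at hc
  rw [map_div₀, map_mul, hz2, ← Complex.Gamma_conj, ← hc, map_add, map_mul,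
    map_ofNat]
  simp

theorem macdonaldQuotient_conj (ν : ℂ) {z : ℝ} (hz : 0 < z) :
    macdonaldQuotient ((starRingEnd ℂ) ν) (z : ℂ)
      = (starRingEnd ℂ) (macdonaldQuotient ν (z : ℂ)) := by
  rw [macdonaldQuotient, macdonaldQuotient, map_mul, map_div₀, map_mul, ← Complex.sin_conj, map_sub,
    map_mul, besselI_conj ν hz, ← map_neg, besselI_conj (-ν) hz,
    map_ofNat, Complex.conj_ofReal]

theorem macdonaldQuotient_neg (ν z : ℂ) : macdonaldQuotient (-ν) z = macdonaldQuotient ν z := by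
  rw [macdonaldQuotient, macdonaldQuotient, neg_neg, mul_neg, Complex.sin_neg]
  rw [mul_neg, div_neg]
  ring

theorem conj_macdonaldK (τ : ℝ) {z : ℝ} (hz : 0 < z) :
    (starRingEnd ℂ) (macdonaldK (Complex.I * τ) (z : ℂ)) = macdonaldK (Complex.I * τ) (z : ℂ) := by
  have hpath : Tendsto (fun ε : ℝ => Complex.I * ((τ + ε : ℝ) : ℂ)) (𝓝[>] 0)
      (𝓝[≠] (Complex.I * τ)) := by
    refine tendsto_nhdsWithin_iff.2 ⟨?_, ?_⟩
    · have : Continuous fun ε : ℝ => Complex.I * ((τ + ε : ℝ) : ℂ) := by fun_prop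
      have := this.tendsto 0
      rw [add_zero] at this
      exact this.mono_left nhdsWithin_le_nhds
    · filter_upwards [self_mem_nhdsWithin] with ε hε
      have hε : 0 < ε := hε
      simpa using hε.ne'
  have h1 := (tendsto_macdonaldQuotient τ hz).comp hpath
  have h2 := (Complex.continuous_conj.tendsto _).comp h1
  refine tendsto_nhds_unique h2 (h1.congr fun ε => ?_)
  simp only [Function.comp]
  rw [← macdonaldQuotient_conj _ hz, map_mul, Complex.conj_I, Complex.conj_ofReal, neg_mul,
    macdonaldQuotient_neg]

/-- The Lebedev kernel is the transform of the kernel of `F` under `g ↦ ∫_0^∞ e^{-y/w} g(w) dw/w`. -/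
theorem integral_skalskayaKernel (τ : ℝ) {y : ℝ} (hy : 0 < y) :
    ∫ w in Ioi (0 : ℝ), ((Real.exp (-(y / w)) / w : ℝ) : ℂ) * (skalskayaKernel τ w : ℂ)
      = 2 * lebedevKernel τ y := by
  have hr : 0 < Real.sqrt y := Real.sqrt_pos.2 hy
  have hint := integrable_exp_mul_besselI (ν := Complex.I * τ) (by simp) (by simp) hy
  have h := congrArg Complex.re (integral_exp_mul_besselI_I_mul τ hy)
  have hre := integral_re hint
  simp only [RCLike.re_eq_complex_re] at hre
  rw [← hre] at h
  have e : ∀ w : ℝ, ((Real.exp (-(y / w)) / w : ℝ) : ℂ) * (skalskayaKernel τ w : ℂ)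
      = (((((Real.exp (-w / 2 - y / w) / w : ℝ) : ℂ) *
        besselI (Complex.I * τ) ((w / 2 : ℝ) : ℂ)).re : ℝ) : ℂ) := fun w => by
    rw [Complex.re_ofReal_mul, skalskayaKernel, sub_eq_add_neg, Real.exp_add]
    push_cast
    ring
  simp only [e]
  rw [integral_complex_ofReal, h, lebedevKernel]
  have hK : ((macdonaldK (Complex.I * τ) ((Real.sqrt y : ℝ) : ℂ)).re : ℂ)
      = macdonaldK (Complex.I * τ) ((Real.sqrt y : ℝ) : ℂ) :=
    Complex.conj_eq_iff_re.1 (conj_macdonaldK τ hr)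
  rw [← hK, Complex.re_mul_ofReal]
  push_cast
  rw [show (2 * besselI (Complex.I * τ) ((Real.sqrt y : ℝ) : ℂ)).re
    = 2 * (besselI (Complex.I * τ) ((Real.sqrt y : ℝ) : ℂ)).re by simp]
  push_cast
  ring

/-! ### Bounds for the kernel and the operator on `L_1` -/

theorem sinh_le_mul_cosh {x : ℝ} (hx : 0 ≤ x) : Real.sinh x ≤ x * Real.cosh x := by
  refine hasSum_le (fun k => ?_) (Real.hasSum_sinh x) ((Real.hasSum_cosh x).mul_left x)
  rw [pow_succ, mul_comm (x ^ (2 * k)) x, mul_div_assoc]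
  gcongr
  omega

/-- `|Γ(1 + iτ)|^{-2} = sinh(πτ) / (πτ) ≤ cosh(πτ)`. -/
theorem norm_inv_Gamma_I_mul_add_one_le (τ : ℝ) :
    ‖(Complex.Gamma (Complex.I * τ + 1))⁻¹‖ ≤ Real.cosh (Real.pi * τ) := by
  have hc := Real.one_le_cosh (Real.pi * τ)
  rcases eq_or_ne τ 0 with rfl | hτ
  · simp
  have hz : Complex.I * τ ≠ 0 := by simp [hτ]
  have h := Complex.Gamma_mul_Gamma_one_sub (Complex.I * τ)
  have hconj : Complex.Gamma (1 - Complex.I * τ)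
      = (starRingEnd ℂ) (Complex.Gamma (Complex.I * τ + 1)) := by
    rw [← Complex.Gamma_conj]; congr 1; simp; ring
  have h2 : ‖Complex.Gamma (Complex.I * τ + 1)‖ ^ 2 = Real.pi * |τ| / |Real.sinh (Real.pi * τ)| := by
    have h3 := congrArg (fun z => ‖Complex.I * τ * z‖) h
    rw [← mul_assoc, ← Complex.Gamma_add_one _ hz, hconj, norm_mul, RCLike.norm_conj,
      show (Real.pi : ℂ) * (Complex.I * τ) = ((Real.pi * τ : ℝ) : ℂ) * Complex.I by push_cast; ring,
      Complex.sin_mul_I, ← Complex.ofReal_sinh] at h3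
    rw [sq, h3]
    simp only [norm_mul, norm_div, Complex.norm_I, Complex.norm_real, Real.norm_eq_abs, one_mul,
      mul_one, abs_of_pos Real.pi_pos]
    ring
  have hs : |Real.sinh (Real.pi * τ)| ≤ Real.pi * |τ| * Real.cosh (Real.pi * τ) := by
    rw [Real.abs_sinh, ← Real.cosh_abs (Real.pi * τ), abs_mul, abs_of_pos Real.pi_pos]
    exact sinh_le_mul_cosh (by positivity)
  have hs0 : 0 < |Real.sinh (Real.pi * τ)| := by
    rw [abs_pos, Ne, Real.sinh_eq_zero]
    exact mul_ne_zero Real.pi_ne_zero hτ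
  have hτ0 : 0 < |τ| := abs_pos.2 hτ
  have hpi := Real.pi_pos
  refine le_of_sq_le_sq ?_ (by linarith)
  rw [norm_inv, inv_pow, h2, inv_div, div_le_iff₀ (by positivity)]
  calc |Real.sinh (Real.pi * τ)| ≤ Real.pi * |τ| * Real.cosh (Real.pi * τ) := hs
    _ ≤ _ := by
      rw [mul_comm, sq]
      have : 0 ≤ Real.pi * |τ| := by positivity
      nlinarith [mul_nonneg this (by linarith : 0 ≤ Real.cosh (Real.pi * τ) - 1)]

theorem abs_skalskayaKernel_le (τ : ℝ) {x : ℝ} (hx : 0 < x) :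
    |skalskayaKernel τ x| ≤ Real.cosh (Real.pi * τ) := by
  have hb := norm_besselI_le (ν := Complex.I * τ) (by simp) (show 0 < x / 2 by positivity)
  simp only [Complex.mul_re, Complex.I_re, zero_mul, Complex.I_im, Complex.ofReal_im, mul_zero,
    sub_self, Real.rpow_zero, one_mul] at hb
  rw [skalskayaKernel, abs_mul, abs_of_pos (Real.exp_pos _)]
  calc Real.exp (-x / 2) * |(besselI (Complex.I * τ) ((x / 2 : ℝ) : ℂ)).re|
      ≤ Real.exp (-x / 2) * (Real.cosh (Real.pi * τ) * Real.exp (x / 2)) := by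
        gcongr
        refine (Complex.abs_re_le_norm _).trans (hb.trans ?_)
        gcongr
        exact norm_inv_Gamma_I_mul_add_one_le τ
    _ = Real.cosh (Real.pi * τ) * (Real.exp (-x / 2) * Real.exp (x / 2)) := by ring
    _ = _ := by rw [← Real.exp_add, neg_div, neg_add_cancel, Real.exp_zero, mul_one]

theorem abs_skalskayaKernel_le_rpow (τ : ℝ) {δ : ℝ} (h0 : 0 ≤ δ) (h1 : δ ≤ 1 / 2) {x : ℝ}
    (hx : 0 < x) : |skalskayaKernel τ x| ≤ 2 * Real.cosh (Real.pi * τ) * x ^ (-δ) := by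
  have hc := Real.one_le_cosh (Real.pi * τ)
  rcases le_total x 1 with hx1 | hx1
  · refine (abs_skalskayaKernel_le τ hx).trans ?_
    have : 1 ≤ x ^ (-δ) := Real.one_le_rpow_of_pos_of_le_one_of_nonpos hx hx1 (by linarith)
    nlinarith
  have hb := norm_besselI_le_div_sqrt (ν := Complex.I * τ) (by simp) (show 0 < x / 2 by positivity)
  simp only [Complex.mul_re, Complex.I_re, zero_mul, Complex.I_im, Complex.ofReal_im, mul_zero,
    sub_self, Real.rpow_zero, one_mul] at hb
  rw [skalskayaKernel, abs_mul, abs_of_pos (Real.exp_pos _)]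
  have hs : (Real.sqrt (x / 2))⁻¹ ≤ 2 * x ^ (-δ) := by
    have e : x ^ (-(1 / 2) : ℝ) ≤ x ^ (-δ) := Real.rpow_le_rpow_of_exponent_le hx1 (by linarith)
    refine le_trans ?_ (mul_le_mul_of_nonneg_left e zero_le_two)
    rw [Real.rpow_neg hx.le, ← Real.sqrt_eq_rpow, Real.sqrt_div hx.le, inv_div, div_eq_mul_inv]
    gcongr
    rw [Real.sqrt_le_left (by norm_num)]
    norm_num
  calc Real.exp (-x / 2) * |(besselI (Complex.I * τ) ((x / 2 : ℝ) : ℂ)).re|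
      ≤ Real.exp (-x / 2) * (Real.cosh (Real.pi * τ) * (Real.exp (x / 2) * (2 * x ^ (-δ)))) := by
        gcongr
        refine (Complex.abs_re_le_norm _).trans (hb.trans ?_)
        gcongr
        exact norm_inv_Gamma_I_mul_add_one_le τ
    _ = (Real.exp (-x / 2) * Real.exp (x / 2)) * (2 * Real.cosh (Real.pi * τ) * x ^ (-δ)) := by ring
    _ = _ := by rw [← Real.exp_add, neg_div, neg_add_cancel, Real.exp_zero, one_mul]

theorem aestronglyMeasurable_skalskayaKernel (τ : ℝ) :
    AEStronglyMeasurable (fun x => (skalskayaKernel τ x : ℂ)) (volume.restrict (Ioi 0)) := by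
  refine ContinuousOn.aestronglyMeasurable ?_ measurableSet_Ioi
  refine Complex.continuous_ofReal.comp_continuousOn ?_
  refine ContinuousOn.mul (by fun_prop) ?_
  exact Complex.continuous_re.comp_continuousOn (continuousOn_besselI_half _)

theorem continuous_skalskayaKernel_left {x : ℝ} (hx : 0 < x) :
    Continuous fun τ => (skalskayaKernel τ x : ℂ) := by
  refine Complex.continuous_ofReal.comp (continuous_const.mul (Complex.continuous_re.comp ?_))
  exact (differentiable_besselI (show 0 < x / 2 by positivity)).continuous.comp (by fun_prop)

theorem integrable_skalskayaKernel_mul (τ : ℝ) {f : ℝ → ℂ}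
    (hf : Integrable f (volume.restrict (Ioi (0 : ℝ)))) :
    IntegrableOn (fun x => (skalskayaKernel τ x : ℂ) * f x) (Ioi 0) := by
  refine hf.bdd_mul (c := Real.cosh (Real.pi * τ)) (aestronglyMeasurable_skalskayaKernel τ) ?_
  filter_upwards [ae_restrict_mem measurableSet_Ioi] with x hx
  rw [Complex.norm_real]
  exact abs_skalskayaKernel_le τ hx

theorem norm_indexF_le {f : ℝ → ℂ} (hf : Integrable f (volume.restrict (Ioi (0 : ℝ)))) (τ : ℝ) :
    ‖indexF f τ‖ ≤ Real.sqrt Real.pi * ∫ x in Ioi (0 : ℝ), ‖f x‖ := by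
  have hc := Real.cosh_pos (Real.pi * τ)
  have h : ‖∫ x in Ioi (0 : ℝ), (skalskayaKernel τ x : ℂ) * f x‖
      ≤ Real.cosh (Real.pi * τ) * ∫ x in Ioi (0 : ℝ), ‖f x‖ := by
    rw [← integral_const_mul]
    refine norm_integral_le_of_norm_le (hf.norm.const_mul _) ?_
    filter_upwards [ae_restrict_mem measurableSet_Ioi] with x hx
    rw [norm_mul, Complex.norm_real]
    exact mul_le_mul_of_nonneg_right (abs_skalskayaKernel_le τ hx) (norm_nonneg _)
  rw [indexF, norm_mul, Complex.norm_real, Real.norm_of_nonneg (by positivity)]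
  calc _ ≤ Real.sqrt Real.pi / Real.cosh (Real.pi * τ) *
        (Real.cosh (Real.pi * τ) * ∫ x in Ioi (0 : ℝ), ‖f x‖) := by gcongr
    _ = _ := by field_simp

theorem continuous_indexF {f : ℝ → ℂ} (hf : Integrable f (volume.restrict (Ioi (0 : ℝ)))) :
    Continuous (indexF f) := by
  refine Continuous.mul (Complex.continuous_ofReal.comp (continuous_const.div (by fun_prop)
    fun τ => (Real.cosh_pos _).ne')) (continuous_iff_continuousAt.2 fun τ₀ => ?_)
  have hev : ∀ᶠ τ in 𝓝 τ₀, Real.cosh (Real.pi * τ) ≤ Real.cosh (Real.pi * τ₀) + 1 := by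
    have hc : Continuous fun τ => Real.cosh (Real.pi * τ) := by fun_prop
    exact (hc.tendsto τ₀).eventually (eventually_le_nhds (by linarith))
  refine tendsto_integral_filter_of_dominated_convergence
    (fun x => (Real.cosh (Real.pi * τ₀) + 1) * ‖f x‖)
    (Eventually.of_forall fun τ => (aestronglyMeasurable_skalskayaKernel τ).mul hf.1) ?_
    (hf.norm.const_mul _) ?_
  · filter_upwards [hev] with τ hτ
    filter_upwards [ae_restrict_mem measurableSet_Ioi] with x hx
    rw [norm_mul, Complex.norm_real]
    exact mul_le_mul_of_nonneg_right ((abs_skalskayaKernel_le τ hx).trans hτ) (norm_nonneg _)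
  · filter_upwards [ae_restrict_mem measurableSet_Ioi] with x hx
    exact ((continuous_skalskayaKernel_left hx).tendsto τ₀).mul_const _

theorem indexF_congr {f g : ℝ → ℂ} (h : f =ᵐ[volume.restrict (Ioi (0 : ℝ))] g) :
    indexF f = indexF g := by
  funext τ
  rw [indexF, indexF]
  congr 1
  refine integral_congr_ae ?_
  filter_upwards [h] with x hx
  rw [hx]

/-- The transform `F` as a bounded operator from `L_1(ℝ_+)` to the bounded continuous functions. -/
noncomputable def indexFOperator :
    (Lp ℂ 1 (volume.restrict (Ioi (0 : ℝ)))) →L[ℂ] (ℝ →ᵇ ℂ) :=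
  LinearMap.mkContinuous
    { toFun := fun f => BoundedContinuousFunction.ofNormedAddCommGroup (indexF f)
        (continuous_indexF (L1.integrable_coeFn f)) _ (norm_indexF_le (L1.integrable_coeFn f))
      map_add' := fun f g => by
        ext τ
        simp only [BoundedContinuousFunction.coe_ofNormedAddCommGroup,
          BoundedContinuousFunction.coe_add, Pi.add_apply]
        rw [indexF_congr (Lp.coeFn_add f g)]
        simp only [indexF, Pi.add_apply, mul_add]
        rw [integral_add (integrable_skalskayaKernel_mul τ (L1.integrable_coeFn f))
          (integrable_skalskayaKernel_mul τ (L1.integrable_coeFn g)), mul_add]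
      map_smul' := fun c f => by
        ext τ
        simp only [BoundedContinuousFunction.coe_ofNormedAddCommGroup,
          BoundedContinuousFunction.coe_smul, RingHom.id_apply]
        rw [indexF_congr (Lp.coeFn_smul c f)]
        simp only [indexF, Pi.smul_apply, smul_eq_mul, mul_left_comm _ c]
        rw [integral_const_mul]
        ring }
    (Real.sqrt Real.pi) fun f => by
      refine (BoundedContinuousFunction.norm_le (by positivity)).2 fun τ => ?_
      rw [L1.norm_eq_integral_norm]
      exact norm_indexF_le (L1.integrable_coeFn f) τ

theorem indexFOperator_toL1 {f : ℝ → ℂ} (hf : Integrable f (volume.restrict (Ioi (0 : ℝ)))) :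
    ⇑(indexFOperator (hf.toL1 f)) = indexF f :=
  indexF_congr hf.coeFn_toL1

theorem exists_indexF_operator :
    ∃ T : (Lp ℂ 1 (volume.restrict (Ioi (0 : ℝ)))) →L[ℂ] (ℝ →ᵇ ℂ),
      ∀ (f : ℝ → ℂ) (hf : Integrable f (volume.restrict (Ioi (0 : ℝ)))),
        (∀ τ : ℝ, IntegrableOn (fun x => (skalskayaKernel τ x : ℂ) * f x) (Ioi 0)) ∧
        (∀ τ : ℝ, T (hf.toL1 f) τ = indexF f τ) ∧
        ‖T (hf.toL1 f)‖ = ⨆ τ : ℝ, ‖indexF f τ‖ ∧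
        ‖T (hf.toL1 f)‖ ≤ Real.sqrt Real.pi * ∫ x in Ioi (0 : ℝ), ‖f x‖ := by
  refine ⟨indexFOperator, fun f hf => ⟨fun τ => integrable_skalskayaKernel_mul τ hf,
    fun τ => congrFun (indexFOperator_toL1 hf) τ, ?_, ?_⟩⟩
  · rw [BoundedContinuousFunction.norm_eq_iSup_norm, indexFOperator_toL1 hf]
  · refine (BoundedContinuousFunction.norm_le (by positivity)).2 fun τ => ?_
    rw [indexFOperator_toL1 hf]
    exact norm_indexF_le hf τ

/-! ### The Hausdorff–Young inequality -/

theorem continuous_fourier_of_integrable {ψ : ℝ → ℂ} (hψ : Integrable ψ) : Continuous (𝓕 ψ) :=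
  VectorFourier.fourierIntegral_continuous Real.continuous_fourierChar continuous_inner hψ

theorem norm_fourier_le_integral_norm (ψ : ℝ → ℂ) (ξ : ℝ) : ‖𝓕 ψ ξ‖ ≤ ∫ t, ‖ψ t‖ :=
  VectorFourier.norm_fourierIntegral_le_integral_norm _ _ _ _ _

theorem integral_fourier_mul_eq_of_integrable {f g : ℝ → ℂ} (hf : Integrable f)
    (hg : Integrable g) : ∫ ξ, 𝓕 f ξ * g ξ = ∫ x, f x * 𝓕 g x := by
  have := VectorFourier.integral_fourierIntegral_smul_eq_flip (L := innerₗ ℝ)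
    Real.continuous_fourierChar continuous_inner hf hg
  rw [flip_innerₗ] at this
  exact this

/-- Plancherel's theorem for the integral transform: on `L_1 ∩ L_2` it agrees with the transform of
`L_2`, because both agree as tempered distributions. -/
theorem eLpNorm_fourier_two {h : ℝ → ℂ} (h1 : Integrable h) (h2 : MemLp h 2) :
    eLpNorm (𝓕 h) 2 volume = eLpNorm h 2 volume := by
  have hae : ∀ᵐ x, 𝓕 h x = (𝓕 (h2.toLp h) : Lp ℂ 2 (volume : Measure ℝ)) x := by
    refine ae_eq_of_integral_contDiff_smul_eq
      (continuous_fourier_of_integrable h1).locallyIntegrable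
      ((Lp.memLp (𝓕 (h2.toLp h) : Lp ℂ 2 (volume : Measure ℝ))).locallyIntegrable one_le_two)
      fun g g_smooth g_cpt => ?_
    have hg₁ : HasCompactSupport (Complex.ofRealCLM ∘ g) := g_cpt.comp_left rfl
    have hg₂ : ContDiff ℝ ((⊤ : ℕ∞) : WithTop ℕ∞) (Complex.ofRealCLM ∘ g) := by fun_prop
    set η : 𝓢(ℝ, ℂ) := hg₁.toSchwartzMap hg₂
    have hη : ∀ x, η x = (g x : ℂ) := fun x => rfl
    have e1 := DFunLike.congr_fun (Lp.fourier_toTemperedDistribution_eq (h2.toLp h)) η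
    rw [TemperedDistribution.fourier_apply, Lp.toTemperedDistribution_apply,
      Lp.toTemperedDistribution_apply] at e1
    have e2 : ∫ x, g x • (𝓕 (h2.toLp h) : Lp ℂ 2 (volume : Measure ℝ)) x
        = ∫ x, 𝓕 η x • (h2.toLp h) x := by
      rw [e1]
      refine integral_congr_ae (Eventually.of_forall fun x => ?_)
      simp [hη]
    rw [e2]
    have e3 := integral_fourier_mul_eq_of_integrable h1 η.integrable
    rw [show (fun x => g x • 𝓕 h x) = fun x => 𝓕 h x * η x from funext fun x => by
      rw [hη, Complex.real_smul, mul_comm], e3]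
    refine integral_congr_ae ?_
    filter_upwards [h2.coeFn_toLp] with x hx
    rw [hx, smul_eq_mul, mul_comm]
    rfl
  rw [eLpNorm_congr_ae hae, ← Lp.enorm_def, ← eLpNorm_congr_ae h2.coeFn_toLp, ← Lp.enorm_def]
  have := Lp.norm_fourier_eq (h2.toLp h)
  rw [← ofReal_norm, this, ofReal_norm]

theorem lintegral_enorm_fourier_sq {h : ℝ → ℂ} (h1 : Integrable h) (h2 : MemLp h 2) :
    ∫⁻ ξ, ‖𝓕 h ξ‖ₑ ^ (2 : ℝ) = ∫⁻ t, ‖h t‖ₑ ^ (2 : ℝ) := by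
  have e := eLpNorm_fourier_two h1 h2
  rw [eLpNorm_eq_lintegral_rpow_enorm_toReal two_ne_zero ENNReal.ofNat_ne_top,
    eLpNorm_eq_lintegral_rpow_enorm_toReal two_ne_zero ENNReal.ofNat_ne_top] at e
  simpa using ENNReal.rpow_left_injective (by norm_num : (1 / (2 : ℝ≥0∞).toReal) ≠ 0) e

/-- The level sets of a Fourier transform. Split `ψ` where `t |ψ|^(p-1) = 2A`, `A = ∫ |ψ|^p`: the
large values have transform at most `t / 2`, and the small values are controlled by Plancherel. -/
theorem volume_lt_norm_fourier_le {p A : ℝ} (hp : 1 < p) {ψ : ℝ → ℂ} (hm : Measurable ψ)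
    (h1 : Integrable ψ) (hpI : Integrable fun x => ‖ψ x‖ ^ p) (hA : ∫ x, ‖ψ x‖ ^ p ≤ A)
    (hA0 : 0 < A) {t : ℝ} (ht : 0 < t) :
    volume {ξ | t < ‖𝓕 ψ ξ‖} ≤ ENNReal.ofReal (4 / t ^ 2) *
      ∫⁻ x, {x | t * ‖ψ x‖ ^ (p - 1) ≤ 2 * A}.indicator (fun x => ‖ψ x‖ₑ ^ (2 : ℝ)) x := by
  set S := {x | t * ‖ψ x‖ ^ (p - 1) ≤ 2 * A} with hS
  have hSm : MeasurableSet S := measurableSet_le (by fun_prop) measurable_const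
  set g := S.indicator ψ
  set b := Sᶜ.indicator ψ
  have hgi : Integrable g := h1.indicator hSm
  have hbi : Integrable b := h1.indicator hSm.compl
  have hgb : ψ = g + b := (indicator_self_add_compl S ψ).symm
  have hbn : ∫ x, ‖b x‖ ≤ t / 2 := by
    calc ∫ x, ‖b x‖ ≤ ∫ x, t / (2 * A) * ‖ψ x‖ ^ p := by
          refine integral_mono hbi.norm (hpI.const_mul _) fun x => ?_
          by_cases hx : x ∈ S
          · have : b x = 0 := indicator_of_notMem (by simpa using hx) _
            simp only [this, norm_zero]
            positivity
          · have hbx : b x = ψ x := indicator_of_mem (by simpa using hx) _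
            have hx' : 2 * A < t * ‖ψ x‖ ^ (p - 1) := not_le.1 hx
            have hpos : 0 < ‖ψ x‖ := by
              rw [norm_pos_iff]
              intro h0
              rw [h0, norm_zero, Real.zero_rpow (by linarith)] at hx'
              linarith
            have e : ‖ψ x‖ ^ p = ‖ψ x‖ ^ (p - 1) * ‖ψ x‖ := by
              rw [← Real.rpow_add_one hpos.ne', sub_add_cancel]
            simp only [hbx]
            rw [e, div_mul_eq_mul_div, le_div_iff₀ (by positivity), ← mul_assoc]
            nlinarith
      _ = t / (2 * A) * ∫ x, ‖ψ x‖ ^ p := integral_const_mul _ _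
      _ ≤ t / (2 * A) * A := by gcongr
      _ = t / 2 := by field_simp
  have hg2 : MemLp g 2 := by
    rw [memLp_two_iff_integrable_sq_norm hgi.1]
    refine (h1.norm.const_mul ((2 * A / t) ^ (p - 1)⁻¹)).mono' (hgi.1.norm.pow 2)
      (Eventually.of_forall fun x => ?_)
    rw [Real.norm_of_nonneg (by positivity)]
    by_cases hx : x ∈ S
    · have hgx : g x = ψ x := indicator_of_mem hx _
      rw [hgx, sq]
      refine mul_le_mul_of_nonneg_right ?_ (norm_nonneg _)
      have hx' : t * ‖ψ x‖ ^ (p - 1) ≤ 2 * A := hx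
      rw [Real.le_rpow_inv_iff_of_pos (norm_nonneg _) (by positivity) (by linarith),
        le_div_iff₀ ht, mul_comm]
      exact hx'
    · have : g x = 0 := indicator_of_notMem hx _
      rw [this, norm_zero, zero_pow two_ne_zero]
      positivity
  have hF : 𝓕 ψ = 𝓕 g + 𝓕 b := by
    conv_lhs => rw [hgb]
    exact VectorFourier.fourierIntegral_add Real.continuous_fourierChar continuous_inner hgi hbi
  have hsub : {ξ | t < ‖𝓕 ψ ξ‖} ⊆ {ξ | ENNReal.ofReal (t ^ 2 / 4) ≤ ‖𝓕 g ξ‖ₑ ^ (2 : ℝ)} := by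
    intro ξ hξ
    have hξ : t < ‖𝓕 ψ ξ‖ := hξ
    rw [hF, Pi.add_apply] at hξ
    have h3 := (norm_fourier_le_integral_norm b ξ).trans hbn
    have h4 : t / 2 ≤ ‖𝓕 g ξ‖ := by linarith [norm_add_le (𝓕 g ξ) (𝓕 b ξ)]
    show ENNReal.ofReal (t ^ 2 / 4) ≤ ‖𝓕 g ξ‖ₑ ^ (2 : ℝ)
    rw [← ofReal_norm, ENNReal.ofReal_rpow_of_nonneg (norm_nonneg _) zero_le_two]
    refine ENNReal.ofReal_le_ofReal ?_
    rw [Real.rpow_two]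
    nlinarith
  refine (measure_mono hsub).trans ((meas_ge_le_lintegral_div ?_ ?_ ENNReal.ofReal_ne_top).trans ?_)
  · exact ((continuous_fourier_of_integrable hgi).aestronglyMeasurable.enorm.pow_const _)
  · rw [Ne, ENNReal.ofReal_eq_zero, not_le]
    positivity
  · rw [lintegral_enorm_fourier_sq hgi hg2, ENNReal.div_eq_inv_mul,
      ← ENNReal.ofReal_inv_of_pos (by positivity), inv_div]
    refine mul_le_mul_right (le_of_eq (lintegral_congr fun x => ?_)) _
    by_cases hx : x ∈ S
    · rw [indicator_of_mem hx, show g x = ψ x from indicator_of_mem hx _]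
    · rw [indicator_of_notMem hx, show g x = 0 from indicator_of_notMem hx _]
      simp

theorem lintegral_Ioc_rpow {R a : ℝ} (hR : 0 ≤ R) (ha : 0 < a) :
    ∫⁻ t in Ioc 0 R, ENNReal.ofReal (t ^ (a - 1)) = ENNReal.ofReal (R ^ a / a) := by
  rw [← ofReal_integral_eq_lintegral_ofReal]
  · rw [← intervalIntegral.integral_of_le hR, integral_rpow (Or.inl (by linarith)), sub_add_cancel,
      Real.zero_rpow ha.ne', sub_zero]
  · exact (intervalIntegrable_iff_integrableOn_Ioc_of_le hR).1
      (intervalIntegral.intervalIntegrable_rpow' (by linarith))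
  · filter_upwards [ae_restrict_mem measurableSet_Ioc] with t ht
    exact Real.rpow_nonneg ht.1.le _

/-- The layer-cake integral of the level set estimate (Marcinkiewicz interpolation between the
endpoints `(1, ∞)` and `(2, 2)`). The bound scales correctly in `A` because the splitting height in
`volume_lt_norm_fourier_le` depends on `A`. -/
theorem lintegral_fourier_rpow_le {p q A : ℝ} (hp : 1 < p) (hp2 : p < 2) (hq : q = p / (p - 1))
    {ψ : ℝ → ℂ} (hm : Measurable ψ)
    (h1 : Integrable ψ) (hpI : Integrable fun x => ‖ψ x‖ ^ p) (hA : ∫ x, ‖ψ x‖ ^ p ≤ A)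
    (hA0 : 0 < A) :
    ∫⁻ ξ, ENNReal.ofReal (‖𝓕 ψ ξ‖ ^ q) ≤
      ENNReal.ofReal (q * (4 * ((2 * A) ^ (q - 2) / (q - 2)) * A)) := by
  have hp1 : 0 < p - 1 := by linarith
  have hq2 : 0 < q - 2 := by
    rw [hq, sub_pos, lt_div_iff₀ hp1]; linarith
  have hpq : (p - 1) * q = p := by rw [hq]; field_simp
  have hc := continuous_fourier_of_integrable h1
  rw [lintegral_rpow_eq_lintegral_meas_lt_mul volume (Eventually.of_forall fun _ => norm_nonneg _)
    hc.norm.measurable.aemeasurable (by linarith : 0 < q)]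
  have hSm : MeasurableSet {z : ℝ × ℝ | z.1 * ‖ψ z.2‖ ^ (p - 1) ≤ 2 * A} :=
    measurableSet_le (by fun_prop) measurable_const
  have key : ∫⁻ t in Ioi (0 : ℝ), volume {ξ | t < ‖𝓕 ψ ξ‖} * ENNReal.ofReal (t ^ (q - 1)) ≤
      ENNReal.ofReal (4 * ((2 * A) ^ (q - 2) / (q - 2)) * A) := by
    calc _ ≤ ∫⁻ t in Ioi (0 : ℝ), ∫⁻ x, ENNReal.ofReal (4 * t ^ (q - 2 - 1)) *
          {z : ℝ × ℝ | z.1 * ‖ψ z.2‖ ^ (p - 1) ≤ 2 * A}.indicator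
            (fun z => ‖ψ z.2‖ₑ ^ (2 : ℝ)) (t, x) := by
          refine setLIntegral_mono' measurableSet_Ioi fun t ht => ?_
          have ht : 0 < t := ht
          have hmeas : Measurable fun x => {z : ℝ × ℝ | z.1 * ‖ψ z.2‖ ^ (p - 1) ≤ 2 * A}.indicator
              (fun z => ‖ψ z.2‖ₑ ^ (2 : ℝ)) (t, x) :=
            (Measurable.indicator (f := fun z : ℝ × ℝ => ‖ψ z.2‖ₑ ^ (2 : ℝ)) (by fun_prop)
              hSm).comp (by fun_prop : Measurable fun x : ℝ => (t, x))
          rw [lintegral_const_mul _ hmeas]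
          refine (mul_le_mul_left (volume_lt_norm_fourier_le hp hm h1 hpI hA hA0 ht) _).trans
            (le_of_eq ?_)
          rw [mul_right_comm, ← ENNReal.ofReal_mul (by positivity)]
          congr 2
          rw [show q - 2 - 1 = (q - 1) - (2 : ℕ) by push_cast; ring, Real.rpow_sub_natCast ht.ne']
          ring
      _ = ∫⁻ x, ∫⁻ t in Ioi (0 : ℝ), ENNReal.ofReal (4 * t ^ (q - 2 - 1)) *
          {z : ℝ × ℝ | z.1 * ‖ψ z.2‖ ^ (p - 1) ≤ 2 * A}.indicator
            (fun z => ‖ψ z.2‖ₑ ^ (2 : ℝ)) (t, x) := by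
          refine lintegral_lintegral_swap (Measurable.aemeasurable ?_)
          exact Measurable.mul (by fun_prop) (Measurable.indicator (by fun_prop) hSm)
      _ ≤ ∫⁻ x, ENNReal.ofReal (4 * ((2 * A) ^ (q - 2) / (q - 2)) * ‖ψ x‖ ^ p) := by
          refine lintegral_mono fun x => ?_
          by_cases hx : ψ x = 0
          · have : ∀ t : ℝ, {z : ℝ × ℝ | z.1 * ‖ψ z.2‖ ^ (p - 1) ≤ 2 * A}.indicator
              (fun z => ‖ψ z.2‖ₑ ^ (2 : ℝ)) (t, x) = 0 := fun t => by
              by_cases h : (t, x) ∈ {z : ℝ × ℝ | z.1 * ‖ψ z.2‖ ^ (p - 1) ≤ 2 * A}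
              · rw [indicator_of_mem h]; simp [hx]
              · rw [indicator_of_notMem h]
            simp only [this, mul_zero, lintegral_zero, zero_le]
          have hn : 0 < ‖ψ x‖ := norm_pos_iff.2 hx
          set R := 2 * A * ‖ψ x‖ ^ (1 - p) with hR
          have hR0 : 0 ≤ R := by positivity
          have hmem : ∀ t : ℝ, t * ‖ψ x‖ ^ (p - 1) ≤ 2 * A ↔ t ≤ R := fun t => by
            rw [hR, show 1 - p = -(p - 1) by ring, Real.rpow_neg hn.le, ← div_eq_mul_inv,
              le_div_iff₀ (by positivity)]
          calc _ = ∫⁻ t in Ioi (0 : ℝ), (Iic R).indicator (fun t =>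
                ENNReal.ofReal (‖ψ x‖ ^ 2 * 4) * ENNReal.ofReal (t ^ (q - 2 - 1))) t := by
                refine setLIntegral_congr_fun measurableSet_Ioi fun t ht => ?_
                have ht : 0 < t := ht
                by_cases h : t ≤ R
                · rw [indicator_of_mem (show t ∈ Iic R from h), indicator_of_mem
                    (show (t, x) ∈ {z : ℝ × ℝ | z.1 * ‖ψ z.2‖ ^ (p - 1) ≤ 2 * A} from
                      (hmem t).2 h), ← ofReal_norm,
                    ENNReal.ofReal_rpow_of_nonneg (norm_nonneg _) zero_le_two, Real.rpow_two,
                    ← ENNReal.ofReal_mul (by positivity), ← ENNReal.ofReal_mul (by positivity)]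
                  congr 1
                  ring
                · rw [indicator_of_notMem (show t ∉ Iic R from h), indicator_of_notMem
                    (show (t, x) ∉ {z : ℝ × ℝ | z.1 * ‖ψ z.2‖ ^ (p - 1) ≤ 2 * A} from
                      fun h' => h ((hmem t).1 h')), mul_zero]
            _ = ENNReal.ofReal (‖ψ x‖ ^ 2 * 4) * ENNReal.ofReal (R ^ (q - 2) / (q - 2)) := by
                rw [setLIntegral_indicator measurableSet_Iic, inter_comm, Ioi_inter_Iic,
                  lintegral_const_mul _ (by fun_prop), lintegral_Ioc_rpow hR0 hq2]
            _ ≤ _ := by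
                rw [← ENNReal.ofReal_mul (by positivity)]
                refine le_of_eq (congrArg ENNReal.ofReal ?_)
                rw [hR, Real.mul_rpow (by positivity) (by positivity), ← Real.rpow_mul hn.le]
                have e : ‖ψ x‖ ^ p = ‖ψ x‖ ^ 2 * ‖ψ x‖ ^ ((1 - p) * (q - 2)) := by
                  rw [← Real.rpow_two, ← Real.rpow_add hn]
                  congr 1
                  linarith
                rw [e]
                ring
      _ = ENNReal.ofReal (∫ x, 4 * ((2 * A) ^ (q - 2) / (q - 2)) * ‖ψ x‖ ^ p) := by
          rw [ofReal_integral_eq_lintegral_ofReal (hpI.const_mul _)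
            (Eventually.of_forall fun x => by positivity)]
      _ ≤ _ := by
          rw [integral_const_mul]
          gcongr
  calc _ ≤ ENNReal.ofReal q * ENNReal.ofReal (4 * ((2 * A) ^ (q - 2) / (q - 2)) * A) := by
        gcongr
    _ = _ := by rw [← ENNReal.ofReal_mul (by linarith)]

/-- The Hausdorff–Young inequality with an unspecified constant. -/
theorem exists_eLpNorm_fourier_le {p q : ℝ} (hp : 1 < p) (hp2 : p ≤ 2) (hq : q = p / (p - 1)) :
    ∃ C : ℝ≥0∞, C ≠ ∞ ∧ ∀ ψ : ℝ → ℂ, Integrable ψ → MemLp ψ (ENNReal.ofReal p) →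
      eLpNorm (𝓕 ψ) (ENNReal.ofReal q) volume ≤ C * eLpNorm ψ (ENNReal.ofReal p) volume := by
  have hp1 : 0 < p - 1 := by linarith
  rcases hp2.eq_or_lt with rfl | hp2
  · refine ⟨1, ENNReal.one_ne_top, fun ψ h1 h2 => ?_⟩
    have hq : q = 2 := by rw [hq]; norm_num
    rw [hq, one_mul, ENNReal.ofReal_ofNat] at *
    exact (eLpNorm_fourier_two h1 h2).le
  have hq2 : 0 < q - 2 := by
    rw [hq, sub_pos, lt_div_iff₀ hp1]; linarith
  have hpq : (p - 1) * q = p := by rw [hq]; field_simp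
  have hq0 : 0 < q := by linarith
  set K := q * (4 * (2 ^ (q - 2) / (q - 2))) with hK
  have hK0 : 0 ≤ K := by positivity
  refine ⟨ENNReal.ofReal (K ^ (1 / q)), ENNReal.ofReal_ne_top, fun ψ h1 hψ => ?_⟩
  have hp0' : ENNReal.ofReal p ≠ 0 := by rw [Ne, ENNReal.ofReal_eq_zero]; linarith
  have hq0' : ENNReal.ofReal q ≠ 0 := by rw [Ne, ENNReal.ofReal_eq_zero]; linarith
  have hpI : Integrable fun x => ‖ψ x‖ ^ p := by
    have := hψ.integrable_norm_rpow hp0' ENNReal.ofReal_ne_top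
    rwa [ENNReal.toReal_ofReal (by linarith)] at this
  set A := ∫ x, ‖ψ x‖ ^ p with hA
  have hA0 : 0 ≤ A := integral_nonneg fun x => by positivity
  have hnorm : eLpNorm ψ (ENNReal.ofReal p) volume = ENNReal.ofReal (A ^ (1 / p)) := by
    rw [hψ.eLpNorm_eq_integral_rpow_norm hp0' ENNReal.ofReal_ne_top,
      ENNReal.toReal_ofReal (by linarith), one_div]
  rcases hA0.eq_or_lt with h0 | hA0
  · have : eLpNorm ψ (ENNReal.ofReal p) volume = 0 := by
      rw [hnorm, ← h0, Real.zero_rpow (by positivity), ENNReal.ofReal_zero]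
    rw [eLpNorm_eq_zero_iff h1.1 hp0'] at this
    have hF : 𝓕 ψ = 0 := by
      funext ξ
      rw [Real.fourier_congr_ae this]
      simp [Real.fourier_eq]
    rw [hF, eLpNorm_zero]
    exact zero_le
  obtain ⟨ψ', hm, hae⟩ := h1.1
  have hF : 𝓕 ψ = 𝓕 ψ' := funext fun ξ => Real.fourier_congr_ae hae ξ
  have hae' : (fun x => ‖ψ x‖ ^ p) =ᵐ[volume] fun x => ‖ψ' x‖ ^ p := by
    filter_upwards [hae] with x hx
    rw [hx]
  have hb := lintegral_fourier_rpow_le hp hp2 hq hm.measurable (h1.congr hae) (hpI.congr hae')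
    (by rw [← integral_congr_ae hae']) hA0
  rw [hF, eLpNorm_eq_lintegral_rpow_enorm_toReal hq0' ENNReal.ofReal_ne_top,
    ENNReal.toReal_ofReal (by linarith), hnorm, ← ENNReal.ofReal_mul (by positivity)]
  have e1 : ∫⁻ ξ, ‖𝓕 ψ' ξ‖ₑ ^ q = ∫⁻ ξ, ENNReal.ofReal (‖𝓕 ψ' ξ‖ ^ q) :=
    lintegral_congr fun ξ => by
      rw [← ofReal_norm, ENNReal.ofReal_rpow_of_nonneg (norm_nonneg _) (by linarith)]
  rw [e1]
  refine (ENNReal.rpow_le_rpow hb (by positivity)).trans (le_of_eq ?_)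
  rw [ENNReal.ofReal_rpow_of_nonneg (by positivity) (by positivity)]
  congr 1
  have e2 : q * (4 * ((2 * A) ^ (q - 2) / (q - 2)) * A) = K * A ^ (q - 1) := by
    rw [hK, Real.mul_rpow zero_le_two hA0.le, show q - 1 = q - 2 + 1 by ring,
      Real.rpow_add_one hA0.ne']
    ring
  rw [e2, Real.mul_rpow (by positivity) (by positivity), ← Real.rpow_mul hA0.le]
  congr 2
  have : 0 < q := by linarith
  field_simp
  linarith

/-! ### The inverse Mellin transform on a vertical line -/

/-- The inverse Mellin integral `(1 / (2 π i)) ∫ h(s) x^(-s) ds` over the line `Re s = σ`, for a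
function `h` of the ordinate `t` of `s = σ + i t`. -/
noncomputable def mellinInvLine (σ : ℝ) (h : ℝ → ℂ) (x : ℝ) : ℂ :=
  (1 / (2 * (Real.pi : ℂ))) * ∫ t : ℝ, h t * (x : ℂ) ^ (-vline σ t)

theorem truncMellinInv_eq_mellinInvLine (σ : ℝ) (H : ℂ → ℂ) (T : ℝ) :
    truncMellinInv σ H T =
      mellinInvLine σ ((Ioc (-T) T).indicator fun t => H (vline σ t)) := by
  funext x
  rw [truncMellinInv, mellinInvLine, ← integral_indicator measurableSet_Ioc]
  congr 2
  funext t
  by_cases ht : t ∈ Ioc (-T) T <;> simp [ht]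

theorem ofReal_exp_cpow (u : ℝ) (s : ℂ) : ((Real.exp u : ℝ) : ℂ) ^ s = Complex.exp (u * s) := by
  rw [Complex.cpow_def_of_ne_zero (by exact_mod_cast (Real.exp_pos u).ne'),
    ← Complex.ofReal_log (Real.exp_pos u).le, Real.log_exp]

theorem continuous_vline (σ : ℝ) : Continuous (vline σ) := by
  unfold vline
  fun_prop

@[simp] theorem vline_re (σ t : ℝ) : (vline σ t).re = σ := by simp [vline]

@[simp] theorem vline_im (σ t : ℝ) : (vline σ t).im = t := by simp [vline]

theorem norm_cpow_vline (σ t : ℝ) {x : ℝ} (hx : 0 < x) :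
    ‖(x : ℂ) ^ (-vline σ t)‖ = x ^ (-σ) := by
  rw [Complex.norm_cpow_eq_rpow_re_of_pos hx]
  simp

/-- In the logarithmic variable the inverse Mellin integral is a Fourier integral. -/
theorem mellinInvLine_exp (σ : ℝ) (h : ℝ → ℂ) (ξ : ℝ) :
    mellinInvLine σ h (Real.exp (2 * Real.pi * ξ)) =
      ((1 / (2 * Real.pi) * Real.exp (-(2 * Real.pi * σ * ξ)) : ℝ) : ℂ) * 𝓕 h ξ := by
  rw [mellinInvLine, Real.fourier_real_eq_integral_exp_smul]
  rw [Complex.ofReal_mul, mul_assoc (Complex.ofReal _)]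
  congr 1
  · push_cast
    rfl
  rw [← integral_const_mul]
  congr 1
  funext t
  rw [ofReal_exp_cpow, smul_eq_mul, Complex.ofReal_exp, mul_comm (h t), ← mul_assoc,
    ← Complex.exp_add]
  congr 2
  rw [vline]
  push_cast
  ring

theorem mellinInvLine_of_pos (σ : ℝ) (h : ℝ → ℂ) {x : ℝ} (hx : 0 < x) :
    mellinInvLine σ h x =
      ((1 / (2 * Real.pi) * x ^ (-σ) : ℝ) : ℂ) * 𝓕 h (Real.log x / (2 * Real.pi)) := by
  have hpi := Real.pi_pos
  have := mellinInvLine_exp σ h (Real.log x / (2 * Real.pi))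
  rw [show 2 * Real.pi * (Real.log x / (2 * Real.pi)) = Real.log x by field_simp,
    Real.exp_log hx] at this
  rw [this, Real.rpow_def_of_pos hx]
  congr 5
  field_simp

theorem continuousOn_mellinInvLine (σ : ℝ) {h : ℝ → ℂ} (hh : Integrable h) :
    ContinuousOn (mellinInvLine σ h) (Ioi 0) := by
  have : ContinuousOn (fun x : ℝ => ((1 / (2 * Real.pi) * x ^ (-σ) : ℝ) : ℂ) *
      𝓕 h (Real.log x / (2 * Real.pi))) (Ioi 0) := by
    refine ContinuousOn.mul ?_ ?_
    · refine Complex.continuous_ofReal.comp_continuousOn (continuousOn_const.mul ?_)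
      exact continuousOn_id.rpow_const fun x hx => Or.inl (ne_of_gt hx)
    · refine (continuous_fourier_of_integrable hh).comp_continuousOn ?_
      exact (Real.continuousOn_log.mono fun x hx => ne_of_gt hx).div_const _
  exact this.congr fun x hx => mellinInvLine_of_pos σ h hx

theorem mellinInvLine_sub (σ : ℝ) {h g : ℝ → ℂ} (hh : Integrable h) (hg : Integrable g)
    {x : ℝ} (hx : 0 < x) :
    mellinInvLine σ (h - g) x = mellinInvLine σ h x - mellinInvLine σ g x := by
  have hb : ∀ t, ‖(x : ℂ) ^ (-vline σ t)‖ ≤ x ^ (-σ) := fun t => (norm_cpow_vline σ t hx).le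
  have hm : AEStronglyMeasurable (fun t => (x : ℂ) ^ (-vline σ t)) volume := by
    refine Continuous.aestronglyMeasurable ?_
    exact (continuous_vline σ).neg.const_cpow (Or.inl (by exact_mod_cast hx.ne'))
  rw [mellinInvLine, mellinInvLine, mellinInvLine, ← mul_sub, ← integral_sub]
  · simp only [Pi.sub_apply, sub_mul]
  · exact hh.mul_bdd (c := x ^ (-σ)) hm (Eventually.of_forall hb)
  · exact hg.mul_bdd (c := x ^ (-σ)) hm (Eventually.of_forall hb)

theorem hasDerivAt_exp_two_pi_mul (ξ : ℝ) : HasDerivAt (fun ξ => Real.exp (2 * Real.pi * ξ))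
    (2 * Real.pi * Real.exp (2 * Real.pi * ξ)) ξ := by
  have := ((hasDerivAt_id ξ).const_mul (2 * Real.pi)).exp
  simpa [mul_comm] using this

theorem injective_exp_two_pi_mul : Function.Injective fun ξ : ℝ => Real.exp (2 * Real.pi * ξ) :=
  fun a b hab => by
    have := Real.exp_injective hab
    have hpi := Real.pi_pos
    exact mul_left_cancel₀ (by positivity) this

theorem image_exp_two_pi_mul : (fun ξ : ℝ => Real.exp (2 * Real.pi * ξ)) '' univ = Ioi 0 := by
  have hpi := Real.pi_pos
  ext x
  simp only [image_univ, mem_range, mem_Ioi]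
  constructor
  · rintro ⟨ξ, rfl⟩
    positivity
  · intro hx
    refine ⟨Real.log x / (2 * Real.pi), ?_⟩
    rw [show 2 * Real.pi * (Real.log x / (2 * Real.pi)) = Real.log x by field_simp,
      Real.exp_log hx]

theorem measurable_ofReal_rpow (c : ℝ) : Measurable fun x : ℝ => ENNReal.ofReal (x ^ c) :=
  (measurable_id.pow_const c).ennreal_ofReal

theorem lintegral_mellinWeight (σ q : ℝ) (g : ℝ → ℝ≥0∞) :
    ∫⁻ x, g x ∂mellinWeight σ q =
      ∫⁻ x in Ioi (0 : ℝ), ENNReal.ofReal (x ^ (σ * q - 1)) * g x := by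
  rw [mellinWeight, lintegral_withDensity_eq_lintegral_mul_non_measurable _
    (measurable_ofReal_rpow _) (Eventually.of_forall fun x => ENNReal.ofReal_lt_top)]
  rfl

/-- The substitution `x = e^(2 π ξ)` in an integral over the half-line with a power weight. -/
theorem lintegral_mellinWeight_eq (σ q : ℝ) (g : ℝ → ℝ≥0∞) :
    ∫⁻ x, g x ∂mellinWeight σ q =
      ∫⁻ ξ : ℝ, ENNReal.ofReal (2 * Real.pi * Real.exp (2 * Real.pi * σ * q * ξ)) *
        g (Real.exp (2 * Real.pi * ξ)) := by
  have hpi := Real.pi_pos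
  rw [lintegral_mellinWeight, ← image_exp_two_pi_mul,
    lintegral_image_eq_lintegral_abs_deriv_mul MeasurableSet.univ
      (fun ξ _ => (hasDerivAt_exp_two_pi_mul ξ).hasDerivWithinAt)
      (injective_exp_two_pi_mul.injOn), setLIntegral_univ]
  refine lintegral_congr fun ξ => ?_
  rw [← mul_assoc, ← ENNReal.ofReal_mul (abs_nonneg _), abs_of_pos (by positivity)]
  congr 2
  rw [← Real.exp_mul, mul_assoc, ← Real.exp_add]
  congr 2
  ring

/-- The Hausdorff–Young inequality for the inverse Mellin transform. -/
theorem exists_eLpNorm_mellinInvLine_le (σ : ℝ) {p q : ℝ} (hp : 1 < p) (hp2 : p ≤ 2)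
    (hq : q = p / (p - 1)) :
    ∃ C : ℝ≥0∞, C ≠ ∞ ∧ ∀ h : ℝ → ℂ, Integrable h → MemLp h (ENNReal.ofReal p) →
      eLpNorm (mellinInvLine σ h) (ENNReal.ofReal q) (mellinWeight σ q) ≤
        C * eLpNorm h (ENNReal.ofReal p) volume := by
  obtain ⟨C, hC, H⟩ := exists_eLpNorm_fourier_le hp hp2 hq
  have hpi := Real.pi_pos
  have hq0 : 0 < q := by rw [hq]; exact div_pos (by linarith) (by linarith)
  have hq0' : ENNReal.ofReal q ≠ 0 := by rw [Ne, ENNReal.ofReal_eq_zero]; linarith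
  set D := ENNReal.ofReal (2 * Real.pi) * ENNReal.ofReal (1 / (2 * Real.pi)) ^ q with hD
  have hDtop : D ^ (1 / q) ≠ ∞ := by
    refine ENNReal.rpow_ne_top_of_nonneg (by positivity) (ENNReal.mul_ne_top ENNReal.ofReal_ne_top
      (ENNReal.rpow_ne_top_of_nonneg hq0.le ENNReal.ofReal_ne_top))
  refine ⟨D ^ (1 / q) * C, ENNReal.mul_ne_top hDtop hC, fun h h1 hψ => ?_⟩
  rw [mul_assoc]
  refine le_trans (le_of_eq ?_) (mul_le_mul_right (H h h1 hψ) _)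
  rw [eLpNorm_eq_lintegral_rpow_enorm_toReal hq0' ENNReal.ofReal_ne_top,
    eLpNorm_eq_lintegral_rpow_enorm_toReal hq0' ENNReal.ofReal_ne_top,
    ENNReal.toReal_ofReal hq0.le, ← ENNReal.mul_rpow_of_nonneg _ _ (by positivity),
    lintegral_mellinWeight_eq]
  congr 1
  rw [← lintegral_const_mul' _ _ (ENNReal.mul_ne_top ENNReal.ofReal_ne_top
      (ENNReal.rpow_ne_top_of_nonneg hq0.le ENNReal.ofReal_ne_top))]
  refine lintegral_congr fun ξ => ?_
  rw [mellinInvLine_exp, enorm_mul, ENNReal.mul_rpow_of_nonneg _ _ hq0.le, ← mul_assoc]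
  congr 1
  have h2 : (0 : ℝ) ≤ 2 * Real.pi := by positivity
  have h3 : (0 : ℝ) ≤ 1 / (2 * Real.pi) := by positivity
  rw [← ofReal_norm, Complex.norm_real, Real.norm_of_nonneg (by positivity),
    ENNReal.ofReal_mul h2, ENNReal.ofReal_mul h3,
    ENNReal.mul_rpow_of_nonneg _ _ hq0.le, ENNReal.ofReal_rpow_of_pos (Real.exp_pos _),
    ← Real.exp_mul, mul_assoc, mul_left_comm (ENNReal.ofReal (Real.exp _)),
    ← ENNReal.ofReal_mul (Real.exp_pos _).le, ← Real.exp_add]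
  rw [show 2 * Real.pi * σ * q * ξ + -(2 * Real.pi * σ * ξ) * q = 0 by ring, Real.exp_zero,
    ENNReal.ofReal_one, mul_one]

theorem mellinWeight_absolutelyContinuous (σ q : ℝ) :
    mellinWeight σ q ≪ volume.restrict (Ioi 0) :=
  withDensity_absolutelyContinuous _ _

theorem absolutelyContinuous_mellinWeight (σ q : ℝ) :
    volume.restrict (Ioi 0) ≪ mellinWeight σ q := by
  refine withDensity_absolutelyContinuous' (measurable_ofReal_rpow _).aemeasurable ?_
  refine (ae_restrict_iff' measurableSet_Ioi).2 (Eventually.of_forall fun x hx => ?_)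
  rw [Ne, ENNReal.ofReal_eq_zero, not_le]
  exact Real.rpow_pos_of_pos hx _

theorem aestronglyMeasurable_mellinInvLine (σ q : ℝ) {h : ℝ → ℂ} (hh : Integrable h) :
    AEStronglyMeasurable (mellinInvLine σ h) (mellinWeight σ q) :=
  ((continuousOn_mellinInvLine σ hh).aestronglyMeasurable measurableSet_Ioi).mono_ac
    (mellinWeight_absolutelyContinuous σ q)

theorem tendsto_eLpNorm_compl_Ioc {p : ℝ} (hp : 1 ≤ p) {ψ : ℝ → ℂ}
    (hψ : MemLp ψ (ENNReal.ofReal p)) :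
    Tendsto (fun T : ℝ => eLpNorm ((Ioc (-T) T)ᶜ.indicator ψ) (ENNReal.ofReal p) volume)
      atTop (𝓝 0) := by
  have hp0' : ENNReal.ofReal p ≠ 0 := by rw [Ne, ENNReal.ofReal_eq_zero]; linarith
  have hp0 : 0 < p := by linarith
  have hfin : ∫⁻ t, ‖ψ t‖ₑ ^ p ≠ ∞ := by
    have := lintegral_rpow_enorm_lt_top_of_eLpNorm_lt_top hp0' ENNReal.ofReal_ne_top hψ.2
    rw [ENNReal.toReal_ofReal hp0.le] at this
    exact this.ne
  have key : Tendsto (fun T : ℝ => ∫⁻ t, ‖(Ioc (-T) T)ᶜ.indicator ψ t‖ₑ ^ p) atTop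
      (𝓝 (∫⁻ _ : ℝ, 0)) := by
    refine tendsto_lintegral_filter_of_dominated_convergence' (fun t => ‖ψ t‖ₑ ^ p)
      (Eventually.of_forall fun T => ?_) (Eventually.of_forall fun T =>
        Eventually.of_forall fun t => ?_) hfin (Eventually.of_forall fun t => ?_)
    · exact ((hψ.1.indicator measurableSet_Ioc.compl).enorm).pow_const p
    · gcongr
      exact enorm_indicator_le_enorm_self _ _
    · refine tendsto_const_nhds.congr' ?_
      filter_upwards [eventually_gt_atTop |t|] with T hT
      rw [indicator_of_notMem, enorm_zero, ENNReal.zero_rpow_of_pos hp0]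
      rw [notMem_compl_iff]
      exact ⟨(abs_lt.1 hT).1, (abs_lt.1 hT).2.le⟩
  rw [lintegral_zero] at key
  have := key.ennrpow_const (1 / p)
  rw [ENNReal.zero_rpow_of_pos (by positivity)] at this
  refine this.congr fun T => ?_
  rw [eLpNorm_eq_lintegral_rpow_enorm_toReal hp0' ENNReal.ofReal_ne_top,
    ENNReal.toReal_ofReal hp0.le]

/-- The truncated inverse Mellin integrals of a function in `L_p` of the line converge in the
weighted space with the conjugate exponent. -/
theorem exists_tendsto_mellinInvLine (σ : ℝ) {p q : ℝ} (hp : 1 < p) (hp2 : p ≤ 2)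
    (hq : q = p / (p - 1)) {ψ : ℝ → ℂ} (hψ : MemLp ψ (ENNReal.ofReal p)) :
    ∃ φ : ℝ → ℂ, MemLp φ (ENNReal.ofReal q) (mellinWeight σ q) ∧
      Tendsto (fun T : ℝ => eLpNorm (mellinInvLine σ ((Ioc (-T) T).indicator ψ) - φ)
        (ENNReal.ofReal q) (mellinWeight σ q)) atTop (𝓝 0) := by
  obtain ⟨C, hC, H⟩ := exists_eLpNorm_mellinInvLine_le σ hp hp2 hq
  have hq1 : 1 ≤ q := by
    rw [hq, le_div_iff₀ (by linarith)]; linarith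
  have : Fact (1 ≤ ENNReal.ofReal q) := ⟨by rwa [ENNReal.one_le_ofReal]⟩
  set h : ℝ → ℝ → ℂ := fun T => (Ioc (-T) T).indicator ψ with hh
  have hLp : ∀ T, MemLp (h T) (ENNReal.ofReal p) := fun T => hψ.indicator measurableSet_Ioc
  have hI : ∀ T, Integrable (h T) := fun T => by
    rw [hh, integrable_indicator_iff measurableSet_Ioc]
    exact (hψ.restrict _).integrable (by rw [ENNReal.one_le_ofReal]; exact hp.le)
  have hM : ∀ T, MemLp (mellinInvLine σ (h T)) (ENNReal.ofReal q) (mellinWeight σ q) := fun T =>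
    ⟨aestronglyMeasurable_mellinInvLine σ q (hI T),
      (H _ (hI T) (hLp T)).trans_lt (ENNReal.mul_lt_top hC.lt_top (hLp T).2)⟩
  -- a modulus of Cauchy convergence, by the Hausdorff–Young inequality
  set b : ℝ → ℝ≥0∞ := fun T =>
    C * eLpNorm ((Ioc (-T) T)ᶜ.indicator ψ) (ENNReal.ofReal p) volume with hb
  have hb0 : Tendsto b atTop (𝓝 0) := by
    have := ENNReal.Tendsto.const_mul (a := C) (tendsto_eLpNorm_compl_Ioc hp.le hψ) (Or.inr hC)
    rwa [mul_zero] at this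
  have hbtop : ∀ T, b T ≠ ∞ := fun T =>
    ENNReal.mul_ne_top hC (hψ.indicator measurableSet_Ioc.compl).2.ne
  have hdiff : ∀ N S T : ℝ, N ≤ S → N ≤ T →
      eLpNorm (mellinInvLine σ (h S) - mellinInvLine σ (h T)) (ENNReal.ofReal q)
        (mellinWeight σ q) ≤ b N := by
    intro N S T hS hT
    have e : mellinInvLine σ (h S) - mellinInvLine σ (h T) =ᵐ[mellinWeight σ q]
        mellinInvLine σ (h S - h T) := by
      refine (mellinWeight_absolutelyContinuous σ q).ae_le ?_
      filter_upwards [ae_restrict_mem measurableSet_Ioi] with x hx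
      exact (mellinInvLine_sub σ (hI S) (hI T) hx).symm
    rw [eLpNorm_congr_ae e]
    refine (H _ ((hI S).sub (hI T)) ((hLp S).sub (hLp T))).trans (mul_le_mul_right ?_ _)
    refine eLpNorm_mono fun t => ?_
    by_cases ht : t ∈ Ioc (-N) N
    · have h1 : t ∈ Ioc (-S) S := ⟨by linarith [ht.1], ht.2.trans hS⟩
      have h2 : t ∈ Ioc (-T) T := ⟨by linarith [ht.1], ht.2.trans hT⟩
      simp [hh, h1, h2]
    · rw [indicator_of_mem (by exact ht)]
      by_cases h1 : t ∈ Ioc (-S) S <;> by_cases h2 : t ∈ Ioc (-T) T <;> simp [hh, h1, h2]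
  set u : ℝ → Lp ℂ (ENNReal.ofReal q) (mellinWeight σ q) := fun T => (hM T).toLp _ with hu
  have hcau : CauchySeq u := by
    refine cauchySeq_of_le_tendsto_0 (fun T => (b T).toReal) (fun S T N hS hT => ?_) ?_
    · rw [dist_edist, hu, Lp.edist_toLp_toLp]
      exact ENNReal.toReal_mono (hbtop N) (hdiff N S T hS hT)
    · exact (ENNReal.tendsto_toReal ENNReal.zero_ne_top).comp hb0
  obtain ⟨φ, hφ⟩ := cauchySeq_tendsto_of_complete hcau
  refine ⟨φ, Lp.memLp φ, ?_⟩
  have hφ' : Tendsto u atTop (𝓝 ((Lp.memLp φ).toLp _)) := by rwa [Lp.toLp_coeFn]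
  exact (Lp.tendsto_Lp_iff_tendsto_eLpNorm'' _ hM _ (Lp.memLp φ)).1 hφ'

/-! ### Laplace averages of an inverse Mellin transform -/

theorem lintegral_min_rpow_ne_top {a b : ℝ} (ha : 0 < a) (hb : b < 0) :
    ∫⁻ y in Ioi (0 : ℝ), ENNReal.ofReal (min (y ^ (a - 1)) (y ^ (b - 1))) ≠ ∞ := by
  have h1 : ∫⁻ y in Ioc (0 : ℝ) 1, ENNReal.ofReal (y ^ (a - 1)) ≠ ∞ := by
    have : IntegrableOn (fun y : ℝ => y ^ (a - 1)) (Ioc 0 1) := by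
      have := intervalIntegral.intervalIntegrable_rpow' (a := 0) (b := 1) (r := a - 1) (by linarith)
      rwa [intervalIntegrable_iff_integrableOn_Ioc_of_le zero_le_one] at this
    exact this.lintegral_lt_top.ne
  have h2 : ∫⁻ y in Ioi (1 : ℝ), ENNReal.ofReal (y ^ (b - 1)) ≠ ∞ :=
    (integrableOn_Ioi_rpow_of_lt (by linarith) one_pos).lintegral_lt_top.ne
  rw [← Ioc_union_Ioi_eq_Ioi zero_le_one]
  refine ne_top_of_le_ne_top (ENNReal.add_ne_top.2 ⟨h1, h2⟩)
    ((lintegral_union_le _ _ _).trans (add_le_add ?_ ?_))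
  · exact lintegral_mono fun y => ENNReal.ofReal_le_ofReal (min_le_left _ _)
  · exact lintegral_mono fun y => ENNReal.ofReal_le_ofReal (min_le_right _ _)

/-- Hölder's inequality: elements of `L_{1-ν,q}` pair with functions that are `O(y^(-δ₁))` at
zero and `O(y^(-δ₂))` at infinity, `δ₁ < ν < δ₂`. -/
theorem exists_lintegral_mul_min_rpow_le {ν p q δ₁ δ₂ : ℝ} (hp : 1 < p) (hq : q = p / (p - 1))
    (h₁ : δ₁ < ν) (h₂ : ν < δ₂) :
    ∃ K : ℝ≥0∞, K ≠ ∞ ∧ ∀ φ : ℝ → ℂ, AEStronglyMeasurable φ (mellinWeight (1 - ν) q) →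
      ∫⁻ y in Ioi (0 : ℝ), ‖φ y‖ₑ * ENNReal.ofReal (min (y ^ (-δ₁)) (y ^ (-δ₂))) ≤
        K * eLpNorm φ (ENNReal.ofReal q) (mellinWeight (1 - ν) q) := by
  have hpq : p.HolderConjugate q := (Real.holderConjugate_iff_eq_conjExponent hp).2 hq
  have hq0 : 0 < q := hpq.symm.pos
  have hp0 : 0 < p := hpq.pos
  have hq0' : ENNReal.ofReal q ≠ 0 := by rw [Ne, ENNReal.ofReal_eq_zero]; linarith
  have hpq' : q * (p - 1) = p := by rw [hq]; field_simp [sub_ne_zero.2 hp.ne']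
  refine ⟨(∫⁻ y in Ioi (0 : ℝ),
    ENNReal.ofReal (min (y ^ ((ν - δ₁) * p - 1)) (y ^ ((ν - δ₂) * p - 1)))) ^ (1 / p), ?_, ?_⟩
  · exact ENNReal.rpow_ne_top_of_nonneg (by positivity)
      (lintegral_min_rpow_ne_top (mul_pos (by linarith) hp0)
        (mul_neg_of_neg_of_pos (by linarith) hp0))
  intro φ hφ
  set m : ℝ → ℝ≥0∞ := fun y => ENNReal.ofReal (min (y ^ (-δ₁)) (y ^ (-δ₂))) with hm
  set w : ℝ → ℝ≥0∞ := fun y => ENNReal.ofReal (y ^ (-((1 - ν) * q - 1))) with hw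
  have hmm : Measurable m := by
    refine Measurable.ennreal_ofReal ?_
    exact (measurable_id.pow_const _).min (measurable_id.pow_const _)
  have hwm : Measurable w := measurable_ofReal_rpow _
  have hold := ENNReal.lintegral_mul_le_Lp_mul_Lq (mellinWeight (1 - ν) q) hpq.symm hφ.enorm
    (hmm.mul hwm).aemeasurable
  have e1 : ∫⁻ y in Ioi (0 : ℝ), ‖φ y‖ₑ * m y =
      ∫⁻ y, ((fun y => ‖φ y‖ₑ) * (m * w)) y ∂mellinWeight (1 - ν) q := by
    rw [lintegral_mellinWeight]
    refine setLIntegral_congr_fun measurableSet_Ioi fun y hy => ?_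
    simp only [Pi.mul_apply]
    rw [mul_left_comm, mul_left_comm (ENNReal.ofReal _) (m y), hw,
      ← ENNReal.ofReal_mul (Real.rpow_nonneg (le_of_lt hy) _), ← Real.rpow_add hy]
    simp
  have e2 : ∫⁻ y, (m * w) y ^ p ∂mellinWeight (1 - ν) q = ∫⁻ y in Ioi (0 : ℝ),
      ENNReal.ofReal (min (y ^ ((ν - δ₁) * p - 1)) (y ^ ((ν - δ₂) * p - 1))) := by
    rw [lintegral_mellinWeight]
    refine setLIntegral_congr_fun measurableSet_Ioi fun y (hy : 0 < y) => ?_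
    have hmin : 0 ≤ min (y ^ (-δ₁)) (y ^ (-δ₂)) := by positivity
    simp only [Pi.mul_apply, hm, hw]
    rw [← ENNReal.ofReal_mul hmin, ENNReal.ofReal_rpow_of_nonneg (by positivity) hp0.le,
      ← ENNReal.ofReal_mul (by positivity)]
    congr 1
    have hmono : Monotone fun t : ℝ => max t 0 ^ p := fun a b hab =>
      Real.rpow_le_rpow (le_max_right _ _) (max_le_max_right _ hab) hp0.le
    have e3 : min (y ^ (-δ₁)) (y ^ (-δ₂)) ^ p = min (y ^ (-δ₁ * p)) (y ^ (-δ₂ * p)) := by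
      have := hmono.map_min (a := y ^ (-δ₁)) (b := y ^ (-δ₂))
      rw [max_eq_left hmin, max_eq_left (by positivity), max_eq_left (by positivity)] at this
      rw [this, Real.rpow_mul hy.le, Real.rpow_mul hy.le]
    have h0 : (1 - ν) * q - 1 + -((1 - ν) * q - 1) * p = ν * p - 1 := by
      linear_combination (-(1 - ν)) * hpq'
    rw [Real.mul_rpow hmin (by positivity), ← Real.rpow_mul hy.le, mul_left_comm,
      ← Real.rpow_add hy, h0, e3, min_mul_of_nonneg _ _ (by positivity), ← Real.rpow_add hy,
      ← Real.rpow_add hy]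
    congr 2 <;> ring
  rw [e1]
  refine hold.trans (le_of_eq ?_)
  rw [e2, mul_comm, eLpNorm_eq_lintegral_rpow_enorm_toReal hq0' ENNReal.ofReal_ne_top,
    ENNReal.toReal_ofReal hq0.le]

theorem norm_Gamma_le {s : ℂ} (hs : 0 < s.re) : ‖Complex.Gamma s‖ ≤ Real.Gamma s.re := by
  rw [Complex.Gamma_eq_integral hs, Complex.GammaIntegral, Real.Gamma_eq_integral hs]
  refine (norm_integral_le_integral_norm _).trans (le_of_eq ?_)
  refine setIntegral_congr_fun measurableSet_Ioi fun x hx => ?_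
  rw [norm_mul, Complex.norm_real, Real.norm_of_nonneg (Real.exp_pos _).le,
    Complex.norm_cpow_eq_rpow_re_of_pos hx]
  simp

theorem one_sub_vline (ν t : ℝ) : 1 - vline (1 - ν) t = ν - Complex.I * t := by
  simp [vline]
  ring

/-- Quadratic decay, from `Γ(z + 2) = (z + 1) z Γ(z)`; it is weaker than the true exponential
decay but puts `Γ(1 - s)` in every `L_q` of the line. -/
theorem norm_Gamma_one_sub_vline_le {ν : ℝ} (h0 : 0 < ν) (h1 : ν ≤ 1) (t : ℝ) :
    ‖Complex.Gamma (1 - vline (1 - ν) t)‖ ≤ Real.Gamma (ν + 2) / ν * (1 + t ^ 2)⁻¹ := by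
  rw [one_sub_vline]
  set z : ℂ := ν - Complex.I * t with hz
  have hre : z.re = ν := by simp [hz]
  have him : z.im = -t := by simp [hz]
  have hz0 : z ≠ 0 := fun h => by rw [h] at hre; simp at hre; linarith
  have hz1 : z + 1 ≠ 0 := fun h => by
    have := congrArg Complex.re h
    simp [hre] at this
    linarith
  have e : Complex.Gamma (z + 2) = (z + 1) * (z * Complex.Gamma z) := by
    rw [← Complex.Gamma_add_one z hz0, ← Complex.Gamma_add_one _ hz1]
    ring_nf
  have hb : ‖Complex.Gamma (z + 2)‖ ≤ Real.Gamma (ν + 2) := by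
    have := norm_Gamma_le (s := z + 2) (by simp [hre]; linarith)
    simpa [hre] using this
  have hprod : ν * (1 + t ^ 2) ≤ ‖z + 1‖ * ‖z‖ := by
    refine le_of_sq_le_sq ?_ (by positivity)
    rw [mul_pow (‖z + 1‖), Complex.sq_norm, Complex.sq_norm, Complex.normSq_apply,
      Complex.normSq_apply]
    simp only [Complex.add_re, Complex.add_im, Complex.one_re, Complex.one_im, hre, him]
    nlinarith [sq_nonneg t, mul_nonneg (sq_nonneg t) (sub_nonneg.2 (pow_le_one₀ (n := 2) h0.le h1)),
      mul_nonneg (sq_nonneg ν) (sq_nonneg t), sq_nonneg (t ^ 2), pow_pos h0 3, pow_pos h0 4,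
      mul_nonneg (pow_pos h0 3).le (sq_nonneg t), mul_nonneg h0.le (sq_nonneg t),
      mul_nonneg (sq_nonneg (t ^ 2)) (sub_nonneg.2 (pow_le_one₀ (n := 2) h0.le h1))]
  rw [e, norm_mul, norm_mul, ← mul_assoc] at hb
  rw [div_mul_eq_mul_div, ← div_eq_mul_inv, div_div, le_div_iff₀ (by positivity)]
  calc _ ≤ ‖Complex.Gamma z‖ * (‖z + 1‖ * ‖z‖) := by
        rw [mul_comm (1 + t ^ 2)]; gcongr
    _ ≤ _ := by rw [mul_comm]; exact hb

theorem continuous_Gamma_one_sub_vline {ν : ℝ} (h0 : 0 < ν) :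
    Continuous fun t : ℝ => Complex.Gamma (1 - vline (1 - ν) t) := by
  have h : ∀ t : ℝ, (1 - vline (1 - ν) t).re = ν := fun t => by simp
  refine continuous_iff_continuousAt.2 fun t => ?_
  refine ContinuousAt.comp (f := fun t : ℝ => 1 - vline (1 - ν) t) ?_
    (continuous_const.sub (continuous_vline _)).continuousAt
  refine (Complex.differentiableAt_Gamma _ fun m hm => ?_).continuousAt
  have := congrArg Complex.re hm
  rw [h] at this
  simp at this
  have := (Nat.cast_nonneg m : (0 : ℝ) ≤ m)
  linarith

theorem memLp_Gamma_one_sub_vline {ν q : ℝ} (h0 : 0 < ν) (h1 : ν ≤ 1) (hq : 1 ≤ q) :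
    MemLp (fun t : ℝ => Complex.Gamma (1 - vline (1 - ν) t)) (ENNReal.ofReal q) := by
  have hq0' : ENNReal.ofReal q ≠ 0 := by rw [Ne, ENNReal.ofReal_eq_zero]; linarith
  have hm := (continuous_Gamma_one_sub_vline h0).aestronglyMeasurable (μ := volume)
  rw [← integrable_norm_rpow_iff hm hq0' ENNReal.ofReal_ne_top,
    ENNReal.toReal_ofReal (by linarith)]
  refine (integrable_inv_one_add_sq.const_mul ((Real.Gamma (ν + 2) / ν) ^ q)).mono'
    (hm.norm.aemeasurable.pow_const q).aestronglyMeasurable (Eventually.of_forall fun t => ?_)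
  have hG : 0 ≤ Real.Gamma (ν + 2) / ν := by
    have := Real.Gamma_pos_of_pos (show 0 < ν + 2 by linarith)
    positivity
  rw [Real.norm_of_nonneg (by positivity)]
  calc _ ≤ (Real.Gamma (ν + 2) / ν * (1 + t ^ 2)⁻¹) ^ q := by
        gcongr
        exact norm_Gamma_one_sub_vline_le h0 h1 t
    _ = (Real.Gamma (ν + 2) / ν) ^ q * (1 + t ^ 2)⁻¹ ^ q :=
        Real.mul_rpow hG (by positivity)
    _ ≤ _ := by
        gcongr
        exact Real.rpow_le_self_of_le_one (by positivity)
          (inv_le_one_of_one_le₀ (by nlinarith [sq_nonneg t])) hq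

/-- The Laplace transform of `y^(-s)` is `Γ(1-s) x^(1-s)`, integrated over the line. -/
theorem integral_mellinInvLine_mul_exp {ν : ℝ} (h0 : 0 < ν) {h : ℝ → ℂ}
    (hh : Integrable h) {x : ℝ} (hx : 0 < x) :
    ((1 / x : ℝ) : ℂ) * ∫ y in Ioi (0 : ℝ), (Real.exp (-(y / x)) : ℂ) * mellinInvLine (1 - ν) h y =
      mellinInvLine (1 - ν) (fun t => h t * Complex.Gamma (1 - vline (1 - ν) t)) x := by
  have hxc : (x : ℂ) ≠ 0 := by exact_mod_cast hx.ne'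
  have hint : Integrable (Function.uncurry fun (y t : ℝ) =>
      (Real.exp (-(y / x)) : ℂ) * (h t * (y : ℂ) ^ (-vline (1 - ν) t)))
      ((volume.restrict (Ioi 0)).prod volume) := by
    have hG : IntegrableOn (fun y : ℝ => Real.exp (-(y / x)) * y ^ (-(1 - ν))) (Ioi 0) := by
      have := (Real.GammaIntegral_convergent h0)
      have := integrableOn_Ioi_comp_mul_left_iff (fun y : ℝ => Real.exp (-y) * y ^ (ν - 1)) 0
        (a := x⁻¹) (by positivity) |>.2 (by simpa using this)
      refine IntegrableOn.congr_fun (this.const_mul (x ^ (ν - 1))) (fun y (hy : 0 < y) => ?_)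
        measurableSet_Ioi
      rw [Real.mul_rpow (by positivity) hy.le, Real.inv_rpow hx.le, neg_sub,
        show x⁻¹ * y = y / x by ring]
      field_simp
    have hp := Integrable.mul_prod (show Integrable _ _ from hG.norm) hh.norm
    refine hp.mono ?_ ?_
    · refine AEStronglyMeasurable.mul ?_ (AEStronglyMeasurable.mul ?_ ?_)
      · refine Continuous.aestronglyMeasurable ?_
        fun_prop
      · exact hh.1.comp_snd
      · refine Measurable.aestronglyMeasurable ?_
        refine Measurable.pow (by fun_prop) ?_
        exact ((continuous_vline _).neg.comp continuous_snd).measurable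
    · have : ∀ᵐ z : ℝ × ℝ ∂((volume.restrict (Ioi (0 : ℝ))).prod volume), 0 < z.1 :=
        Measure.quasiMeasurePreserving_fst.ae (ae_restrict_mem measurableSet_Ioi)
      filter_upwards [this] with z hz
      simp only [Function.uncurry]
      rw [norm_mul, norm_mul, norm_cpow_vline _ _ hz, norm_mul, norm_norm, norm_norm, norm_mul,
        Complex.norm_real, Real.norm_of_nonneg (Real.rpow_nonneg hz.le _)]
      exact le_of_eq (by ring)
  have e1 : ∫ y in Ioi (0 : ℝ), (Real.exp (-(y / x)) : ℂ) * mellinInvLine (1 - ν) h y =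
      (1 / (2 * (Real.pi : ℂ))) * ∫ y in Ioi (0 : ℝ), ∫ t : ℝ,
        (Real.exp (-(y / x)) : ℂ) * (h t * (y : ℂ) ^ (-vline (1 - ν) t)) := by
    rw [← integral_const_mul]
    refine integral_congr_ae (Eventually.of_forall fun y => ?_)
    simp only [mellinInvLine]
    rw [integral_const_mul]
    ring
  rw [e1, integral_integral_swap hint, mellinInvLine, mul_left_comm, ← integral_const_mul]
  congr 2
  funext t
  have hre : 0 < (1 - vline (1 - ν) t).re := by simpa using h0
  have hG := Complex.integral_cpow_mul_exp_neg_mul_Ioi hre (inv_pos.2 hx)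
  have e2 : ∫ y in Ioi (0 : ℝ), (Real.exp (-(y / x)) : ℂ) * (h t * (y : ℂ) ^ (-vline (1 - ν) t)) =
      h t * ((1 / ((x⁻¹ : ℝ) : ℂ)) ^ (1 - vline (1 - ν) t) *
        Complex.Gamma (1 - vline (1 - ν) t)) := by
    rw [← hG, ← integral_const_mul]
    refine integral_congr_ae (Eventually.of_forall fun y => ?_)
    simp only
    push_cast
    rw [show -((y : ℂ) / x) = -((x : ℂ)⁻¹ * y) by ring,
      show 1 - vline (1 - ν) t - 1 = -vline (1 - ν) t by ring]
    ring
  rw [e2]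
  push_cast
  rw [one_div, one_div, inv_inv, sub_eq_add_neg, Complex.cpow_add _ _ hxc, Complex.cpow_one]
  field_simp

theorem exp_neg_div_le_min {x y : ℝ} (hx : 0 < x) (hy : 0 < y) :
    Real.exp (-(y / x)) ≤ (1 + x) * min (y ^ (-(0 : ℝ))) (y ^ (-(1 : ℝ))) := by
  rw [neg_zero, Real.rpow_zero, Real.rpow_neg_one, mul_min_of_nonneg _ _ (by linarith)]
  refine le_min ?_ ?_
  · have : Real.exp (-(y / x)) ≤ 1 := Real.exp_le_one_iff.2 (by
      have : 0 < y / x := by positivity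
      linarith)
    linarith
  · rw [Real.exp_neg, ← div_eq_mul_inv, inv_le_comm₀ (Real.exp_pos _) (by positivity), inv_div]
    have h1 := Real.add_one_le_exp (y / x)
    have h2 : y / (1 + x) ≤ y / x := by gcongr; linarith
    linarith

/-- The integrability form of `exists_lintegral_mul_min_rpow_le`. -/
theorem integrableOn_mul_of_le_min {ν p q δ₁ δ₂ K : ℝ} (hp : 1 < p) (hq : q = p / (p - 1))
    (h₁ : δ₁ < ν) (h₂ : ν < δ₂) {φ g : ℝ → ℂ}
    (hφ : MemLp φ (ENNReal.ofReal q) (mellinWeight (1 - ν) q))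
    (hg : AEStronglyMeasurable g (volume.restrict (Ioi 0)))
    (hgb : ∀ y, 0 < y → ‖g y‖ ≤ K * min (y ^ (-δ₁)) (y ^ (-δ₂))) :
    IntegrableOn (fun y => g y * φ y) (Ioi 0) := by
  obtain ⟨C, hC, H⟩ := exists_lintegral_mul_min_rpow_le hp hq h₁ h₂
  have hφm : AEStronglyMeasurable φ (volume.restrict (Ioi 0)) :=
    hφ.1.mono_ac (absolutelyContinuous_mellinWeight _ _)
  refine ⟨hg.mul hφm, ?_⟩
  have hb : ∫⁻ y in Ioi (0 : ℝ), ‖g y * φ y‖ₑ ≤ ENNReal.ofReal K *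
      ∫⁻ y in Ioi (0 : ℝ), ‖φ y‖ₑ * ENNReal.ofReal (min (y ^ (-δ₁)) (y ^ (-δ₂))) := by
    rw [← lintegral_const_mul' _ _ ENNReal.ofReal_ne_top]
    refine setLIntegral_mono_ae' measurableSet_Ioi (Eventually.of_forall fun y (hy : 0 < y) => ?_)
    have hmin : 0 ≤ min (y ^ (-δ₁)) (y ^ (-δ₂)) := by positivity
    rw [enorm_mul, mul_left_comm, mul_comm, ← ENNReal.ofReal_mul' hmin]
    gcongr
    rw [← ofReal_norm]
    exact ENNReal.ofReal_le_ofReal (hgb y hy)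
  refine hb.trans_lt (ENNReal.mul_lt_top ENNReal.ofReal_lt_top ((H φ hφ.1).trans_lt ?_))
  exact ENNReal.mul_lt_top hC.lt_top hφ.2

/-- The Laplace average of the limit in mean of the inverse Mellin integrals of `ψ` is the
(absolutely convergent) inverse Mellin integral of `ψ(s) Γ(1-s)`. -/
theorem integral_limit_mul_exp {ν p q : ℝ} (h0 : 0 < ν) (h1 : ν < 1) (hp : 1 < p)
    (hq : q = p / (p - 1)) {ψ φ : ℝ → ℂ} (hψ : MemLp ψ (ENNReal.ofReal p))
    (hφ : MemLp φ (ENNReal.ofReal q) (mellinWeight (1 - ν) q))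
    (hlim : Tendsto (fun T : ℝ => eLpNorm (mellinInvLine (1 - ν) ((Ioc (-T) T).indicator ψ) - φ)
        (ENNReal.ofReal q) (mellinWeight (1 - ν) q)) atTop (𝓝 0))
    (hF : Integrable fun t => ψ t * Complex.Gamma (1 - vline (1 - ν) t))
    {x : ℝ} (hx : 0 < x) :
    ((1 / x : ℝ) : ℂ) * ∫ y in Ioi (0 : ℝ), (Real.exp (-(y / x)) : ℂ) * φ y =
      mellinInvLine (1 - ν) (fun t => ψ t * Complex.Gamma (1 - vline (1 - ν) t)) x := by
  obtain ⟨C, hC, H⟩ := exists_lintegral_mul_min_rpow_le hp hq h0 h1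
  set σ := 1 - ν with hσ
  set h : ℝ → ℝ → ℂ := fun T => (Ioc (-T) T).indicator ψ with hh
  have hI : ∀ T, Integrable (h T) := fun T => by
    rw [hh, integrable_indicator_iff measurableSet_Ioc]
    exact (hψ.restrict _).integrable (by rw [ENNReal.one_le_ofReal]; exact hp.le)
  have hem : Continuous fun y : ℝ => (Real.exp (-(y / x)) : ℂ) := by fun_prop
  have heb : ∀ y, 0 < y → ‖(Real.exp (-(y / x)) : ℂ)‖ ≤
      (1 + x) * min (y ^ (-(0 : ℝ))) (y ^ (-(1 : ℝ))) := fun y hy => by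
    rw [Complex.norm_real, Real.norm_of_nonneg (Real.exp_pos _).le]
    exact exp_neg_div_le_min hx hy
  have hφI : IntegrableOn (fun y => (Real.exp (-(y / x)) : ℂ) * φ y) (Ioi 0) :=
    integrableOn_mul_of_le_min hp hq h0 h1 hφ hem.aestronglyMeasurable heb
  have hmeas : ∀ T, AEStronglyMeasurable (mellinInvLine σ (h T) - φ) (mellinWeight σ q) := fun T =>
    (aestronglyMeasurable_mellinInvLine σ q (hI T)).sub hφ.1
  have hmem : ∀ᶠ T in atTop, MemLp (mellinInvLine σ (h T)) (ENNReal.ofReal q)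
      (mellinWeight σ q) := by
    filter_upwards [hlim.eventually (gt_mem_nhds ENNReal.zero_lt_top)] with T hT
    have := MemLp.add (f := mellinInvLine σ (h T) - φ) ⟨hmeas T, hT⟩ hφ
    rwa [sub_add_cancel] at this
  have hlhs : Tendsto (fun T => ∫ y in Ioi (0 : ℝ),
      (Real.exp (-(y / x)) : ℂ) * mellinInvLine σ (h T) y) atTop
      (𝓝 (∫ y in Ioi (0 : ℝ), (Real.exp (-(y / x)) : ℂ) * φ y)) := by
    refine tendsto_integral_of_L1 _ hφI.1 ?_ ?_
    · filter_upwards [hmem] with T hT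
      exact integrableOn_mul_of_le_min hp hq h0 h1 hT hem.aestronglyMeasurable heb
    · have hz : Tendsto (fun T => ENNReal.ofReal (1 + x) * (C * eLpNorm (mellinInvLine σ (h T) - φ)
          (ENNReal.ofReal q) (mellinWeight σ q))) atTop (𝓝 0) := by
        have := ENNReal.Tendsto.const_mul (a := ENNReal.ofReal (1 + x))
          (ENNReal.Tendsto.const_mul (a := C) hlim (Or.inr hC)) (Or.inr ENNReal.ofReal_ne_top)
        simpa using this
      refine tendsto_of_tendsto_of_tendsto_of_le_of_le tendsto_const_nhds hz
        (fun _ => zero_le) fun T => ?_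
      simp only
      refine le_trans ?_ (mul_le_mul_right (H _ (hmeas T)) _)
      rw [← lintegral_const_mul' _ _ ENNReal.ofReal_ne_top]
      refine setLIntegral_mono_ae' measurableSet_Ioi
        (Eventually.of_forall fun y (hy : 0 < y) => ?_)
      rw [← mul_sub, enorm_mul, mul_left_comm, mul_comm,
        ← ENNReal.ofReal_mul (by linarith)]
      simp only [Pi.sub_apply]
      gcongr
      rw [← ofReal_norm]
      exact ENNReal.ofReal_le_ofReal (heb y hy)
  have hrhs : Tendsto (fun T => mellinInvLine σ (fun t => h T t *
      Complex.Gamma (1 - vline σ t)) x) atTop (𝓝 (mellinInvLine σ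
        (fun t => ψ t * Complex.Gamma (1 - vline σ t)) x)) := by
    simp only [mellinInvLine]
    refine Tendsto.const_mul _ ?_
    have hFx : Integrable fun t => ψ t * Complex.Gamma (1 - vline σ t) *
        (x : ℂ) ^ (-vline σ t) := by
      refine hF.mul_bdd (c := x ^ (-σ)) ?_
        (Eventually.of_forall fun t => (norm_cpow_vline σ t hx).le)
      refine Continuous.aestronglyMeasurable ?_
      exact (continuous_vline σ).neg.const_cpow (Or.inl (by exact_mod_cast hx.ne'))
    have := intervalIntegral_tendsto_integral hFx tendsto_neg_atTop_atBot tendsto_id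
    refine this.congr' ?_
    filter_upwards [eventually_ge_atTop 0] with T hT
    rw [intervalIntegral.integral_of_le (by simp; linarith), id,
      ← integral_indicator measurableSet_Ioc]
    congr 1
    funext t
    by_cases ht : t ∈ Ioc (-T) T <;> simp [hh, ht]
  refine tendsto_nhds_unique (hlhs.const_mul _) (hrhs.congr fun T => ?_)
  exact (integral_mellinInvLine_mul_exp h0 (hI T) hx).symm

/-! ### Uniqueness for Mellin transforms convergent in mean -/

theorem continuous_exp_two_pi_mul : Continuous fun u : ℝ => Real.exp (2 * Real.pi * u) := by
  fun_prop

/-- The function `u ↦ f(e^(2 π u)) e^(2 π σ u)` whose Fourier transform is the Mellin transform of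
`f` on `Re s = σ`, up to normalization. -/
noncomputable def logProfile (f : ℝ → ℂ) (σ u : ℝ) : ℂ :=
  f (Real.exp (2 * Real.pi * u)) * (Real.exp (2 * Real.pi * σ * u) : ℂ)

theorem locallyIntegrable_logProfile {f : ℝ → ℂ} (hf : LocallyIntegrableOn f (Ioi 0)) (σ : ℝ) :
    LocallyIntegrable (logProfile f σ) := by
  rw [locallyIntegrable_iff]
  intro K hK
  have hpi := Real.pi_pos
  have himg : IntegrableOn f ((fun u : ℝ => Real.exp (2 * Real.pi * u)) '' K) := by
    refine hf.integrableOn_compact_subset ?_ (hK.image continuous_exp_two_pi_mul)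
    rw [← image_exp_two_pi_mul]
    exact image_mono (subset_univ K)
  rw [integrableOn_image_iff_integrableOn_abs_deriv_smul hK.measurableSet
    (fun ξ _ => (hasDerivAt_exp_two_pi_mul ξ).hasDerivWithinAt)
      (injective_exp_two_pi_mul.injOn)] at himg
  have hc : ContinuousOn (fun u : ℝ => ((1 / (2 * Real.pi) * Real.exp (-(2 * Real.pi * u)) *
      Real.exp (2 * Real.pi * σ * u) : ℝ) : ℂ)) K := by
    fun_prop
  refine (himg.mul_continuousOn hc hK).congr_fun (fun u _ => ?_) hK.measurableSet
  have h : 2 * Real.pi * Real.exp (2 * Real.pi * u) * (1 / (2 * Real.pi) *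
      Real.exp (-(2 * Real.pi * u)) * Real.exp (2 * Real.pi * σ * u)) =
      Real.exp (2 * Real.pi * σ * u) := by
    rw [Real.exp_neg (2 * Real.pi * u)]
    have := Real.exp_pos (2 * Real.pi * u)
    generalize Real.exp (2 * Real.pi * u) = a at *
    field_simp
  beta_reduce
  rw [logProfile, Complex.real_smul, abs_of_pos (by positivity), mul_right_comm,
    ← Complex.ofReal_mul, h, mul_comm]

/-- A truncated Mellin transform is the Fourier transform of a compactly supported function. -/
theorem integral_Ioc_mul_cpow (f : ℝ → ℂ) (σ t a : ℝ) :
    ∫ x in Ioc (Real.exp (2 * Real.pi * a))⁻¹ (Real.exp (2 * Real.pi * a)),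
        f x * (x : ℂ) ^ (vline σ t - 1) =
      2 * Real.pi * 𝓕 ((Ioc (-a) a).indicator (logProfile f σ)) (-t) := by
  have hpi := Real.pi_pos
  have himg : Ioc (Real.exp (2 * Real.pi * a))⁻¹ (Real.exp (2 * Real.pi * a)) =
      (fun u : ℝ => Real.exp (2 * Real.pi * u)) '' Ioc (-a) a := by
    ext x
    rw [← Real.exp_neg]
    constructor
    · intro hx
      have hx0 : 0 < x := (Real.exp_pos _).trans hx.1
      obtain ⟨u, -, rfl⟩ : x ∈ (fun u : ℝ => Real.exp (2 * Real.pi * u)) '' univ := by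
        rw [image_exp_two_pi_mul]; exact hx0
      refine ⟨u, ⟨?_, ?_⟩, rfl⟩
      · have := Real.exp_lt_exp.1 hx.1
        rw [← mul_neg] at this
        exact lt_of_mul_lt_mul_left this (by positivity)
      · exact le_of_mul_le_mul_left (Real.exp_le_exp.1 hx.2) (by positivity)
    · rintro ⟨u, hu, rfl⟩
      refine ⟨Real.exp_lt_exp.2 ?_, Real.exp_le_exp.2 ?_⟩
      · rw [← mul_neg]
        exact mul_lt_mul_of_pos_left hu.1 (by positivity)
      · exact mul_le_mul_of_nonneg_left hu.2 (by positivity)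
  rw [himg, integral_image_eq_integral_abs_deriv_smul measurableSet_Ioc
    (fun ξ _ => (hasDerivAt_exp_two_pi_mul ξ).hasDerivWithinAt)
      (injective_exp_two_pi_mul.injOn), Real.fourier_real_eq_integral_exp_smul,
    ← integral_indicator measurableSet_Ioc, ← integral_const_mul]
  congr 1
  funext u
  by_cases hu : u ∈ Ioc (-a) a
  · rw [indicator_of_mem hu, indicator_of_mem hu, logProfile, ofReal_exp_cpow, Complex.real_smul,
      abs_of_pos (by positivity), Complex.ofReal_mul, Complex.ofReal_exp, Complex.ofReal_exp,
      smul_eq_mul]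
    rw [show Complex.exp (((2 * Real.pi * u : ℝ) : ℂ) * (vline σ t - 1)) =
      Complex.exp (-((2 * Real.pi * u : ℝ) : ℂ)) * Complex.exp ((2 * Real.pi * σ * u : ℝ)) *
        Complex.exp (((-2 * Real.pi * u * -t : ℝ) : ℂ) * Complex.I) by
      rw [← Complex.exp_add, ← Complex.exp_add, vline]
      congr 1
      push_cast
      ring]
    have : Complex.exp ((2 * Real.pi * u : ℝ) : ℂ) * Complex.exp (-((2 * Real.pi * u : ℝ) : ℂ))
        = 1 := by rw [← Complex.exp_add, add_neg_cancel, Complex.exp_zero]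
    push_cast at this ⊢
    linear_combination (2 * (Real.pi : ℂ) * f (Real.exp (2 * Real.pi * u)) *
      Complex.exp (2 * Real.pi * σ * u) * Complex.exp (-2 * Real.pi * u * -t * Complex.I)) * this
  · rw [indicator_of_notMem hu, indicator_of_notMem hu, smul_zero, mul_zero]

/-- A function whose Mellin transform converges in mean to an integrable function on a line is
the inverse Mellin integral of that function: both sides have the same pairing with test
functions, by Hölder's inequality on the Fourier side. -/
theorem ae_eq_mellinInvLine {f : ℝ → ℂ} {σ : ℝ} {fstar : ℂ → ℂ}
    (hM : IsMellinTransformOnLine f σ fstar)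
    (hF : Integrable fun t : ℝ => fstar (vline σ t)) :
    ∀ᵐ x ∂volume.restrict (Ioi (0 : ℝ)), f x = mellinInvLine σ (fun t => fstar (vline σ t)) x := by
  obtain ⟨hloc, hFm, r, hr, hlim⟩ := hM
  have hpi := Real.pi_pos
  have hpic : (Real.pi : ℂ) ≠ 0 := by exact_mod_cast hpi.ne'
  set F : ℝ → ℂ := fun t => fstar (vline σ t) with hFdef
  have hGloc := locallyIntegrable_logProfile hloc σ
  set G := logProfile f σ with hG
  set Gt : ℝ → ℝ → ℂ := fun a => (Ioc (-a) a).indicator G with hGt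
  have hGtI : ∀ a, Integrable (Gt a) := fun a => by
    rw [hGt, integrable_indicator_iff measurableSet_Ioc]
    exact (hGloc.integrableOn_isCompact isCompact_Icc).mono_set Ioc_subset_Icc_self
  have hexp : Tendsto (fun a : ℝ => Real.exp (2 * Real.pi * a)) atTop atTop :=
    Real.tendsto_exp_atTop.comp (tendsto_id.const_mul_atTop (by positivity))
  set M : ℝ → ℝ → ℂ := fun a t => 2 * Real.pi * 𝓕 (Gt a) (-t) with hMdef
  have hMc : ∀ a, Continuous (M a) := fun a =>
    continuous_const.mul ((continuous_fourier_of_integrable (hGtI a)).comp continuous_neg)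
  have hlim' : Tendsto (fun a => eLpNorm (fun t => M a t - F t) r volume) atTop (𝓝 0) := by
    refine (hlim.comp hexp).congr fun a => ?_
    simp only [Function.comp_apply, integral_Ioc_mul_cpow, hMdef, hFdef, hGt, hG]
  have hae : ∀ᵐ u, G u = (1 / (2 * (Real.pi : ℂ))) * 𝓕 F u := by
    refine ae_eq_of_integral_contDiff_smul_eq hGloc
      ((continuous_const.mul (continuous_fourier_of_integrable hF)).locallyIntegrable)
      fun g g_smooth g_cpt => ?_
    have hg₁ : HasCompactSupport (Complex.ofRealCLM ∘ g) := g_cpt.comp_left rfl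
    have hg₂ : ContDiff ℝ ((⊤ : ℕ∞) : WithTop ℕ∞) (Complex.ofRealCLM ∘ g) := by fun_prop
    set χ : 𝓢(ℝ, ℂ) := hg₁.toSchwartzMap hg₂
    have hχ : ∀ x, χ x = (g x : ℂ) := fun x => rfl
    set η : 𝓢(ℝ, ℂ) := 𝓕⁻ χ with hη
    have hη1 : 𝓕 (η : ℝ → ℂ) = χ := by
      rw [← SchwartzMap.fourier_coe, hη, FourierTransform.fourier_fourierInv_eq]
    have hη2 : ∀ t, η (-t) = 𝓕 (χ : ℝ → ℂ) t := fun t => by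
      rw [hη, SchwartzMap.fourierInv_coe, Real.fourierInv_eq_fourier_neg, neg_neg]
    have hθm : MemLp (fun t => η (-t)) r.conjExponent volume := by
      have := (𝓕 χ).memLp r.conjExponent volume
      refine this.ae_eq (Eventually.of_forall fun t => ?_)
      beta_reduce
      rw [hη2, SchwartzMap.fourier_coe]
    have hθI : Integrable fun t => η (-t) := (η.integrable (μ := volume)).comp_neg
    have hconj : r.HolderConjugate r.conjExponent := .conjExponent hr
    -- Parseval's formula for the truncated function, with `η` the inverse transform of `χ`
    have hint : ∀ a, ∫ t, M a t * η (-t) = 2 * Real.pi * ∫ u, Gt a u * χ u := fun a => by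
      rw [← hη1, ← integral_fourier_mul_eq_of_integrable (hGtI a) η.integrable,
        ← integral_neg_eq_self (fun t => 𝓕 (Gt a) t * η t), ← integral_const_mul]
      simp only [hMdef, mul_assoc]
    have hconv : Tendsto (fun a => ∫ t, M a t * η (-t)) atTop (𝓝 (∫ t, F t * η (-t))) := by
      refine tendsto_integral_of_L1 _ (hF.1.mul hθI.1) (Eventually.of_forall fun a => ?_) ?_
      · refine hθI.bdd_mul (c := 2 * Real.pi * ∫ u, ‖Gt a u‖) (hMc a).aestronglyMeasurable
          (Eventually.of_forall fun t => ?_)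
        rw [hMdef]
        simp only
        rw [norm_mul]
        have := norm_fourier_le_integral_norm (Gt a) (-t)
        have h2 : ‖(2 * Real.pi : ℂ)‖ = 2 * Real.pi := by
          rw [norm_mul, Complex.norm_real, Real.norm_of_nonneg hpi.le]; simp
        rw [h2]
        gcongr
      · have hz : Tendsto (fun a => eLpNorm (fun t => M a t - F t) r volume *
            eLpNorm (fun t => η (-t)) r.conjExponent volume) atTop (𝓝 0) := by
          have := ENNReal.Tendsto.mul_const hlim' (Or.inr hθm.2.ne)
          rwa [zero_mul] at this
        refine tendsto_of_tendsto_of_tendsto_of_le_of_le tendsto_const_nhds hz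
          (fun _ => zero_le) fun a => ?_
        simp only
        have := eLpNorm_smul_le_mul_eLpNorm (p := r) (q := r.conjExponent) (r := 1) hθm.1
          ((hMc a).aestronglyMeasurable.sub hF.1)
        rw [eLpNorm_one_eq_lintegral_enorm] at this
        refine le_trans (le_of_eq (lintegral_congr fun t => ?_)) this
        simp [sub_mul]
    have hev : ∀ᶠ a in atTop, ∫ u, Gt a u * χ u = ∫ u, g u • G u := by
      obtain ⟨R, hR⟩ := g_cpt.isCompact.isBounded.subset_closedBall 0
      filter_upwards [eventually_gt_atTop R] with a ha
      refine integral_congr_ae (Eventually.of_forall fun u => ?_)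
      simp only [hχ, hGt, Complex.real_smul]
      by_cases hu : u ∈ Ioc (-a) a
      · rw [indicator_of_mem hu, mul_comm]
      · have : g u = 0 := by
          by_contra hne
          have h1 := hR (subset_tsupport g hne)
          rw [mem_closedBall_zero_iff, Real.norm_eq_abs] at h1
          have h2 := abs_lt.1 (h1.trans_lt ha)
          exact hu ⟨h2.1, h2.2.le⟩
        simp [this]
    have h1 : 2 * Real.pi * ∫ u, g u • G u = ∫ t, F t * η (-t) := by
      refine tendsto_nhds_unique ?_ hconv
      refine tendsto_const_nhds.congr' ?_
      filter_upwards [hev] with a ha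
      rw [hint, ha]
    have h2 : ∫ t, F t * η (-t) = ∫ u, 𝓕 F u * χ u := by
      rw [integral_fourier_mul_eq_of_integrable hF χ.integrable]
      simp only [hη2]
    have h3 : ∫ u, g u • (1 / (2 * (Real.pi : ℂ)) * 𝓕 F u) =
        1 / (2 * (Real.pi : ℂ)) * ∫ u, 𝓕 F u * χ u := by
      rw [← integral_const_mul]
      refine integral_congr_ae (Eventually.of_forall fun u => ?_)
      simp only [hχ, Complex.real_smul]
      ring
    rw [h3, ← h2, ← h1]
    field_simp
  have hnull := addHaar_image_eq_zero_of_differentiableOn_of_addHaar_eq_zero volume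
    (s := {u | ¬ G u = (1 / (2 * (Real.pi : ℂ))) * 𝓕 F u})
    (fun ξ _ => (hasDerivAt_exp_two_pi_mul ξ).differentiableAt.differentiableWithinAt) hae
  rw [ae_restrict_iff' measurableSet_Ioi]
  have hcompl : ∀ᵐ x, x ∉ (fun u : ℝ => Real.exp (2 * Real.pi * u)) ''
      {u | ¬ G u = (1 / (2 * (Real.pi : ℂ))) * 𝓕 F u} := measure_eq_zero_iff_ae_notMem.1 hnull
  filter_upwards [hcompl] with x hx hx0
  obtain ⟨u, -, rfl⟩ : x ∈ (fun u : ℝ => Real.exp (2 * Real.pi * u)) '' univ := by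
    rw [image_exp_two_pi_mul]; exact hx0
  have hu : G u = (1 / (2 * (Real.pi : ℂ))) * 𝓕 F u := by
    by_contra hne
    exact hx ⟨u, hne, rfl⟩
  have hc : ((1 / (2 * Real.pi) : ℝ) : ℂ) * 𝓕 F u = G u := by
    rw [hu]
    push_cast
    rfl
  beta_reduce
  rw [mellinInvLine_exp, Complex.ofReal_mul, mul_right_comm (Complex.ofReal _), hc, hG, logProfile,
    mul_assoc (f _), ← Complex.ofReal_mul, ← Real.exp_add, add_neg_cancel, Real.exp_zero,
    Complex.ofReal_one, mul_one]

/-! ### The index transform as a Lebedev transform -/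

/-- Joint integrability behind the interchange of the Laplace average of `φ` with the index
transform: it comes down to the decay `|kernel(x)| ≤ C x^(-δ)` for two exponents `δ` on either
side of `ν`. -/
theorem integrable_skalskayaKernel_mul_exp {ν p q : ℝ} (h0 : 0 < ν) (h1 : ν < 1 / 2) (hp : 1 < p)
    (hq : q = p / (p - 1)) {φ : ℝ → ℂ}
    (hφ : MemLp φ (ENNReal.ofReal q) (mellinWeight (1 - ν) q)) (τ : ℝ) :
    Integrable (Function.uncurry fun x y : ℝ =>
      ((Real.exp (-(y / x)) / x : ℝ) : ℂ) * (skalskayaKernel τ x : ℂ) * φ y)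
      ((volume.restrict (Ioi 0)).prod (volume.restrict (Ioi 0))) := by
  have hφm : AEStronglyMeasurable φ (volume.restrict (Ioi 0)) :=
    hφ.1.mono_ac (absolutelyContinuous_mellinWeight _ _)
  have hkm := aestronglyMeasurable_skalskayaKernel τ
  have hem : Measurable fun z : ℝ × ℝ => ((Real.exp (-(z.2 / z.1)) / z.1 : ℝ) : ℂ) := by fun_prop
  have hJm : AEStronglyMeasurable (Function.uncurry fun x y : ℝ =>
      ((Real.exp (-(y / x)) / x : ℝ) : ℂ) * (skalskayaKernel τ x : ℂ) * φ y)
      ((volume.restrict (Ioi 0)).prod (volume.restrict (Ioi 0))) :=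
    (hem.aestronglyMeasurable.mul hkm.comp_fst).mul hφm.comp_snd
  have hcosh := Real.cosh_pos (Real.pi * τ)
  have hbd : ∀ δ : ℝ, 0 < δ → δ ≤ 1 / 2 → ∀ x y : ℝ, 0 < x →
      ‖((Real.exp (-(y / x)) / x : ℝ) : ℂ) * (skalskayaKernel τ x : ℂ) * φ y‖ ≤
        2 * Real.cosh (Real.pi * τ) * ‖φ y‖ * (Real.exp (-(y / x)) * x ^ (-δ - 1)) := by
    intro δ hδ hδ' x y hx
    rw [norm_mul, norm_mul, Complex.norm_real, Complex.norm_real,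
      Real.norm_of_nonneg (by positivity), Real.norm_eq_abs, Real.rpow_sub_one hx.ne']
    calc _ ≤ Real.exp (-(y / x)) / x * (2 * Real.cosh (Real.pi * τ) * x ^ (-δ)) * ‖φ y‖ := by
          gcongr
          exact abs_skalskayaKernel_le_rpow τ hδ.le hδ' hx
      _ = _ := by ring
  -- the integral over `x` of this majorant is a Gamma integral
  have hrow : ∀ δ : ℝ, 0 < δ → δ ≤ 1 / 2 → ∀ y : ℝ, 0 < y →
      ∫ x in Ioi (0 : ℝ), ‖((Real.exp (-(y / x)) / x : ℝ) : ℂ) * (skalskayaKernel τ x : ℂ) * φ y‖ ≤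
        2 * Real.cosh (Real.pi * τ) * ‖φ y‖ * (Real.Gamma δ * y ^ (-δ)) := by
    intro δ hδ hδ' y hy
    obtain ⟨hI, hv⟩ := integral_exp_neg_div_mul_rpow hδ hy
    rw [← hv, ← integral_const_mul]
    refine integral_mono_of_nonneg (Eventually.of_forall fun x => norm_nonneg _)
      (hI.const_mul _) ?_
    filter_upwards [ae_restrict_mem measurableSet_Ioi] with x hx
    exact hbd δ hδ hδ' x y hx
  set K := 2 * Real.cosh (Real.pi * τ) * max (Real.Gamma (ν / 2)) (Real.Gamma (1 / 2)) with hK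
  have hg1 : 0 < Real.Gamma (ν / 2) := Real.Gamma_pos_of_pos (by linarith)
  have hmax : 0 < max (Real.Gamma (ν / 2)) (Real.Gamma (1 / 2)) := lt_max_of_lt_left hg1
  have hK0 : 0 ≤ K := by positivity
  have hdom : IntegrableOn (fun y => ((K * min (y ^ (-(ν / 2))) (y ^ (-(1 / 2 : ℝ))) : ℝ) : ℂ) * φ y)
      (Ioi 0) := by
    refine integrableOn_mul_of_le_min (δ₁ := ν / 2) (δ₂ := 1 / 2) (K := K) hp hq (by linarith) h1
      hφ ?_ fun y hy => ?_
    · have : Measurable fun y : ℝ => ((K * min (y ^ (-(ν / 2))) (y ^ (-(1 / 2 : ℝ))) : ℝ) : ℂ) := by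
        fun_prop
      exact this.aestronglyMeasurable
    · rw [Complex.norm_real, Real.norm_of_nonneg (by positivity)]
  refine (integrable_prod_iff' hJm).2 ⟨?_, ?_⟩
  · filter_upwards [ae_restrict_mem measurableSet_Ioi] with y (hy : 0 < y)
    obtain ⟨hI, -⟩ := integral_exp_neg_div_mul_rpow (δ := 1 / 2) (by norm_num) hy
    refine (hI.const_mul (2 * Real.cosh (Real.pi * τ) * ‖φ y‖)).mono' ?_ ?_
    · have : Measurable fun x : ℝ => ((Real.exp (-(y / x)) / x : ℝ) : ℂ) := by fun_prop
      exact (this.aestronglyMeasurable.mul hkm).mul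
        (aestronglyMeasurable_const (b := φ y))
    · filter_upwards [ae_restrict_mem measurableSet_Ioi] with x hx
      exact hbd _ (by norm_num) le_rfl x y hx
  · refine (show Integrable _ _ from hdom.norm).mono' hJm.prod_swap.norm.integral_prod_right' ?_
    filter_upwards [ae_restrict_mem measurableSet_Ioi] with y (hy : 0 < y)
    rw [Real.norm_of_nonneg (integral_nonneg fun x => norm_nonneg _), norm_mul, Complex.norm_real,
      Real.norm_of_nonneg (by positivity), hK, mul_min_of_nonneg _ _ (by positivity),
      min_mul_of_nonneg _ _ (norm_nonneg _)]
    refine le_min ?_ ?_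
    · refine (hrow (ν / 2) (by linarith) (by linarith) y hy).trans ?_
      rw [mul_right_comm _ ‖φ y‖, ← mul_assoc]
      gcongr
      exact le_max_left _ _
    · refine (hrow (1 / 2) (by norm_num) le_rfl y hy).trans ?_
      rw [mul_right_comm _ ‖φ y‖, ← mul_assoc]
      gcongr
      exact le_max_right _ _

/-- If `f` is the Laplace average of `φ`, its index transform is the Lebedev transform of `φ`. -/
theorem indexF_eq_lebedevTransform {ν p q : ℝ} (h0 : 0 < ν) (h1 : ν < 1 / 2) (hp : 1 < p)
    (hq : q = p / (p - 1)) {f φ : ℝ → ℂ}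
    (hφ : MemLp φ (ENNReal.ofReal q) (mellinWeight (1 - ν) q))
    (hf : ∀ᵐ x ∂volume.restrict (Ioi (0 : ℝ)),
      f x = ((1 / x : ℝ) : ℂ) * ∫ y in Ioi (0 : ℝ), (Real.exp (-(y / x)) : ℂ) * φ y) (τ : ℝ) :
    IntegrableOn (fun x => (skalskayaKernel τ x : ℂ) * f x) (Ioi 0) ∧
      IntegrableOn (fun x => lebedevKernel τ x * φ x) (Ioi 0) ∧
      indexF f τ = lebedevTransform φ τ := by
  have hJ := integrable_skalskayaKernel_mul_exp h0 h1 hp hq hφ τ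
  have e1 : (fun x => ∫ y in Ioi (0 : ℝ), Function.uncurry (fun x y : ℝ =>
      ((Real.exp (-(y / x)) / x : ℝ) : ℂ) * (skalskayaKernel τ x : ℂ) * φ y) (x, y))
      =ᵐ[volume.restrict (Ioi 0)] fun x => (skalskayaKernel τ x : ℂ) * f x := by
    filter_upwards [hf] with x hx
    rw [hx, ← integral_const_mul, ← integral_const_mul]
    refine integral_congr_ae (Eventually.of_forall fun y => ?_)
    simp only [Function.uncurry_apply_pair]
    push_cast
    ring
  have e2 : (fun y => ∫ x in Ioi (0 : ℝ), Function.uncurry (fun x y : ℝ =>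
      ((Real.exp (-(y / x)) / x : ℝ) : ℂ) * (skalskayaKernel τ x : ℂ) * φ y) (x, y))
      =ᵐ[volume.restrict (Ioi 0)] fun y => 2 * (lebedevKernel τ y * φ y) := by
    filter_upwards [ae_restrict_mem measurableSet_Ioi] with y hy
    simp only [Function.uncurry_apply_pair]
    rw [integral_mul_const, integral_skalskayaKernel τ hy, mul_assoc]
  have hi1 := hJ.integral_prod_left.congr e1
  have hi2 := hJ.integral_prod_right.congr e2
  have hi2' : IntegrableOn (fun x => lebedevKernel τ x * φ x) (Ioi 0) := by
    refine (hi2.const_mul (1 / 2)).congr (Eventually.of_forall fun y => ?_)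
    ring
  refine ⟨hi1, hi2', ?_⟩
  have hswap := integral_integral_swap hJ
  have e3 : ∫ x in Ioi (0 : ℝ), (skalskayaKernel τ x : ℂ) * f x =
      2 * ∫ y in Ioi (0 : ℝ), lebedevKernel τ y * φ y := by
    rw [← integral_congr_ae e1, ← integral_const_mul, ← integral_congr_ae e2]
    exact hswap
  rw [indexF, lebedevTransform, e3]
  push_cast
  ring

theorem theorem1 :
    -- `F` is a bounded operator from `L_1(ℝ_+)` to the bounded continuous functions on `ℝ`
    (∃ T : (Lp ℂ 1 (volume.restrict (Ioi (0 : ℝ)))) →L[ℂ] (ℝ →ᵇ ℂ),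
      ∀ (f : ℝ → ℂ) (hf : Integrable f (volume.restrict (Ioi (0 : ℝ)))),
        (∀ τ : ℝ, IntegrableOn (fun x => (skalskayaKernel τ x : ℂ) * f x) (Ioi 0)) ∧
        (∀ τ : ℝ, T (hf.toL1 f) τ = indexF f τ) ∧
        ‖T (hf.toL1 f)‖ = ⨆ τ : ℝ, ‖indexF f τ‖ ∧
        ‖T (hf.toL1 f)‖ ≤ Real.sqrt Real.pi * ∫ x in Ioi (0 : ℝ), ‖f x‖) ∧
    -- the representation of `F f` as a Lebedev transform
    (∀ (ν p q : ℝ) (f : ℝ → ℂ) (fstar : ℂ → ℂ),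
      0 < ν → ν < 1 / 2 → 1 < p → p ≤ 2 → q = p / (p - 1) →
      IsMellinTransformOnLine f (1 - ν) fstar →
      MemLp (fun t : ℝ => fstar (vline (1 - ν) t) / Complex.Gamma (1 - vline (1 - ν) t))
        (ENNReal.ofReal p) volume →
      ∃ φ : ℝ → ℂ,
        MemLp φ (ENNReal.ofReal q) (mellinWeight (1 - ν) q) ∧
        Tendsto (fun T : ℝ => eLpNorm
            (fun x => truncMellinInv (1 - ν) (fun s => fstar s / Complex.Gamma (1 - s)) T x - φ x)
            (ENNReal.ofReal q) (mellinWeight (1 - ν) q)) atTop (𝓝 0) ∧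
        ∀ τ : ℝ,
          IntegrableOn (fun x => (skalskayaKernel τ x : ℂ) * f x) (Ioi 0) ∧
          IntegrableOn (fun x => lebedevKernel τ x * φ x) (Ioi 0) ∧
          indexF f τ = lebedevTransform φ τ) := by
  refine ⟨exists_indexF_operator, fun ν p q f fstar h0 h1 hp hp2 hq hM hψ => ?_⟩
  have hpq : p.HolderConjugate q := (Real.holderConjugate_iff_eq_conjExponent hp).2 hq
  obtain ⟨φ, hφ, hlim⟩ := exists_tendsto_mellinInvLine (1 - ν) hp hp2 hq hψ
  have e : (fun t : ℝ => fstar (vline (1 - ν) t) / Complex.Gamma (1 - vline (1 - ν) t) *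
      Complex.Gamma (1 - vline (1 - ν) t)) = fun t : ℝ => fstar (vline (1 - ν) t) := by
    funext t
    exact div_mul_cancel₀ _ (Complex.Gamma_ne_zero_of_re_pos (by simpa using h0))
  -- `f^*(s)` is the product of a function in `L_p` and `Γ(1 - s)`, which lies in `L_q`
  have : (ENNReal.ofReal p).HolderTriple (ENNReal.ofReal q) 1 :=
    hpq.ennrealOfReal
  have hF := hψ.integrable_mul
    (memLp_Gamma_one_sub_vline h0 (by linarith) hpq.symm.lt.le)
  refine ⟨φ, hφ, ?_, indexF_eq_lebedevTransform h0 h1 hp hq hφ ?_⟩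
  · refine hlim.congr fun T => ?_
    rw [truncMellinInv_eq_mellinInvLine]
    rfl
  · have hFi : Integrable fun t : ℝ => fstar (vline (1 - ν) t) := by
      rw [← e]
      exact hF
    filter_upwards [ae_eq_mellinInvLine hM hFi, ae_restrict_mem measurableSet_Ioi] with x hx hx0
    rw [hx, integral_limit_mul_exp h0 (by linarith) hp hq hψ hφ hlim hF hx0, e]
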